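/- **Setting.** Let $N\ge1$, $D\ge0$, $\mathcal X=\mathbb Z_N^D$; $d_H$ is the Hamming distance and $x^{d\leftarrow n}$ is $x$ with its $d$-th entry replaced by $n$. Let $\gamma:[0,1]\to[0,\infty)$ be continuous and positive almost everywhere, $w:[0,1]\to[0,\infty)$ integrable and positive almost everywhere, $f$ strictly convex and differentiable on $(0,\infty)$, $D_f(a\|b)=f(a)-f(b)-(a-b)f'(b)$. Let $\mu,\nu$ be probability vectors on $\mathcal X$ with $\nu>0$ everywhere. The reference rate is $r_t(y,x)=\gamma_t/N$ if $d_H(x,y)=1$, $r_t(x,x)=-\gamma_tD(1-\frac1N)$, and $0$ otherwise, with transition kernel $p^r_{t|s}(y|x)$ and bridge $p^r_{t|0,1}(x|x_0,x_1)=p^r_{t|0}(x|x_0)p^r_{1|t}(x_1|x)/p^r_{1|0}(x_1|x_0)$; $p^r$ is the path measure of the Markov chain with rate $r$ started from $\mu$. A path measure is a probability measure on $\mathcal X^{[0,1]}$ with the product $\sigma$-algebra, and $\mathrm{KL}$ is the Kullback–Leibler divergence. A *controller* is a family of positive numbers $\varPhi_t(x)_{d,n}$, continuous in $t\in[0,1]$,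 and a *corrector* a family of positive numbers $\widehat\varPhi(x)_{d,n}$ ($x\in\mathcal X$, $1\le d\le D$, $n\in\mathbb Z_N$), both normalized to be $1$ at $n=x^d$. For a controller $\varPhi$ let $p^{r\varPhi}$ be the path measure of the chain started from $\mu$ whose rate from $x$ to $x^{d\leftarrow n}\neq x$ is $r_t(x^{d\leftarrow n},x)\varPhi_t(x)_{d,n}$ (other jumps have rate $0$). For $\psi:\mathcal X\to(0,\infty)$ of the form $\psi(x)=\sum_yp^r_{1|0}(x|y)\psi_0(y)$ with $\psi_0\ge0$, put $\psi_t(x)=\sum_yp^r_{t|0}(x|y)\psi_0(y)$ and let $q^\psi$ be the path measure of the chain started from $\nu$ at time $1$ and run backward in time with backward rate $\frac{\psi_t(y)}{\psi_t(x)}r_t(x,y)$ from $x$ to $y\ne x$. For a corrector $\widehat\varPhi$ the *controller adjoint-matching loss* is $$\int_0^1w_t\,\mathbb E\sum_{d}\sum_{n\ne x^d}D_f\Big(\tfrac{\nu(x_1^{d\leftarrow x_1^d+n-x^d})}{\nu(x_1)}\Big/\widehat\varPhi(x_1)_{d,\,x_1^d+n-x^d}\,\Big\|\,\varPhi_t(x)_{d,n}\Big)dt,\qquad(x,x_1)\sim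 p_{t,1};$$ $\varPhi$ is a *fixed point* if it minimizes this loss over all controllers when $p=p^{r\varPhi}$ is held fixed. In the *bridge version* one samples instead $(x_0,x_1)\sim p_{0,1}$, $x\sim p^r_{t|0,1}(\cdot|x_0,x_1)$. For a controller $\varPhi$ with $p=p^{r\varPhi}$, the *corrector adjoint-matching* (AM) loss of $\widehat\varPhi$ is $\mathbb E_{(x_0,x_1)\sim p_{0,1}}\sum_d\sum_{n\ne x_1^d}D_f\big(\frac{\mu(x_0^{d\leftarrow m})}{\mu(x_0)}/\varPhi_0(x_0)_{d,m}\big\|\widehat\varPhi(x_1)_{d,n}\big)$ with $m=x_0^d+n-x_1^d$, and the *corrector denoising-matching* (DM) loss is $\int_0^1w_t\,\mathbb E\sum_d\sum_{n\ne x_1^d}D_f\big(\frac{p^r_{1|t}(x_1^{d\leftarrow n}|x)}{p^r_{1|t}(x_1|x)}\big\|\widehat\varPhi(x_1)_{d,n}\big)dt$ with $(x_0,x_1)\sim p_{0,1}$, $x\sim p^r_{t|0,1}(\cdot|x_0,x_1)$. **Theorem.** There are controllers $\varPhi^{(k)}$ ($k\ge1$), correctors $\widehat\varPhi^{(k)}$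 and functions $\widehat\varphi_1^{(k)}:\mathcal X\to(0,\infty)$ ($k\ge0$) such that $\widehat\varPhi^{(0)}\equiv1$, $\widehat\varPhi^{(k)}(x)_{d,n}=\widehat\varphi^{(k)}_1(x^{d\leftarrow n})/\widehat\varphi^{(k)}_1(x)$, the path measures $q^{\widehat\varphi_1^{(k)}}$ and $p^{r\varPhi^{(k)}}$ exist, and for every $k\ge1$: 1. $\varPhi^{(k)}$ is the unique fixed point of the controller adjoint-matching loss with corrector $\widehat\varPhi^{(k-1)}$. It is also a fixed point of the bridge version, its path measure has the reference bridges ($p^{r\varPhi}_{0,t,1}=p^{r\varPhi}_{0,1}\,p^r_{t|0,1}$ for all $t$), and it is the only fixed point of the bridge version with this property. Its path measure $p^{r\varPhi^{(k)}}$ solves the forward half-bridge problem $\min_{p:\,p_0=\mu}\mathrm{KL}(p\|q^{\widehat\varphi_1^{(k-1)}})$ over all path measures $p$. 2. For $p=p^{r\varPhi^{(k)}}$, $\widehat\varPhi^{(k)}$ is the unique minimizer over all correctors of the DM loss (provided this loss is finite for at least one corrector), and, if $\mu>0$ everywhere, also the unique minimizer of the AM loss. The path measure $q^{\widehat\varphi^{(k)}_1}$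 solves the backward half-bridge problem $\min_{q:\,q_1=\nu}\mathrm{KL}(p^{r\varPhi^{(k)}}\|q)$ over all path measures $q$. Moreover the alternating scheme converges: there is a controller $\varPhi^\star$ such that $p^\star=p^{r\varPhi^\star}$ solves the Schrödinger bridge problem $\min_{p:\,p_0=\mu,\,p_1=\nu}\mathrm{KL}(p\|p^r)$ over all path measures, and $\mathrm{KL}(p^\star\|p^{r\varPhi^{(k)}})\to0$ and $\mathrm{KL}(p^\star\|q^{\widehat\varphi_1^{(k)}})\to0$ as $k\to\infty$. -/

import Mathlib

open MeasureTheory Set Filter Topology InformationTheory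
open scoped ENNReal unitInterval

noncomputable section

namespace DASBS

/-! ### State space, paths, Kolmogorov equations, path measures -/

/-- The state space: sequences of length `D` over the cyclic group of integers modulo `N`. -/
abbrev State (N D : ℕ) : Type := Fin D → ZMod N

/-- Paths indexed by `[0,1]`, with the sigma-algebra generated by the coordinates.
A path measure is a probability measure on this space. -/
abbrev PathSpace (N D : ℕ) : Type := I → State N D

/-- `x` with its `d`-th entry replaced by `n`. -/
abbrev upd {N D : ℕ} (x : State N D) (d : Fin D) (n : ZMod N) : State N D := Function.update x d n

variable {N D : ℕ} [NeZero N]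

/-- A rate `u t y x` is the rate of jumping from `x` to `y` at time `t`. From the off-diagonal
entries this fills in the diagonal, so that each column sums to zero. -/
def rateMatrix (off : ℝ → State N D → State N D → ℝ) (t : ℝ) (y x : State N D) : ℝ :=
  if y = x then -∑ z ∈ Finset.univ.filter (fun z => z ≠ x), off t z x else off t y x

/-- `K s t y x` is the probability of being in `y` at time `t` given `x` at time `s ≤ t`, for
the forward rate `u`: it solves the Kolmogorov forward equation. -/
def IsForwardKernel (u : ℝ → State N D → State N D → ℝ)
    (K : ℝ → ℝ → State N D → State N D → ℝ) : Prop :=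
  (∀ s ∈ Icc (0 : ℝ) 1, ∀ y x, K s s y x = if y = x then 1 else 0) ∧
  (∀ s ∈ Icc (0 : ℝ) 1, ∀ y x, ContinuousOn (fun t => K s t y x) (Icc s 1)) ∧
  (∀ s ∈ Icc (0 : ℝ) 1, ∀ t ∈ Ioo s 1, ∀ y x,
    HasDerivAt (fun t' => K s t' y x) (∑ z, u t y z * K s t z x) t)

/-- `K t s y x` is the probability of being in `y` at time `s` given `x` at time `t ≥ s`, for
the backward rate `u`: it solves the Kolmogorov equation run backward in time. -/
def IsBackwardKernel (u : ℝ → State N D → State N D → ℝ)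
    (K : ℝ → ℝ → State N D → State N D → ℝ) : Prop :=
  (∀ t ∈ Icc (0 : ℝ) 1, ∀ y x, K t t y x = if y = x then 1 else 0) ∧
  (∀ t ∈ Icc (0 : ℝ) 1, ∀ y x, ContinuousOn (fun s => K t s y x) (Icc 0 t)) ∧
  (∀ t ∈ Icc (0 : ℝ) 1, ∀ s ∈ Ioo 0 t, ∀ y x,
    HasDerivAt (fun s' => K t s' y x) (-∑ z, u s y z * K t s z x) s)

/-- `P` is the path measure of the continuous-time Markov chain with forward rate `u`
started at time `0` from the probability vector `μ`. -/
def IsForwardCTMC (μ : State N D → ℝ) (u : ℝ → State N D → State N D → ℝ)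
    (P : Measure (PathSpace N D)) : Prop :=
  IsProbabilityMeasure P ∧ ∃ K, IsForwardKernel u K ∧
    ∀ (n : ℕ) (t : Fin (n + 1) → I) (x : Fin (n + 1) → State N D), Monotone t → t 0 = 0 →
      P {ω | ∀ i, ω (t i) = x i} = ENNReal.ofReal
        (μ (x 0) * ∏ i : Fin n, K (t i.castSucc) (t i.succ) (x i.succ) (x i.castSucc))

/-- `Q` is the path measure of the continuous-time Markov chain with backward rate `u`
started at time `1` from the probability vector `ν` and run backward in time. -/
def IsBackwardCTMC (ν : State N D → ℝ) (u : ℝ → State N D → State N D → ℝ)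
    (Q : Measure (PathSpace N D)) : Prop :=
  IsProbabilityMeasure Q ∧ ∃ K, IsBackwardKernel u K ∧
    ∀ (n : ℕ) (t : Fin (n + 1) → I) (x : Fin (n + 1) → State N D), Antitone t → t 0 = 1 →
      Q {ω | ∀ i, ω (t i) = x i} = ENNReal.ofReal
        (ν (x 0) * ∏ i : Fin n, K (t i.castSucc) (t i.succ) (x i.succ) (x i.castSucc))

/-- The marginal of `P` at time `t` is the probability vector `μ`. -/
def HasMarginal (P : Measure (PathSpace N D)) (t : I) (μ : State N D → ℝ) : Prop :=
  ∀ x, P {ω | ω t = x} = ENNReal.ofReal (μ x)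

/-- Probability vectors on the state space. -/
def IsProbVec (μ : State N D → ℝ) : Prop := (∀ x, 0 ≤ μ x) ∧ ∑ x, μ x = 1

/-! ### The reference dynamics -/

/-- The uniform reference rate with noise schedule `γ`. -/
def refRate (γ : ℝ → ℝ) (t : ℝ) (y x : State N D) : ℝ :=
  if hammingDist y x = 1 then γ t / N
  else if y = x then -(γ t * D * (1 - 1 / N)) else 0

/-- One-coordinate probability of moving to a given other value between times `s` and `t`. -/
def refA (N : ℕ) (γ : ℝ → ℝ) (s t : ℝ) : ℝ := (1 - Real.exp (-∫ v in s..t, γ v)) / N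

/-- One-coordinate probability of seeing the same value at times `s` and `t`. -/
def refB (N : ℕ) (γ : ℝ → ℝ) (s t : ℝ) : ℝ :=
  (1 + (N - 1) * Real.exp (-∫ v in s..t, γ v)) / N

/-- The reference transition probability from `x` at time `s` to `y` at time `t`, in closed
form; `isForwardKernel_refKernel` below shows that it belongs to the rate `refRate γ`. -/
def refKernel (γ : ℝ → ℝ) (s t : ℝ) (y x : State N D) : ℝ :=
  refA N γ s t ^ hammingDist x y * refB N γ s t ^ (D - hammingDist x y)

set_option linter.unusedSectionVars false in
/-- The closed form as a product over the coordinates. -/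
theorem refKernel_eq_prod (γ : ℝ → ℝ) (s t : ℝ) (y x : State N D) :
    refKernel γ s t y x = ∏ d, if y d = x d then refB N γ s t else refA N γ s t := by
  have hc : (Finset.univ.filter fun d => ¬ (y d = x d)).card = hammingDist x y := by
    rw [hammingDist_comm]; rfl
  have hs : (Finset.univ.filter fun d => y d = x d).card = D - hammingDist x y := by
    have h := Finset.card_filter_add_card_filter_not (s := (Finset.univ : Finset (Fin D)))
      (fun d => y d = x d)
    rw [hc, Finset.card_univ, Fintype.card_fin] at h
    omega
  rw [Finset.prod_ite, Finset.prod_const, Finset.prod_const, hc, hs, mul_comm]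
  rfl

/-- Sums over the states at Hamming distance `1`. -/
theorem sum_hammingDist_one (y : State N D) (g : State N D → ℝ) :
    (∑ z, if hammingDist y z = 1 then g z else 0) =
      ∑ d, ∑ n ∈ Finset.univ.filter (fun n => n ≠ y d), g (upd y d n) := by
  have key : ∀ z, (if hammingDist y z = 1 then g z else 0) =
      ∑ d, ∑ n ∈ Finset.univ.filter (fun n => n ≠ y d), if upd y d n = z then g z else 0 := by
    intro z
    split_ifs with h
    · obtain ⟨d, hd⟩ := Finset.card_eq_one.mp h
      have hne : ∀ j, y j ≠ z j ↔ j = d := by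
        intro j
        have := Finset.ext_iff.mp hd j
        simpa using this
      have hzd : z d ∈ Finset.univ.filter (fun n => n ≠ y d) :=
        Finset.mem_filter.mpr ⟨Finset.mem_univ _, ((hne d).mpr rfl).symm⟩
      rw [Finset.sum_eq_single d, Finset.sum_eq_single_of_mem (z d) hzd]
      · rw [if_pos]
        funext j
        by_cases hj : j = d
        · subst hj; simp
        · rw [upd, Function.update_of_ne hj]
          by_contra hh
          exact hj ((hne j).mp hh)
      · intro n _ hn
        rw [if_neg]
        intro hh
        exact hn (by rw [← hh]; simp)
      · intro j _ hj
        refine Finset.sum_eq_zero fun n hn => ?_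
        rw [if_neg]
        intro hh
        have h1 : z j = n := by rw [← hh]; simp
        have h2 : n ≠ y j := (Finset.mem_filter.mp hn).2
        exact hj ((hne j).mp (by rw [h1]; exact h2.symm))
      · intro hh
        exact absurd (Finset.mem_univ _) hh
    · symm
      refine Finset.sum_eq_zero fun d _ => Finset.sum_eq_zero fun n hn => ?_
      rw [if_neg]
      intro hh
      apply h
      have h2 : n ≠ y d := (Finset.mem_filter.mp hn).2
      refine Finset.card_eq_one.mpr ⟨d, ?_⟩
      ext j
      rw [← hh]
      by_cases hj : j = d
      · subst hj; simpa using h2.symm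
      · simp [hj, upd]
  rw [Finset.sum_congr rfl fun z _ => key z, Finset.sum_comm]
  refine Finset.sum_congr rfl fun d _ => ?_
  rw [Finset.sum_comm]
  refine Finset.sum_congr rfl fun n _ => ?_
  simp

/-- The closed form is the transition kernel of the reference rate. -/
theorem isForwardKernel_refKernel (γ : ℝ → ℝ) (hγ : ContinuousOn γ (Icc 0 1)) :
    IsForwardKernel (refRate γ) (refKernel γ : ℝ → ℝ → State N D → State N D → ℝ) := by
  have hN : (N : ℝ) ≠ 0 := Nat.cast_ne_zero.mpr (NeZero.ne N)
  have hint : ∀ s ∈ Icc (0 : ℝ) 1, ContinuousOn (fun t => ∫ v in s..t, γ v) (Icc s 1) := by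
    intro s hs
    have h1 : IntervalIntegrable γ volume s 1 := by
      apply ContinuousOn.intervalIntegrable
      rw [uIcc_of_le hs.2]
      exact hγ.mono (Icc_subset_Icc_left hs.1)
    have h2 := intervalIntegral.continuousOn_primitive_interval' h1 left_mem_uIcc
    rwa [uIcc_of_le hs.2] at h2
  refine ⟨?_, ?_, ?_⟩
  · intro s _ y x
    rw [refKernel_eq_prod]
    have hA : refA N γ s s = 0 := by simp [refA]
    have hB : refB N γ s s = 1 := by simp [refB, hN]
    rw [hA, hB]
    by_cases h : y = x
    · simp [h]
    · rw [if_neg h]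
      obtain ⟨d, hd⟩ := Function.ne_iff.mp h
      exact Finset.prod_eq_zero (Finset.mem_univ d) (by simp [hd])
  · intro s hs y x
    have hi := hint s hs
    simp only [refKernel, refA, refB]
    fun_prop
  · intro s hs t ht y x
    have hd : HasDerivAt (fun t' => ∫ v in s..t', γ v) (γ t) t := by
      apply intervalIntegral.integral_hasDerivAt_right
      · apply ContinuousOn.intervalIntegrable
        rw [uIcc_of_le ht.1.le]
        exact hγ.mono (Icc_subset_Icc hs.1 ht.2.le)
      · exact ContinuousOn.stronglyMeasurableAtFilter isOpen_Ioo
          (hγ.mono Ioo_subset_Icc_self) t ⟨hs.1.trans_lt ht.1, ht.2⟩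
      · exact hγ.continuousAt (Icc_mem_nhds (hs.1.trans_lt ht.1) ht.2)
    have hA : HasDerivAt (fun t' => refA N γ s t') (γ t * (1 / N - refA N γ s t)) t := by
      have := (((hd.neg).exp).const_sub 1).div_const (N : ℝ)
      refine this.congr_deriv ?_
      simp only [refA]; field_simp; simp only [Pi.neg_apply]; ring
    have hB : HasDerivAt (fun t' => refB N γ s t') (γ t * (1 / N - refB N γ s t)) t := by
      have := ((((hd.neg).exp).const_mul ((N : ℝ) - 1)).const_add 1).div_const (N : ℝ)
      refine this.congr_deriv ?_
      simp only [refB]; field_simp; simp only [Pi.neg_apply]; ring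
    set k : ZMod N → ZMod N → ℝ → ℝ := fun a b t' => if a = b then refB N γ s t' else refA N γ s t'
      with hk
    have hkd : ∀ a b, HasDerivAt (k a b) (γ t * (1 / N - k a b t)) t := by
      intro a b
      by_cases h : a = b
      · simpa [hk, h] using hB
      · simpa [hk, h] using hA
    have hsum : ∀ b, ∑ a, k a b t = 1 := by
      intro b
      have h1 : ∀ a, k a b t = refA N γ s t + if a = b then refB N γ s t - refA N γ s t else 0 := by
        intro a
        by_cases h : a = b <;> simp [hk, h]
      rw [Finset.sum_congr rfl fun a _ => h1 a, Finset.sum_add_distrib]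
      simp only [Finset.sum_const, Finset.card_univ, ZMod.card, Finset.sum_ite_eq',
        Finset.mem_univ, if_true, nsmul_eq_mul, refA, refB]
      field_simp
      ring
    have hprod : ∀ t' z, refKernel γ s t' z x = ∏ d, k (z d) (x d) t' := fun t' z =>
      refKernel_eq_prod γ s t' z x
    have hder := HasDerivAt.fun_finsetProd (u := (Finset.univ : Finset (Fin D)))
      (f := fun d => k (y d) (x d)) (fun d _ => hkd (y d) (x d))
    simp only [hprod]
    refine hder.congr_deriv ?_
    set E : Fin D → ℝ := fun d => ∏ j ∈ Finset.univ.erase d, k (y j) (x j) t with hE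
    have hupd : ∀ d n, ∏ j, k (upd y d n j) (x j) t = E d * k n (x d) t := by
      intro d n
      rw [← Finset.prod_erase_mul _ _ (Finset.mem_univ d)]
      congr 1
      · refine Finset.prod_congr rfl fun j hj => ?_
        rw [upd, Function.update_of_ne (Finset.ne_of_mem_erase hj)]
      · simp
    have hfull : ∀ d, ∏ j, k (y j) (x j) t = E d * k (y d) (x d) t := fun d =>
      (Finset.prod_erase_mul _ _ (Finset.mem_univ d)).symm
    have hrate : ∀ z, refRate γ t y z * ∏ d, k (z d) (x d) t =
        (if hammingDist y z = 1 then γ t / N * ∏ d, k (z d) (x d) t else 0) +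
          if y = z then -(γ t * D * (1 - 1 / N)) * ∏ d, k (z d) (x d) t else 0 := by
      intro z
      unfold refRate
      by_cases h1 : hammingDist y z = 1
      · have : y ≠ z := by rintro rfl; simp at h1
        simp [h1, this]
      · by_cases h2 : y = z <;> simp [h1, h2]
    rw [Finset.sum_congr rfl fun z _ => hrate z, Finset.sum_add_distrib,
      sum_hammingDist_one y fun z => γ t / N * ∏ d, k (z d) (x d) t]
    have hin : ∀ d, ∑ n ∈ Finset.univ.filter (fun n => n ≠ y d),
        γ t / N * ∏ j, k (upd y d n j) (x j) t =
        γ t / N * (E d - ∏ j, k (y j) (x j) t) := by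
      intro d
      have h1 : ∑ n, γ t / N * ∏ j, k (upd y d n j) (x j) t = γ t / N * E d := by
        simp only [hupd]
        rw [← Finset.mul_sum, ← Finset.mul_sum, hsum, mul_one]
      have h2 := Finset.sum_filter_add_sum_filter_not Finset.univ (fun n => n ≠ y d)
        (fun n => γ t / N * ∏ j, k (upd y d n j) (x j) t)
      rw [h1] at h2
      have h3 : (Finset.univ.filter fun n => ¬ (n ≠ y d)) = {y d} := by ext n; simp
      rw [h3, Finset.sum_singleton, show upd y d (y d) = y from Function.update_eq_self _ _] at h2
      linarith
    simp only [hin]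
    simp only [Finset.sum_ite_eq, Finset.mem_univ, if_true, smul_eq_mul]
    have hD : (D : ℝ) = ∑ _d : Fin D, (1 : ℝ) := by simp
    rw [hD, Finset.mul_sum, Finset.sum_mul, ← Finset.sum_neg_distrib, Finset.sum_mul,
      ← Finset.sum_add_distrib]
    refine Finset.sum_congr rfl fun d _ => ?_
    rw [hfull d]
    simp only [hE]
    field_simp
    ring

/-- The reference bridge: probability of `x` at time `t`, given `x₀` at time `0` and `x₁` at
time `1`. -/
def refBridge (γ : ℝ → ℝ) (t : ℝ) (x x₀ x₁ : State N D) : ℝ :=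
  refKernel γ 0 t x x₀ * refKernel γ t 1 x₁ x / refKernel γ 0 1 x₁ x₀

/-- The bridges of `P` between times `0` and `1` are the reference bridges (at one time). -/
def HasRefBridges (γ : ℝ → ℝ) (P : Measure (PathSpace N D)) : Prop :=
  ∀ (t : I) (x x₀ x₁ : State N D), P {ω | ω 0 = x₀ ∧ ω t = x ∧ ω 1 = x₁} =
    P {ω | ω 0 = x₀ ∧ ω 1 = x₁} * ENNReal.ofReal (refBridge γ t x x₀ x₁)

/-! ### Controllers, correctors and the path measures they induce -/

/-- Controllers: positive matrices depending continuously on time. The entries `n = x d`, which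
no rate and no loss involves, are normalized to `1`. -/
def IsController (Φ : ℝ → State N D → Fin D → ZMod N → ℝ) : Prop :=
  ∀ x d n, ContinuousOn (fun t => Φ t x d n) (Icc 0 1) ∧
    ∀ t ∈ Icc (0 : ℝ) 1, 0 < Φ t x d n ∧ (n = x d → Φ t x d n = 1)

/-- Correctors: positive matrices, with the same normalization. -/
def IsCorrector (Φh : State N D → Fin D → ZMod N → ℝ) : Prop :=
  ∀ x d n, 0 < Φh x d n ∧ (n = x d → Φh x d n = 1)

/-- The controlled rate: `r_t(x^{d←n}, x) Φ_t(x)_{d,n}` for the jump from `x` to `x^{d←n} ≠ x`,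
and `0` for all jumps that change more than one entry. -/
def ctrlRate (γ : ℝ → ℝ) (Φ : ℝ → State N D → Fin D → ZMod N → ℝ) :
    ℝ → State N D → State N D → ℝ :=
  rateMatrix fun t y x => ∑ d, ∑ n ∈ Finset.univ.filter (fun n => n ≠ x d),
    if y = upd x d n then refRate γ t y x * Φ t x d n else 0

/-- The function `ψ_t(x) = ∑_y p^r_{t|0}(x|y) ψ₀(y)`. -/
def evolve (γ : ℝ → ℝ) (ψ₀ : State N D → ℝ) (t : ℝ) (x : State N D) : ℝ :=
  ∑ y, refKernel γ 0 t x y * ψ₀ y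

/-- The path measure `q^ψ`: it starts at time `1` from `ν` and has the backward rate
`ψ_t(y) / ψ_t(x) * r_t(x, y)` from `x` to `y`, where `ψ_t` evolves under the reference dynamics
from a nonnegative `ψ₀` to `ψ_1 = ψ`. -/
def IsInducedBy (γ : ℝ → ℝ) (ν ψ : State N D → ℝ) (Q : Measure (PathSpace N D)) : Prop :=
  ∃ ψ₀ : State N D → ℝ, (∀ x, 0 ≤ ψ₀ x) ∧ (∀ x, evolve γ ψ₀ 1 x = ψ x) ∧
    IsBackwardCTMC ν
      (rateMatrix fun t y x => evolve γ ψ₀ t y / evolve γ ψ₀ t x * refRate γ t x y) Q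

/-! ### The losses -/

/-- The Bregman divergence of `f`. -/
def bregman (f : ℝ → ℝ) (a b : ℝ) : ℝ := f a - f b - (a - b) * deriv f b

/-- Integrand of the controller adjoint-matching loss. The regression target is the discrete
score of `ν` at `x₁` divided by the entry of the previous corrector `Φh` at `x₁`, both at the
shifted value `x₁ d + n - x d`. -/
def ctrlAMTerm (f : ℝ → ℝ) (ν : State N D → ℝ) (Φh : State N D → Fin D → ZMod N → ℝ)
    (Φ : ℝ → State N D → Fin D → ZMod N → ℝ) (t : ℝ) (x x₁ : State N D) : ℝ≥0∞ :=
  ∑ d, ∑ n ∈ Finset.univ.filter (fun n => n ≠ x d), ENNReal.ofReal (bregman f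
    (ν (upd x₁ d (x₁ d + n - x d)) / ν x₁ / Φh x₁ d (x₁ d + n - x d)) (Φ t x d n))

/-- The controller adjoint-matching loss of `Φ`, where `(x, x₁)` is sampled from the marginal of
the path measure `P` at times `t` and `1`. -/
def ctrlAMLoss (w f : ℝ → ℝ) (ν : State N D → ℝ) (Φh : State N D → Fin D → ZMod N → ℝ)
    (P : Measure (PathSpace N D)) (Φ : ℝ → State N D → Fin D → ZMod N → ℝ) : ℝ≥0∞ :=
  ∫⁻ t : I, ENNReal.ofReal (w t) * ∫⁻ ω, ctrlAMTerm f ν Φh Φ t (ω t) (ω 1) ∂P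

/-- The controller adjoint-matching loss of `Φ`, where `(x₀, x₁)` is sampled from the endpoints
of the path measure `P`, and `x` from the reference bridge between them. -/
def ctrlAMBridgeLoss (γ w f : ℝ → ℝ) (ν : State N D → ℝ)
    (Φh : State N D → Fin D → ZMod N → ℝ) (P : Measure (PathSpace N D))
    (Φ : ℝ → State N D → Fin D → ZMod N → ℝ) : ℝ≥0∞ :=
  ∫⁻ t : I, ENNReal.ofReal (w t) * ∫⁻ ω, ∑ x,
    ENNReal.ofReal (refBridge γ t x (ω 0) (ω 1)) * ctrlAMTerm f ν Φh Φ t x (ω 1) ∂P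

/-- The corrector adjoint-matching loss of `Φh`, for the controller `Φ` and its path measure `P`.
The regression target is the ratio of `μ` at `x₀` divided by the entry of `Φ_0` at `x₀`, both at
the shifted value `x₀ d + n - x₁ d`. -/
def corrAMLoss (f : ℝ → ℝ) (μ : State N D → ℝ) (Φ : ℝ → State N D → Fin D → ZMod N → ℝ)
    (P : Measure (PathSpace N D)) (Φh : State N D → Fin D → ZMod N → ℝ) : ℝ≥0∞ :=
  ∫⁻ ω, ∑ d, ∑ n ∈ Finset.univ.filter (fun n => n ≠ ω 1 d), ENNReal.ofReal (bregman f
    (μ (upd (ω 0) d (ω 0 d + n - ω 1 d)) / μ (ω 0) / Φ 0 (ω 0) d (ω 0 d + n - ω 1 d))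
    (Φh (ω 1) d n)) ∂P

/-- The corrector denoising-matching loss of `Φh`, for the path measure `P` of a controller:
`(x₀, x₁)` is sampled from the endpoints of `P` and `x` from the reference bridge. -/
def corrDMLoss (γ w f : ℝ → ℝ) (P : Measure (PathSpace N D))
    (Φh : State N D → Fin D → ZMod N → ℝ) : ℝ≥0∞ :=
  ∫⁻ t : I, ENNReal.ofReal (w t) * ∫⁻ ω, ∑ x,
    ENNReal.ofReal (refBridge γ t x (ω 0) (ω 1)) *
      ∑ d, ∑ n ∈ Finset.univ.filter (fun n => n ≠ ω 1 d), ENNReal.ofReal (bregman f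
        (refKernel γ t 1 (upd (ω 1) d n) x / refKernel γ t 1 (ω 1) x) (Φh (ω 1) d n)) ∂P

/-- `Φ` is a fixed point of the controller adjoint-matching loss: it minimizes the loss in which
the samples come from its own path measure. -/
def IsCtrlFixedPoint (γ w f : ℝ → ℝ) (μ ν : State N D → ℝ)
    (Φh : State N D → Fin D → ZMod N → ℝ) (Φ : ℝ → State N D → Fin D → ZMod N → ℝ) : Prop :=
  IsController Φ ∧ ∃ P, IsForwardCTMC μ (ctrlRate γ Φ) P ∧
    ∀ Φ', IsController Φ' → ctrlAMLoss w f ν Φh P Φ ≤ ctrlAMLoss w f ν Φh P Φ'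

/-- The same for the loss whose intermediate sample comes from the reference bridge between the
endpoints of the path measure of `Φ`. -/
def IsCtrlBridgeFixedPoint (γ w f : ℝ → ℝ) (μ ν : State N D → ℝ)
    (Φh : State N D → Fin D → ZMod N → ℝ) (Φ : ℝ → State N D → Fin D → ZMod N → ℝ) : Prop :=
  IsController Φ ∧ ∃ P, IsForwardCTMC μ (ctrlRate γ Φ) P ∧
    ∀ Φ', IsController Φ' → ctrlAMBridgeLoss γ w f ν Φh P Φ ≤ ctrlAMBridgeLoss γ w f ν Φh P Φ'

/-- `Φh` is the unique minimizer of the loss `L` among all correctors. -/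
def IsUniqueCorrectorMin (L : (State N D → Fin D → ZMod N → ℝ) → ℝ≥0∞)
    (Φh : State N D → Fin D → ZMod N → ℝ) : Prop :=
  IsCorrector Φh ∧ (∀ Φh', IsCorrector Φh' → L Φh ≤ L Φh') ∧
    ∀ Φh', IsCorrector Φh' → L Φh' ≤ L Φh → Φh' = Φh

/-! ### Half-bridge and bridge problems, over all path measures -/

/-- `P` solves `min KL(p‖Q)` over path measures `p` with `p_0 = μ`. -/
def SolvesForwardHalfBridge (μ : State N D → ℝ) (Q P : Measure (PathSpace N D)) : Prop :=
  IsProbabilityMeasure P ∧ HasMarginal P 0 μ ∧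
    ∀ p, IsProbabilityMeasure p → HasMarginal p 0 μ → klDiv P Q ≤ klDiv p Q

/-- `Q` solves `min KL(P‖q)` over path measures `q` with `q_1 = ν`. -/
def SolvesBackwardHalfBridge (ν : State N D → ℝ) (P Q : Measure (PathSpace N D)) : Prop :=
  IsProbabilityMeasure Q ∧ HasMarginal Q 1 ν ∧
    ∀ q, IsProbabilityMeasure q → HasMarginal q 1 ν → klDiv P Q ≤ klDiv P q

/-- `P` solves `min KL(p‖R)` over path measures `p` with `p_0 = μ` and `p_1 = ν`. -/
def SolvesBridge (μ ν : State N D → ℝ) (R P : Measure (PathSpace N D)) : Prop :=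
  IsProbabilityMeasure P ∧ HasMarginal P 0 μ ∧ HasMarginal P 1 ν ∧
    ∀ p, IsProbabilityMeasure p → HasMarginal p 0 μ → HasMarginal p 1 ν → klDiv P R ≤ klDiv p R

end DASBS

end

open DASBS

set_option linter.unusedSectionVars false

namespace DASBS

/-! ### The reference kernel -/

section refKernel

variable {N D : ℕ} [NeZero N] {γ : ℝ → ℝ}

/-! Every path measure that the scheme produces has a density proportional to `a (ω 0) * b (ω 1)`
with respect to one stationary reference chain `R`; this is `bridgeMixture R a b`. Such a measure
has the reference bridges. Forward in time it is the Doob transform of the reference chain by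
`coevolve γ b`, whose rate is the controlled rate of `ratioController γ b`; backward in time it is
the Doob transform by `evolve γ a` (`isForwardCTMC_bridgeMixture`, `isBackwardCTMC_bridgeMixture`).
A controller step keeps `b = ν / φ` and changes `a` so that the marginal at time 0 becomes `μ`; a
corrector step keeps `a` and changes `b` so that the marginal at time 1 becomes `ν`. Consecutive
measures therefore differ by a density in one endpoint. The divergence between them is that of the
marginals at this endpoint, and the data-processing inequality gives both half-bridge statements.

A Bregman regression loss is the loss of the conditional expectation of the targets plus an excess
that vanishes only at this expectation (`regressionLoss_eq_add`). The reference kernel commutes with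
translations of the group, so the translated ratios of `ν / φ` at time 1 average to ratios of
`coevolve γ (ν / φ)`: the ratio controller is the conditional expectation of its targets under its
own law. The corrector losses are treated in the same way with `evolve γ a`.

Uniqueness of the fixed point is harder, since an arbitrary fixed point `Φ` is a conditional
expectation under its own law, which need not be a mixture of bridges. The scores `coevolve γ b t (x
+ c) / coevolve γ b t x` satisfy the backward equation of the ratio controller (`hasDerivAt_score`),
and their terminal values are the targets. Following them along the chain of `Φ` expresses the
difference of the two controllers at time `s` through their differences at later times, and a
backward Grönwall argument makes it zero (`eq_ratioController_of_optimal`).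

Finally, the factors `b` follow the Sinkhorn iteration for the kernel from time 0 to time 1. Its
limit comes from maximizing a dual objective, and the oscillation of the ratio to the limit
contracts geometrically (`sinkhorn_converges`). So the density of the Schrödinger bridge with
respect to the iterates tends to 1 uniformly, and the divergences tend to 0. -/

theorem card_ne_zero : (N : ℝ) ≠ 0 := Nat.cast_ne_zero.mpr (NeZero.ne N)

theorem one_le_card : (1 : ℝ) ≤ N := Nat.one_le_cast.mpr (NeZero.one_le)

theorem intervalIntegrable_of_continuousOn_Icc (hγ : ContinuousOn γ (Icc 0 1)) {s t : ℝ}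
    (hs : s ∈ Icc (0 : ℝ) 1) (ht : t ∈ Icc (0 : ℝ) 1) : IntervalIntegrable γ volume s t :=
  (hγ.mono (uIcc_subset_Icc hs ht)).intervalIntegrable

theorem integral_schedule_nonneg (hγ0 : ∀ t ∈ Icc (0 : ℝ) 1, 0 ≤ γ t) {s t : ℝ}
    (hs : s ∈ Icc (0 : ℝ) 1) (ht : t ∈ Icc (0 : ℝ) 1) (hst : s ≤ t) : 0 ≤ ∫ v in s..t, γ v :=
  intervalIntegral.integral_nonneg hst fun _ hv => hγ0 _ ⟨hs.1.trans hv.1, hv.2.trans ht.2⟩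

theorem integral_schedule_pos (hγ : ContinuousOn γ (Icc 0 1)) (hγ0 : ∀ t ∈ Icc (0 : ℝ) 1, 0 ≤ γ t)
    (hγ1 : ∀ᵐ t ∂volume.restrict (Icc (0 : ℝ) 1), 0 < γ t) {s t : ℝ}
    (hs : s ∈ Icc (0 : ℝ) 1) (ht : t ∈ Icc (0 : ℝ) 1) (hst : s < t) : 0 < ∫ v in s..t, γ v := by
  rw [intervalIntegral.integral_pos_iff_support_of_nonneg_ae'
    (μ := volume) ?_ (intervalIntegrable_of_continuousOn_Icc hγ hs ht)]
  · refine ⟨hst, ?_⟩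
    have hsub : Ioc s t ⊆ Icc 0 1 := fun v hv => ⟨hs.1.trans hv.1.le, hv.2.trans ht.2⟩
    have h1 : ∀ᵐ v ∂volume.restrict (Ioc s t), 0 < γ v := ae_restrict_of_ae_restrict_of_subset hsub hγ1
    have h2 : volume (Ioc s t) ≤ volume (Function.support γ ∩ Ioc s t) := by
      rw [ae_restrict_iff' measurableSet_Ioc] at h1
      refine measure_mono_ae ?_
      filter_upwards [h1] with v hv hm
      exact ⟨(hv hm).ne', hm⟩
    exact lt_of_lt_of_le (by simp [hst]) h2
  · rw [uIoc_of_le hst.le]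
    refine (ae_restrict_iff' measurableSet_Ioc).mpr (Eventually.of_forall fun v hv => ?_)
    exact hγ0 v ⟨hs.1.trans hv.1.le, hv.2.trans ht.2⟩

theorem refA_nonneg (hγ0 : ∀ t ∈ Icc (0 : ℝ) 1, 0 ≤ γ t) {s t : ℝ}
    (hs : s ∈ Icc (0 : ℝ) 1) (ht : t ∈ Icc (0 : ℝ) 1) (hst : s ≤ t) : 0 ≤ refA N γ s t := by
  have := integral_schedule_nonneg hγ0 hs ht hst
  refine div_nonneg ?_ (Nat.cast_nonneg N)
  have : Real.exp (-∫ v in s..t, γ v) ≤ 1 := Real.exp_le_one_iff.mpr (by linarith)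
  linarith

theorem refA_pos (hγ : ContinuousOn γ (Icc 0 1)) (hγ0 : ∀ t ∈ Icc (0 : ℝ) 1, 0 ≤ γ t)
    (hγ1 : ∀ᵐ t ∂volume.restrict (Icc (0 : ℝ) 1), 0 < γ t) {s t : ℝ}
    (hs : s ∈ Icc (0 : ℝ) 1) (ht : t ∈ Icc (0 : ℝ) 1) (hst : s < t) : 0 < refA N γ s t := by
  have := integral_schedule_pos hγ hγ0 hγ1 hs ht hst
  refine div_pos ?_ (by have := one_le_card (N := N); linarith)
  have : Real.exp (-∫ v in s..t, γ v) < 1 := Real.exp_lt_one_iff.mpr (by linarith)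
  linarith

theorem refB_pos (s t : ℝ) : 0 < refB N γ s t := by
  have h1 := one_le_card (N := N)
  have h2 := Real.exp_pos (-∫ v in s..t, γ v)
  refine div_pos ?_ (by linarith)
  nlinarith

theorem refKernel_nonneg (hγ0 : ∀ t ∈ Icc (0 : ℝ) 1, 0 ≤ γ t) {s t : ℝ}
    (hs : s ∈ Icc (0 : ℝ) 1) (ht : t ∈ Icc (0 : ℝ) 1) (hst : s ≤ t) (y x : State N D) :
    0 ≤ refKernel γ s t y x :=
  mul_nonneg (pow_nonneg (refA_nonneg hγ0 hs ht hst) _) (pow_nonneg (refB_pos s t).le _)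

theorem refKernel_pos (hγ : ContinuousOn γ (Icc 0 1)) (hγ0 : ∀ t ∈ Icc (0 : ℝ) 1, 0 ≤ γ t)
    (hγ1 : ∀ᵐ t ∂volume.restrict (Icc (0 : ℝ) 1), 0 < γ t) {s t : ℝ}
    (hs : s ∈ Icc (0 : ℝ) 1) (ht : t ∈ Icc (0 : ℝ) 1) (hst : s < t) (y x : State N D) :
    0 < refKernel γ s t y x :=
  mul_pos (pow_pos (refA_pos hγ hγ0 hγ1 hs ht hst) _) (pow_pos (refB_pos s t) _)

theorem refKernel_comm (s t : ℝ) (y x : State N D) : refKernel γ s t y x = refKernel γ s t x y := by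
  simp only [refKernel, hammingDist_comm]

theorem refKernel_self (t : ℝ) (y x : State N D) :
    refKernel γ t t y x = if y = x then 1 else 0 := by
  rw [refKernel_eq_prod]
  have hA : refA N γ t t = 0 := by simp [refA]
  have hB : refB N γ t t = 1 := by simp [refB]
  rw [hA, hB]
  by_cases h : y = x
  · simp [h]
  · rw [if_neg h]
    obtain ⟨d, hd⟩ := Function.ne_iff.mp h
    exact Finset.prod_eq_zero (Finset.mem_univ d) (by simp [hd])

theorem refKernel_add (s t : ℝ) (y x c : State N D) :
    refKernel γ s t (y + c) (x + c) = refKernel γ s t y x := by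
  simp only [refKernel_eq_prod, Pi.add_apply, add_left_inj]

/-- Chapman–Kolmogorov equation. -/
theorem refKernel_comp (hγ : ContinuousOn γ (Icc 0 1)) {s t u : ℝ}
    (hs : s ∈ Icc (0 : ℝ) 1) (ht : t ∈ Icc (0 : ℝ) 1) (hu : u ∈ Icc (0 : ℝ) 1) (y x : State N D) :
    ∑ z, refKernel γ t u y z * refKernel γ s t z x = refKernel γ s u y x := by
  simp only [refKernel_eq_prod, ← Finset.prod_mul_distrib]
  have h := Finset.prod_univ_sum (fun _ : Fin D => (Finset.univ : Finset (ZMod N)))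
    (fun d a => (if y d = a then refB N γ t u else refA N γ t u) *
      (if a = x d then refB N γ s t else refA N γ s t))
  rw [Fintype.piFinset_univ] at h
  rw [← h]
  refine Finset.prod_congr rfl fun d _ => ?_
  have hint : ∫ v in s..u, γ v = (∫ v in s..t, γ v) + ∫ v in t..u, γ v :=
    (intervalIntegral.integral_add_adjacent_intervals
      (intervalIntegrable_of_continuousOn_Icc hγ hs ht)
      (intervalIntegrable_of_continuousOn_Icc hγ ht hu)).symm
  have hexp : Real.exp (-∫ v in s..u, γ v) =
      Real.exp (-∫ v in s..t, γ v) * Real.exp (-∫ v in t..u, γ v) := by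
    rw [hint, ← Real.exp_add]; congr 1; ring
  -- Each factor is a constant plus a multiple of an indicator, which makes the sum over the
  -- intermediate value explicit.
  have hk : ∀ a : ZMod N, (if y d = a then refB N γ t u else refA N γ t u) *
      (if a = x d then refB N γ s t else refA N γ s t) = refA N γ t u * refA N γ s t +
      (if y d = a then (refB N γ t u - refA N γ t u) * refA N γ s t else 0) +
      (if a = x d then refA N γ t u * (refB N γ s t - refA N γ s t) +
        (if y d = x d then (refB N γ t u - refA N γ t u) * (refB N γ s t - refA N γ s t) else 0)
        else 0) := by
    intro a
    by_cases h1 : y d = a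
    · subst h1
      by_cases h2 : y d = x d
      · simp only [h2, if_true]; ring
      · simp only [h2, if_true, if_false]; ring
    · by_cases h2 : a = x d
      · subst h2; simp only [h1, if_true, if_false]; ring
      · simp only [h1, h2, if_false]; ring
  have hN := card_ne_zero (N := N)
  rw [Finset.sum_congr rfl fun a _ => hk a, Finset.sum_add_distrib, Finset.sum_add_distrib,
    Finset.sum_ite_eq, Finset.sum_ite_eq', Finset.sum_const, Finset.card_univ, ZMod.card]
  simp only [Finset.mem_univ, if_true, nsmul_eq_mul]
  by_cases h1 : y d = x d
  · simp only [h1, if_true, refA, refB, hexp]; field_simp; ring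
  · simp only [h1, if_false, refA, refB, hexp]; field_simp; ring

theorem refKernel_sum (s t : ℝ) (x : State N D) : ∑ y, refKernel γ s t y x = 1 := by
  simp only [refKernel_eq_prod]
  have h := Finset.prod_univ_sum (fun _ : Fin D => (Finset.univ : Finset (ZMod N)))
    (fun d a => (if a = x d then refB N γ s t else refA N γ s t))
  rw [Fintype.piFinset_univ] at h
  rw [← h]
  refine Finset.prod_eq_one fun d _ => ?_
  have hk : ∀ a : ZMod N, (if a = x d then refB N γ s t else refA N γ s t) =
      refA N γ s t + if a = x d then refB N γ s t - refA N γ s t else 0 := by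
    intro a; split_ifs <;> ring
  have hN := card_ne_zero (N := N)
  rw [Finset.sum_congr rfl fun a _ => hk a, Finset.sum_add_distrib, Finset.sum_ite_eq',
    Finset.sum_const, Finset.card_univ, ZMod.card]
  simp only [Finset.mem_univ, if_true, nsmul_eq_mul, refA, refB]
  field_simp; ring

/-- The kernel depends on the times only through the integral of `γ`. Together with the symmetry in
the states, this reduces regularity and the differential equation in the initial time to those in
the final time. -/
theorem refKernel_reverse (s t : ℝ) :
    (refKernel γ s t : State N D → State N D → ℝ) =
      refKernel (fun v => γ (1 - v)) (1 - t) (1 - s) := by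
  have h : ∫ v in (1 - t)..(1 - s), γ (1 - v) = ∫ v in s..t, γ v := by
    rw [intervalIntegral.integral_comp_sub_left (fun v => γ v) 1]; simp
  funext y x
  simp only [refKernel, refA, refB, h]

theorem continuousOn_reverse (hγ : ContinuousOn γ (Icc 0 1)) :
    ContinuousOn (fun v => γ (1 - v)) (Icc 0 1) :=
  hγ.comp (by fun_prop) fun v hv => ⟨by linarith [hv.2], by linarith [hv.1]⟩

theorem continuousOn_refKernel_right (hγ : ContinuousOn γ (Icc 0 1)) {s : ℝ}
    (hs : s ∈ Icc (0 : ℝ) 1) (y x : State N D) :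
    ContinuousOn (fun t => refKernel γ s t y x) (Icc s 1) :=
  (isForwardKernel_refKernel γ hγ).2.1 s hs y x

theorem continuousOn_refKernel_left (hγ : ContinuousOn γ (Icc 0 1)) {t : ℝ}
    (ht : t ∈ Icc (0 : ℝ) 1) (y x : State N D) :
    ContinuousOn (fun s => refKernel γ s t y x) (Icc 0 t) := by
  have h := (isForwardKernel_refKernel _ (continuousOn_reverse hγ)).2.1 (1 - t)
    ⟨by linarith [ht.2], by linarith [ht.1]⟩ y x
  have h2 : (fun s => refKernel γ s t y x) =
      (fun s => refKernel (fun v => γ (1 - v)) (1 - t) s y x) ∘ fun s => 1 - s := by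
    funext s; simp only [Function.comp, refKernel_reverse s t]
  rw [h2]
  exact h.comp (by fun_prop) fun s hs => ⟨by linarith [hs.2], by linarith [hs.1]⟩

theorem refRate_comm (t : ℝ) (y x : State N D) : refRate γ t y x = refRate γ t x y := by
  simp only [refRate, hammingDist_comm, eq_comm]

theorem hasDerivAt_refKernel_right (hγ : ContinuousOn γ (Icc 0 1)) {s t : ℝ}
    (hs : s ∈ Icc (0 : ℝ) 1) (ht : t ∈ Ioo s 1) (y x : State N D) :
    HasDerivAt (fun t' => refKernel γ s t' y x) (∑ z, refRate γ t y z * refKernel γ s t z x) t :=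
  (isForwardKernel_refKernel γ hγ).2.2 s hs t ht y x

/-- Kolmogorov backward equation. -/
theorem hasDerivAt_refKernel_left (hγ : ContinuousOn γ (Icc 0 1)) {s t : ℝ}
    (ht : t ∈ Icc (0 : ℝ) 1) (hs : s ∈ Ioo 0 t) (y x : State N D) :
    HasDerivAt (fun s' => refKernel γ s' t y x) (-∑ z, refRate γ s z x * refKernel γ s t y z) s := by
  have h := (isForwardKernel_refKernel _ (continuousOn_reverse hγ)).2.2 (1 - t)
    ⟨by linarith [ht.2], by linarith [ht.1]⟩ (1 - s) ⟨by linarith [hs.2], by linarith [hs.1]⟩ x y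
  have h2 := h.comp s ((hasDerivAt_id s).const_sub 1)
  have h3 : (fun s => refKernel γ s t y x) =
      (fun s => refKernel (fun v => γ (1 - v)) (1 - t) s x y) ∘ fun s => 1 - s := by
    funext s; rw [refKernel_comm]; simp only [Function.comp, refKernel_reverse s t]
  rw [h3]
  refine h2.congr_deriv ?_
  rw [mul_neg_one, neg_inj]
  refine Finset.sum_congr rfl fun z _ => ?_
  rw [refKernel_comm s t y z, refKernel_reverse s t, refRate_comm s z x]
  simp only [refRate, sub_sub_cancel]

end refKernel

/-! ### Path measures of Markov chains with a finite state space -/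

section Kolmogorov

variable {ι S : Type*} [Finite S] [MeasurableSpace S] [DiscreteMeasurableSpace S]

/-- Kolmogorov extension for a finite state space. -/
theorem exists_isProjectiveLimit {P : ∀ J : Finset ι, Measure (∀ _ : J, S)}
    [∀ J, IsFiniteMeasure (P J)] (hP : IsProjectiveMeasureFamily (α := fun _ => S) P) :
    ∃ m : Measure (ι → S), IsProjectiveLimit (α := fun _ => S) m P := by
  classical
  let _ : TopologicalSpace S := ⊥
  have : DiscreteTopology S := ⟨rfl⟩
  -- A product of finite discrete spaces is compact and its cylinders are clopen, so a countable
  -- cover of a cylinder by cylinders has a finite subcover; countable subadditivity follows from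
  -- finite subadditivity.
  have hopen : ∀ s ∈ measurableCylinders (fun _ : ι => S), IsOpen s ∧ IsClosed s := by
    intro s hs
    obtain ⟨J, T, -, rfl⟩ := (mem_measurableCylinders _).1 hs
    have hc : Continuous (J.restrict (π := fun _ : ι => S)) := by fun_prop
    exact ⟨(isOpen_discrete T).preimage hc, (isClosed_discrete T).preimage hc⟩
  have hsub : (projectiveFamilyContent hP).IsSigmaSubadditive := by
    intro f hf hU
    obtain ⟨t, ht⟩ := (hopen _ hU).2.isCompact.elim_finite_subcover f (fun i => (hopen _ (hf i)).1)
      subset_rfl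
    have hbU : (⋃ i ∈ t, f i) ∈ measurableCylinders (fun _ : ι => S) :=
      isSetRing_measurableCylinders.biUnion_mem t fun i _ => hf i
    calc projectiveFamilyContent hP (⋃ i, f i)
        ≤ projectiveFamilyContent hP (⋃ i ∈ t, f i) := projectiveFamilyContent_mono hP hU hbU ht
      _ ≤ ∑ i ∈ t, projectiveFamilyContent hP (f i) :=
          addContent_biUnion_le isSetRing_measurableCylinders fun i _ => hf i
      _ ≤ ∑' i, projectiveFamilyContent hP (f i) := ENNReal.sum_le_tsum t
  refine ⟨(projectiveFamilyContent hP).measure isSetSemiring_measurableCylinders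
    generateFrom_measurableCylinders.ge hsub, fun J => ?_⟩
  ext s hs
  rw [Measure.map_apply (by fun_prop) hs]
  exact ((projectiveFamilyContent hP).measure_eq isSetSemiring_measurableCylinders
    generateFrom_measurableCylinders.symm hsub (cylinder_mem_measurableCylinders J s hs)).trans
    (projectiveFamilyContent_cylinder hP hs)

end Kolmogorov

/-! ### Finite-dimensional laws of a Markov chain and their consistency. -/

section Chain

variable {ι S : Type*} [LinearOrder ι] {K : ι → ι → S → S → ℝ}

/-- The probability that a chain which is in `x` at time `s` follows `ω` at the times `l`. -/
def chainWeight (K : ι → ι → S → S → ℝ) : ι → S → List ι → (ι → S) → ℝ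
  | _, _, [], _ => 1
  | s, x, t :: l, ω => K s t (ω t) x * chainWeight K t (ω t) l ω

theorem chainWeight_congr (l : List ι) : ∀ (s : ι) (x : S) {ω ω' : ι → S}, (∀ t ∈ l, ω t = ω' t) →
    chainWeight K s x l ω = chainWeight K s x l ω' := by
  induction l with
  | nil => intros; rfl
  | cons t l ih =>
    intro s x ω ω' h
    simp only [chainWeight]
    rw [h t (by simp), ih t _ fun u hu => h u (by simp [hu])]

theorem chainWeight_nonneg (hK : ∀ s t y x, s ≤ t → 0 ≤ K s t y x) (ω : ι → S) (l : List ι) :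
    ∀ (s : ι) (x : S), (s :: l).Pairwise (· ≤ ·) → 0 ≤ chainWeight K s x l ω := by
  induction l with
  | nil => intros; exact zero_le_one
  | cons t l ih =>
    intro s x h
    rw [List.pairwise_cons] at h
    exact mul_nonneg (hK _ _ _ _ (h.1 t (by simp))) (ih _ _ h.2)

/-- A repeated time contributes a factor `K t t y y = 1`. This carries the formula from finite sets
of times, on which the laws are built, to ordered lists with repetitions. -/
theorem chainWeight_dedup (hK : ∀ t y, K t t y y = 1) (ω : ι → S) (l : List ι) :
    ∀ (s : ι) (x : S), l.Pairwise (· ≤ ·) → chainWeight K s x l.dedup ω = chainWeight K s x l ω := by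
  induction l with
  | nil => intros; rfl
  | cons t l ih =>
    intro s x h
    rw [List.pairwise_cons] at h
    by_cases ht : t ∈ l
    · rw [List.dedup_cons_of_mem ht, ih _ _ h.2]
      cases l with
      | nil => simp at ht
      | cons u l =>
        have hu : u = t := by
          refine le_antisymm ?_ (h.1 u (by simp))
          rcases List.mem_cons.mp ht with rfl | ht
          · exact le_rfl
          · exact (List.pairwise_cons.mp h.2).1 t ht
        subst hu
        simp only [chainWeight, hK, one_mul]
    · rw [List.dedup_cons_of_notMem ht]
      simp only [chainWeight, ih _ _ h.2]

variable [Fintype S]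

/-- Summing out the value at the new time is the Chapman–Kolmogorov equation if a later time follows
in the list, and normalization of the kernel if none does. -/
theorem sum_chainWeight_orderedInsert
    (hsum : ∀ s t x, s ≤ t → ∑ y, K s t y x = 1)
    (hcomp : ∀ s t u y x, s ≤ t → t ≤ u → ∑ z, K t u y z * K s t z x = K s u y x)
    (t : ι) (ω : ι → S) (l : List ι) :
    ∀ (s : ι) (x : S), s ≤ t → (s :: l).Pairwise (· ≤ ·) → t ∉ l →
      ∑ v, chainWeight K s x (l.orderedInsert (· ≤ ·) t) (Function.update ω t v) =
        chainWeight K s x l ω := by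
  induction l with
  | nil =>
    intro s x hst _ _
    simp [chainWeight, hsum s t x hst]
  | cons u l ih =>
    intro s x hst hl ht
    rw [List.pairwise_cons] at hl
    have hut : u ≠ t := fun h => ht (by simp [h])
    have htl : t ∉ l := fun h => ht (by simp [h])
    have hcongr : ∀ v, chainWeight K u (ω u) l (Function.update ω t v) = chainWeight K u (ω u) l ω :=
      fun v => chainWeight_congr l _ _ fun w hw => Function.update_of_ne
        (by rintro rfl; exact htl hw) _ _
    by_cases htu : t ≤ u
    · rw [List.orderedInsert_cons_of_le _ _ htu]
      simp only [chainWeight, Function.update_self, Function.update_of_ne hut, hcongr]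
      rw [← hcomp s t u (ω u) x hst htu, Finset.sum_mul]
      exact Finset.sum_congr rfl fun v _ => by ring
    · rw [List.orderedInsert_of_not_le _ _ htu]
      simp only [chainWeight, Function.update_of_ne hut]
      rw [← Finset.mul_sum, ih u (ω u) (le_of_not_ge htu) hl.2 htl]

variable [OrderBot ι] [DecidableEq S] [Inhabited S] [MeasurableSpace S] [DiscreteMeasurableSpace S]

/-- The probability that a chain with initial vector `μ` follows `ω` at the times `l`. -/
def pathWeight (μ : S → ℝ) (K : ι → ι → S → S → ℝ) (l : List ι) (ω : ι → S) : ℝ :=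
  ∑ x, μ x * chainWeight K ⊥ x l ω

/-- The path that follows `x` on `J` and is constant elsewhere. -/
def extendPath (J : Finset ι) (x : J → S) (t : ι) : S := if h : t ∈ J then x ⟨t, h⟩ else default

open Classical in
/-- The law of a Markov chain at finitely many times. -/
noncomputable def chainLaw (μ : S → ℝ) (K : ι → ι → S → S → ℝ) (J : Finset ι) : Measure (J → S) :=
  ∑ x : J → S, ENNReal.ofReal (pathWeight μ K J.sort (extendPath J x)) • Measure.dirac x

instance (μ : S → ℝ) (J : Finset ι) : IsFiniteMeasure (chainLaw μ K J) := by
  unfold chainLaw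
  refine ⟨?_⟩
  rw [Measure.finsetSum_apply]
  refine ENNReal.sum_lt_top.mpr fun x _ => ?_
  simp

theorem chainLaw_singleton (μ : S → ℝ) (J : Finset ι) (x : J → S) :
    chainLaw μ K J {x} = ENNReal.ofReal (pathWeight μ K J.sort (extendPath J x)) := by
  classical
  unfold chainLaw
  rw [Measure.finsetSum_apply, Finset.sum_eq_single x]
  · simp
  · intro y _ hy
    simp [hy]
  · simp

theorem pairwise_bot_sort (J : Finset ι) : (⊥ :: J.sort).Pairwise (· ≤ ·) :=
  List.pairwise_cons.mpr ⟨fun _ _ => bot_le, J.pairwise_sort _⟩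

theorem sort_insert_eq (J : Finset ι) {t : ι} (ht : t ∉ J) :
    (insert t J).sort = J.sort.orderedInsert (· ≤ ·) t := by
  refine List.Perm.eq_of_pairwise' (r := (· ≤ ·)) (Finset.pairwise_sort _ _)
    ((J.pairwise_sort _).orderedInsert t _) ?_
  refine ((insert t J).sort_perm_toList _).trans (List.Perm.trans ?_ (List.perm_orderedInsert _ t _).symm)
  exact (Finset.toList_insert ht).trans ((J.sort_perm_toList _).symm.cons t)

theorem chainLaw_insert {μ : S → ℝ} (hμ : ∀ x, 0 ≤ μ x)
    (hK : ∀ s t y x, s ≤ t → 0 ≤ K s t y x)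
    (hsum : ∀ s t x, s ≤ t → ∑ y, K s t y x = 1)
    (hcomp : ∀ s t u y x, s ≤ t → t ≤ u → ∑ z, K t u y z * K s t z x = K s u y x)
    (J : Finset ι) {t : ι} (ht : t ∉ J) :
    chainLaw μ K J =
      (chainLaw μ K (insert t J)).map (Finset.restrict₂ (π := fun _ => S) (Finset.subset_insert t J)) := by
  refine Measure.ext_of_singleton fun x => ?_
  rw [Measure.map_apply (by fun_prop) (measurableSet_singleton x), chainLaw_singleton]
  -- `g v` extends `x` by the value `v` at the new time; these are the points that restrict to `x`.
  set g : S → (↥(insert t J) → S) := fun v i => if i.1 = t then v else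
    extendPath J x i.1 with hg
  have hset : Finset.restrict₂ (π := fun _ => S) (Finset.subset_insert t J) ⁻¹' {x} = ⋃ v, {g v} := by
    ext y
    simp only [mem_preimage, mem_singleton_iff, mem_iUnion]
    constructor
    · rintro rfl
      refine ⟨y ⟨t, Finset.mem_insert_self t J⟩, funext fun i => ?_⟩
      obtain ⟨i, hi⟩ := i
      by_cases hit : i = t
      · subst hit; simp [hg]
      · have hiJ : i ∈ J := (Finset.mem_insert.mp hi).resolve_left hit
        simp [hg, hit, extendPath, hiJ]
    · rintro ⟨v, rfl⟩
      funext i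
      obtain ⟨i, hi⟩ := i
      have hit : i ≠ t := fun h => ht (h ▸ hi)
      simp [hg, hit, extendPath, hi]
  have hext : ∀ v, extendPath (insert t J) (g v) = Function.update (extendPath J x) t v := by
    intro v
    funext i
    by_cases hit : i = t
    · subst hit; simp [extendPath, hg]
    · by_cases hiJ : i ∈ J <;> simp [extendPath, hg, hit, hiJ]
  have hinj : Function.Injective g := by
    intro v w h
    simpa [hg] using congrFun h ⟨t, Finset.mem_insert_self t J⟩
  rw [hset, measure_iUnion (fun v w hvw => by
    simpa [Function.onFun] using fun h => hvw (hinj h)) (fun v => measurableSet_singleton _),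
    tsum_fintype]
  simp only [chainLaw_singleton, hext]
  rw [← ENNReal.ofReal_sum_of_nonneg]
  · congr 1
    simp only [pathWeight]
    rw [Finset.sum_comm]
    refine Finset.sum_congr rfl fun z _ => ?_
    rw [← Finset.mul_sum, sort_insert_eq J ht, sum_chainWeight_orderedInsert hsum hcomp t _ _ _ _ bot_le
      (pairwise_bot_sort J) (by simpa using ht)]
  · intro v _
    exact Finset.sum_nonneg fun z _ => mul_nonneg (hμ z)
      (chainWeight_nonneg hK _ _ _ _ (pairwise_bot_sort _))

theorem isProjectiveMeasureFamily_chainLaw {μ : S → ℝ} (hμ : ∀ x, 0 ≤ μ x)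
    (hK : ∀ s t y x, s ≤ t → 0 ≤ K s t y x)
    (hsum : ∀ s t x, s ≤ t → ∑ y, K s t y x = 1)
    (hcomp : ∀ s t u y x, s ≤ t → t ≤ u → ∑ z, K t u y z * K s t z x = K s u y x) :
    IsProjectiveMeasureFamily (α := fun _ : ι => S) (chainLaw μ K) := by
  -- Consistency for `J ⊆ L` follows by adding the times of `L` that are missing in `J` one at a
  -- time.
  have key : ∀ (n : ℕ) (L J : Finset ι) (hJL : J ⊆ L), (L \ J).card = n →
      chainLaw μ K J = (chainLaw μ K L).map (Finset.restrict₂ (π := fun _ => S) hJL) := by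
    intro n
    induction n with
    | zero =>
      intro L J hJL hn
      have : L = J := (Finset.sdiff_eq_empty_iff_subset.mp (Finset.card_eq_zero.mp hn)).antisymm hJL
      subst this
      exact Measure.map_id.symm
    | succ n ih =>
      intro L J hJL hn
      obtain ⟨t, ht⟩ := Finset.card_pos.mp (by omega : 0 < (L \ J).card)
      obtain ⟨htL, htJ⟩ := Finset.mem_sdiff.mp ht
      have hsub : insert t J ⊆ L := Finset.insert_subset htL hJL
      have hcard : (L \ insert t J).card = n := by
        rw [Finset.sdiff_insert, Finset.card_erase_of_mem ht, hn, Nat.add_sub_cancel]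
      rw [chainLaw_insert hμ hK hsum hcomp J htJ, ih L _ hsub hcard,
        Measure.map_map (by fun_prop) (by fun_prop)]
      rfl
  exact fun L J hJL => key _ L J hJL rfl

/-- Existence of Markov chains with finite state space, through their values at finitely many
times. -/
theorem exists_chainMeasure {μ : S → ℝ} (hμ : ∀ x, 0 ≤ μ x) (hμ1 : ∑ x, μ x = 1)
    (hK : ∀ s t y x, s ≤ t → 0 ≤ K s t y x) (hself : ∀ t y, K t t y y = 1)
    (hsum : ∀ s t x, s ≤ t → ∑ y, K s t y x = 1)
    (hcomp : ∀ s t u y x, s ≤ t → t ≤ u → ∑ z, K t u y z * K s t z x = K s u y x) :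
    ∃ P : Measure (ι → S), IsProbabilityMeasure P ∧ ∀ (l : List ι) (ω₀ : ι → S),
      l.Pairwise (· ≤ ·) → P {ω | ∀ t ∈ l, ω t = ω₀ t} = ENNReal.ofReal (pathWeight μ K l ω₀) := by
  obtain ⟨P, hP⟩ := exists_isProjectiveLimit
    (isProjectiveMeasureFamily_chainLaw (K := K) hμ hK hsum hcomp)
  have hcyl : ∀ (J : Finset ι) (ω₀ : ι → S),
      P {ω | ∀ t ∈ J, ω t = ω₀ t} = ENNReal.ofReal (pathWeight μ K J.sort ω₀) := by
    intro J ω₀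
    have h1 : {ω : ι → S | ∀ t ∈ J, ω t = ω₀ t} =
        J.restrict (π := fun _ => S) ⁻¹' {J.restrict (π := fun _ => S) ω₀} := by
      ext ω
      simp [funext_iff]
    rw [h1, ← Measure.map_apply (by fun_prop) (measurableSet_singleton _), hP J, chainLaw_singleton]
    congr 1
    refine Finset.sum_congr rfl fun z _ => ?_
    congr 1
    refine chainWeight_congr _ _ _ fun t ht => ?_
    have ht' : t ∈ J := by simpa using ht
    simp [extendPath, ht']
  refine ⟨P, ⟨?_⟩, fun l ω₀ hl => ?_⟩
  · have h := hcyl ∅ fun _ => default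
    simpa [pathWeight, chainWeight, hμ1] using h
  · have h := hcyl l.toFinset ω₀
    have h2 : l.toFinset.sort = l.dedup := by
      have h3 : l.dedup.toFinset = l.toFinset := by ext; simp
      rw [← h3]
      exact (List.toFinset_sort _ l.nodup_dedup).mpr (hl.sublist l.dedup_sublist)
    rw [h2] at h
    simp only [List.mem_toFinset] at h
    rw [h]
    congr 1
    exact Finset.sum_congr rfl fun z _ => by rw [chainWeight_dedup hself _ _ _ _ hl]

end Chain

/-! ### Path measures with reference bridges -/

section FiniteSums

theorem prod_fin_cons {α : Type*} (F : α → α → ℝ) (a : α) {n : ℕ} (u : Fin (n + 1) → α) :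
    ∏ i : Fin (n + 1), F ((Fin.cons a u : Fin (n + 2) → α) i.castSucc)
      ((Fin.cons a u : Fin (n + 2) → α) i.succ) =
      F a (u 0) * ∏ i : Fin n, F (u i.castSucc) (u i.succ) := by
  rw [Fin.prod_univ_succ]
  simp only [Fin.castSucc_zero, Fin.cons_zero, Fin.cons_succ, ← Fin.succ_castSucc]

theorem prod_fin_snoc {α : Type*} (F : α → α → ℝ) (a : α) {n : ℕ} (u : Fin (n + 1) → α) :
    ∏ i : Fin (n + 1), F ((Fin.snoc u a : Fin (n + 2) → α) i.castSucc)
      ((Fin.snoc u a : Fin (n + 2) → α) i.succ) =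
      (∏ i : Fin n, F (u i.castSucc) (u i.succ)) * F (u (Fin.last n)) a := by
  rw [Fin.prod_univ_castSucc]
  simp only [Fin.snoc_castSucc, Fin.succ_castSucc, Fin.succ_last, Fin.snoc_last]

theorem prod_fin_telescope {n : ℕ} (c : Fin (n + 1) → ℝ) (F G : Fin n → ℝ)
    (h : ∀ i, c i.castSucc * G i = F i * c i.succ) :
    c 0 * ∏ i, G i = (∏ i, F i) * c (Fin.last n) := by
  induction n with
  | zero => simp
  | succ n ih =>
    rw [Fin.prod_univ_castSucc, Fin.prod_univ_castSucc, ← mul_assoc]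
    have h1 := ih (fun i => c i.castSucc) (fun i => F i.castSucc) (fun i => G i.castSucc)
      fun i => h i.castSucc
    have h2 := h (Fin.last n)
    rw [Fin.succ_last] at h2
    simp only [Fin.castSucc_zero] at h1
    rw [h1, mul_assoc, h2, mul_assoc]

theorem lintegral_comp_fintype {Ω α : Type*} [MeasurableSpace Ω] [Fintype α] [MeasurableSpace α]
    [DiscreteMeasurableSpace α] (m : Measure Ω) {T : Ω → α} (hT : Measurable T) (g : α → ℝ≥0∞) :
    ∫⁻ ω, g (T ω) ∂m = ∑ a, g a * m (T ⁻¹' {a}) := by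
  rw [← lintegral_map (measurable_of_finite g) hT, lintegral_fintype]
  exact Finset.sum_congr rfl fun a _ => by rw [Measure.map_apply hT (measurableSet_singleton a)]

end FiniteSums

/-! ### Mixtures of reference bridges and their finite-dimensional laws. -/

section BridgeMixture

variable {N D : ℕ} [NeZero N] {γ : ℝ → ℝ}

theorem measurable_eval (t : I) : Measurable fun ω : PathSpace N D => ω t := measurable_pi_apply t

theorem lintegral_endpoints (m : Measure (PathSpace N D)) (s t : I)
    (g : State N D → State N D → ℝ≥0∞) :
    ∫⁻ ω, g (ω s) (ω t) ∂m = ∑ x, ∑ y, g x y * m {ω | ω s = x ∧ ω t = y} := by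
  have h := lintegral_comp_fintype m ((measurable_eval (N := N) (D := D) s).prodMk (measurable_eval t))
    fun p => g p.1 p.2
  rw [Fintype.sum_prod_type] at h
  refine h.trans ?_
  refine Finset.sum_congr rfl fun x _ => Finset.sum_congr rfl fun y _ => ?_
  congr 2
  ext ω
  simp [Prod.ext_iff]

/-- The reference chain started from the uniform distribution. -/
def IsUniformRef (γ : ℝ → ℝ) (R : Measure (PathSpace N D)) : Prop :=
  IsProbabilityMeasure R ∧ ∀ (n : ℕ) (u : Fin (n + 1) → I × State N D), Monotone (fun i => (u i).1) →
    R {ω | ∀ i, ω (u i).1 = (u i).2} = ENNReal.ofReal ((Fintype.card (State N D) : ℝ)⁻¹ *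
      ∏ i : Fin n, refKernel γ (u i.castSucc).1 (u i.succ).1 (u i.succ).2 (u i.castSucc).2)

theorem chainWeight_ofFn {ι S : Type*} (K : ι → ι → S → S → ℝ) (ω : ι → S) {n : ℕ} :
    ∀ (s : ι) (x : S) (t : Fin (n + 1) → ι),
      chainWeight K s x (List.ofFn t) ω = K s (t 0) (ω (t 0)) x *
        ∏ i : Fin n, K (t i.castSucc) (t i.succ) (ω (t i.succ)) (ω (t i.castSucc)) := by
  induction n with
  | zero => intro s x t; simp [chainWeight]
  | succ n ih =>
    intro s x t
    rw [List.ofFn_succ, chainWeight, ih, Fin.prod_univ_succ]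
    rfl

theorem card_state_ne_zero : (Fintype.card (State N D) : ℝ) ≠ 0 :=
  Nat.cast_ne_zero.mpr Fintype.card_ne_zero

/-- The uniform vector is stationary because the kernel is symmetric and normalized. Hence the
formula may start at any time, not only at 0. -/
theorem exists_isUniformRef (hγ : ContinuousOn γ (Icc 0 1)) (hγ0 : ∀ t ∈ Icc (0 : ℝ) 1, 0 ≤ γ t) :
    ∃ R : Measure (PathSpace N D), IsUniformRef γ R := by
  classical
  have hc := card_state_ne_zero (N := N) (D := D)
  have hμ1 : ∑ _x : State N D, (Fintype.card (State N D) : ℝ)⁻¹ = 1 := by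
    rw [Finset.sum_const, Finset.card_univ, nsmul_eq_mul, mul_inv_cancel₀ hc]
  obtain ⟨R, hR, h⟩ := exists_chainMeasure (ι := I) (S := State N D)
    (K := fun s t => refKernel γ s t) (μ := fun _ => (Fintype.card (State N D) : ℝ)⁻¹)
    (fun _ => by positivity) hμ1
    (fun s t y x hst => refKernel_nonneg hγ0 s.2 t.2 hst y x)
    (fun t y => by simp [refKernel_self])
    (fun s t x _ => refKernel_sum _ _ x)
    (fun s t u y x _ _ => refKernel_comp hγ s.2 t.2 u.2 y x)
  refine ⟨R, hR, fun n u hu => ?_⟩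
  set F : I × State N D → I × State N D → ℝ := fun p q => refKernel γ p.1 q.1 q.2 p.2 with hF
  -- If equal times carry equal values, the values come from a path and the general formula applies.
  -- Otherwise both sides vanish: the event is empty, and by monotonicity two different values sit
  -- at consecutive equal times, where the kernel is the identity.
  by_cases hcons : ∀ i j, (u i).1 = (u j).1 → (u i).2 = (u j).2
  · set ω₀ : PathSpace N D := fun τ => if h : ∃ i, (u i).1 = τ then (u h.choose).2 else default
    have hω₀ : ∀ i, ω₀ (u i).1 = (u i).2 := by
      intro i
      have hi : ∃ j, (u j).1 = (u i).1 := ⟨i, rfl⟩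
      simp only [ω₀, dif_pos hi]
      exact hcons _ _ hi.choose_spec
    have hset : {ω : PathSpace N D | ∀ i, ω (u i).1 = (u i).2} =
        {ω | ∀ t ∈ List.ofFn fun i => (u i).1, ω t = ω₀ t} := by
      ext ω
      simp only [mem_ofPred_eq, List.forall_mem_ofFn_iff, hω₀]
    rw [hset, h _ _ (List.pairwise_ofFn.mpr fun i j hij => hu hij.le)]
    congr 1
    simp only [pathWeight, chainWeight_ofFn, hω₀]
    rw [← Finset.mul_sum, ← Finset.sum_mul]
    simp only [refKernel_comm _ _ (u 0).2]
    rw [refKernel_sum, one_mul]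
  · have hbad : ∃ i : Fin n, (u i.castSucc).1 = (u i.succ).1 ∧ (u i.castSucc).2 ≠ (u i.succ).2 := by
      by_contra! hno
      apply hcons
      have key : ∀ (k : ℕ) (i j : Fin (n + 1)), (j : ℕ) = i + k → (u i).1 = (u j).1 →
          (u i).2 = (u j).2 := by
        intro k
        induction k with
        | zero => intro i j hij _; rw [Fin.ext (by omega : (i : ℕ) = j)]
        | succ k ih =>
          intro i j hij hu'
          let m : Fin n := ⟨i + k, by have := j.2; omega⟩
          have hjm : j = m.succ := Fin.ext (by simp [m]; omega)
          have h1 : (u i).1 ≤ (u m.castSucc).1 := hu (Fin.le_def.mpr (by simp [m]))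
          have h2 : (u m.castSucc).1 ≤ (u m.succ).1 := hu (Fin.castSucc_lt_succ).le
          rw [hjm] at hu' ⊢
          have h3 : (u i).1 = (u m.castSucc).1 := le_antisymm h1 (h2.trans hu'.ge)
          exact (ih i m.castSucc (by simp [m]) h3).trans (hno m (h3.symm.trans hu'))
      intro i j hij
      rcases le_total i j with hle | hle
      · exact key (j - i) i j (by have := Fin.le_def.mp hle; omega) hij
      · exact (key (i - j) j i (by have := Fin.le_def.mp hle; omega) hij.symm).symm
    obtain ⟨i, hi1, hi2⟩ := hbad
    have h1 : {ω : PathSpace N D | ∀ i, ω (u i).1 = (u i).2} = ∅ := by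
      refine eq_empty_of_forall_notMem fun ω hω => hi2 ?_
      rw [← hω, ← hω, hi1]
    rw [h1, measure_empty, Finset.prod_eq_zero (Finset.mem_univ i), mul_zero, ENNReal.ofReal_zero]
    rw [hi1, refKernel_self, if_neg hi2.symm]

/-- The function `∑_y p^r_{1|t}(y|x) b(y)`. -/
noncomputable def coevolve (γ : ℝ → ℝ) (b : State N D → ℝ) (t : ℝ) (x : State N D) : ℝ :=
  ∑ y, refKernel γ t 1 y x * b y

/-- The path measure with reference bridges and endpoint law `a x₀ * p^r_{1|0}(x₁|x₀) * b x₁`. -/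
noncomputable def bridgeMixture (R : Measure (PathSpace N D)) (a b : State N D → ℝ) :
    Measure (PathSpace N D) :=
  R.withDensity fun ω => ENNReal.ofReal (Fintype.card (State N D) * (a (ω 0) * b (ω 1)))

theorem evolve_zero (a : State N D → ℝ) (x : State N D) : evolve γ a 0 x = a x := by
  simp [evolve, refKernel_self]

theorem coevolve_one (b : State N D → ℝ) (x : State N D) : coevolve γ b 1 x = b x := by
  simp [coevolve, refKernel_self]

theorem measurableSet_follow {n : ℕ} (u : Fin (n + 1) → I × State N D) :
    MeasurableSet {ω : PathSpace N D | ∀ i, ω (u i).1 = (u i).2} := by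
  have h : {ω : PathSpace N D | ∀ i, ω (u i).1 = (u i).2} = ⋂ i, {ω | ω (u i).1 = (u i).2} := by
    ext; simp
  rw [h]
  exact MeasurableSet.iInter fun i => measurable_eval _ (measurableSet_singleton _)

variable {R : Measure (PathSpace N D)} {a b : State N D → ℝ}

/-- Once the times 0 and 1 are added to the prescribed ones, the density is constant on the event.
Summing over the two endpoint values turns `a` into `evolve` at the first time and `b` into
`coevolve` at the last. -/
theorem bridgeMixture_follow (hγ0 : ∀ t ∈ Icc (0 : ℝ) 1, 0 ≤ γ t) (hR : IsUniformRef γ R)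
    (ha : ∀ x, 0 ≤ a x) (hb : ∀ x, 0 ≤ b x) {n : ℕ} (u : Fin (n + 1) → I × State N D)
    (hu : Monotone fun i => (u i).1) :
    bridgeMixture R a b {ω | ∀ i, ω (u i).1 = (u i).2} = ENNReal.ofReal
      (evolve γ a (u 0).1 (u 0).2 *
        (∏ i : Fin n, refKernel γ (u i.castSucc).1 (u i.succ).1 (u i.succ).2 (u i.castSucc).2) *
        coevolve γ b (u (Fin.last n)).1 (u (Fin.last n)).2) := by
  set A := {ω : PathSpace N D | ∀ i, ω (u i).1 = (u i).2} with hA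
  have hAm : MeasurableSet A := measurableSet_follow u
  set F : I × State N D → I × State N D → ℝ := fun p q => refKernel γ p.1 q.1 q.2 p.2 with hF
  have hF0 : ∀ p q, p.1 ≤ q.1 → 0 ≤ F p q := fun p q hpq => refKernel_nonneg hγ0 p.1.2 q.1.2 hpq _ _
  rw [bridgeMixture, withDensity_apply _ hAm, lintegral_endpoints _ 0 1
    fun x y => ENNReal.ofReal (Fintype.card (State N D) * (a x * b y))]
  have hpt : ∀ x y, (R.restrict A) {ω | ω 0 = x ∧ ω 1 = y} = ENNReal.ofReal
      ((Fintype.card (State N D) : ℝ)⁻¹ * (F (0, x) (u 0) *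
        ((∏ i : Fin n, F (u i.castSucc) (u i.succ)) * F (u (Fin.last n)) (1, y)))) := by
    intro x y
    set u' : Fin (n + 3) → I × State N D := Fin.cons (0, x) (Fin.snoc u (1, y) : Fin (n + 2) → _)
      with hu'
    have hmono : Monotone fun i => (u' i).1 := by
      intro i j hij
      induction i using Fin.cases with
      | zero => simp [hu']
      | succ i =>
        induction j using Fin.cases with
        | zero => simp at hij
        | succ j =>
          simp only [hu', Fin.cons_succ]
          induction j using Fin.lastCases with
          | last => simp [unitInterval.le_one']
          | cast j =>
            induction i using Fin.lastCases with
            | last =>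
              have := Fin.le_def.mp hij
              simp at this
              omega
            | cast i =>
              simp only [Fin.snoc_castSucc]
              exact hu (by simpa using hij)
    have h := hR.2 (n + 2) u' hmono
    have hset : {ω : PathSpace N D | ∀ i, ω (u' i).1 = (u' i).2} = {ω | ω 0 = x ∧ ω 1 = y} ∩ A := by
      ext ω
      simp only [hu', Fin.forall_fin_succ (n := n + 2), Fin.cons_zero, Fin.cons_succ, mem_ofPred_eq,
        Fin.forall_fin_succ' (n := n + 1), Fin.snoc_castSucc, Fin.snoc_last, mem_inter_iff, hA]
      tauto
    rw [Measure.restrict_apply' hAm, ← hset, h]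
    congr 2
    refine (prod_fin_cons F (0, x) _).trans ?_
    rw [prod_fin_snoc F (1, y) u]
    rw [show (Fin.snoc u (1, y) : Fin (n + 2) → I × State N D) 0 = u 0 from Fin.snoc_castSucc
      (α := fun _ => I × State N D) (1, y) u 0]
  simp only [hpt]
  have hc := card_state_ne_zero (N := N) (D := D)
  have hpr : 0 ≤ ∏ i : Fin n, F (u i.castSucc) (u i.succ) :=
    Finset.prod_nonneg fun i _ => hF0 _ _ (hu (Fin.castSucc_lt_succ).le)
  have h1 : ∀ x y, 0 ≤ (Fintype.card (State N D) : ℝ) * (a x * b y) := fun x y =>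
    mul_nonneg (Nat.cast_nonneg _) (mul_nonneg (ha x) (hb y))
  have h2 : ∀ x y, 0 ≤ (Fintype.card (State N D) : ℝ)⁻¹ * (F (0, x) (u 0) *
      ((∏ i : Fin n, F (u i.castSucc) (u i.succ)) * F (u (Fin.last n)) (1, y))) := fun x y =>
    mul_nonneg (by positivity) (mul_nonneg (hF0 _ _ unitInterval.nonneg')
      (mul_nonneg hpr (hF0 _ _ unitInterval.le_one')))
  simp only [← ENNReal.ofReal_mul (h1 _ _)]
  rw [Finset.sum_congr rfl fun x _ => (ENNReal.ofReal_sum_of_nonneg fun y _ =>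
      mul_nonneg (h1 x y) (h2 x y)).symm,
    ← ENNReal.ofReal_sum_of_nonneg fun x _ => Finset.sum_nonneg fun y _ =>
      mul_nonneg (h1 x y) (h2 x y)]
  congr 1
  simp only [evolve, coevolve]
  rw [Finset.sum_mul, Finset.sum_mul]
  refine Finset.sum_congr rfl fun x _ => ?_
  rw [Finset.mul_sum]
  refine Finset.sum_congr rfl fun y _ => ?_
  simp only [hF, Icc.coe_zero, Icc.coe_one]
  field_simp

theorem bridgeMixture_pair (hγ0 : ∀ t ∈ Icc (0 : ℝ) 1, 0 ≤ γ t) (hR : IsUniformRef γ R)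
    (ha : ∀ x, 0 ≤ a x) (hb : ∀ x, 0 ≤ b x) {s t : I} (hst : s ≤ t) (x y : State N D) :
    bridgeMixture R a b {ω | ω s = x ∧ ω t = y} = ENNReal.ofReal
      (evolve γ a s x * refKernel γ s t y x * coevolve γ b t y) := by
  have h := bridgeMixture_follow hγ0 hR ha hb (n := 1) ![(s, x), (t, y)] (by
    intro i j hij
    fin_cases i <;> fin_cases j <;> simp_all)
  simpa [Fin.forall_fin_two] using h

theorem bridgeMixture_triple (hγ0 : ∀ t ∈ Icc (0 : ℝ) 1, 0 ≤ γ t) (hR : IsUniformRef γ R)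
    (ha : ∀ x, 0 ≤ a x) (hb : ∀ x, 0 ≤ b x) (t : I) (x₀ x x₁ : State N D) :
    bridgeMixture R a b {ω | ω 0 = x₀ ∧ ω t = x ∧ ω 1 = x₁} = ENNReal.ofReal
      (a x₀ * (refKernel γ 0 t x x₀ * refKernel γ t 1 x₁ x) * b x₁) := by
  have h := bridgeMixture_follow hγ0 hR ha hb (n := 2) ![(0, x₀), (t, x), (1, x₁)] (by
    intro i j hij
    fin_cases i <;> fin_cases j <;> simp_all [unitInterval.le_one'])
  simpa [Fin.forall_fin_succ, Fin.prod_univ_two, evolve_zero, coevolve_one] using h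

theorem bridgeMixture_single (hγ0 : ∀ t ∈ Icc (0 : ℝ) 1, 0 ≤ γ t) (hR : IsUniformRef γ R)
    (ha : ∀ x, 0 ≤ a x) (hb : ∀ x, 0 ≤ b x) (t : I) (x : State N D) :
    bridgeMixture R a b {ω | ω t = x} = ENNReal.ofReal (evolve γ a t x * coevolve γ b t x) := by
  have h := bridgeMixture_follow hγ0 hR ha hb (n := 0) ![(t, x)] (by
    intro i j hij
    fin_cases i; fin_cases j; simp)
  simpa using h

theorem bridgeMixture_endpoints (hγ0 : ∀ t ∈ Icc (0 : ℝ) 1, 0 ≤ γ t) (hR : IsUniformRef γ R)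
    (ha : ∀ x, 0 ≤ a x) (hb : ∀ x, 0 ≤ b x) (x₀ x₁ : State N D) :
    bridgeMixture R a b {ω | ω 0 = x₀ ∧ ω 1 = x₁} = ENNReal.ofReal
      (a x₀ * refKernel γ 0 1 x₁ x₀ * b x₁) := by
  have h := bridgeMixture_pair hγ0 hR ha hb (zero_le_one : (0 : I) ≤ 1) x₀ x₁
  simpa [evolve_zero, coevolve_one] using h

theorem measure_univ_eq_sum (m : Measure (PathSpace N D)) (t : I) :
    m univ = ∑ x, m {ω | ω t = x} := by
  have h := lintegral_comp_fintype m (measurable_eval (N := N) (D := D) t) fun _ => 1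
  simp only [lintegral_one, one_mul] at h
  exact h

theorem evolve_nonneg (hγ0 : ∀ t ∈ Icc (0 : ℝ) 1, 0 ≤ γ t) (ha : ∀ x, 0 ≤ a x) {t : ℝ}
    (ht : t ∈ Icc (0 : ℝ) 1) (x : State N D) : 0 ≤ evolve γ a t x :=
  Finset.sum_nonneg fun y _ => mul_nonneg
    (refKernel_nonneg hγ0 (left_mem_Icc.mpr zero_le_one) ht ht.1 _ _) (ha y)

theorem coevolve_nonneg (hγ0 : ∀ t ∈ Icc (0 : ℝ) 1, 0 ≤ γ t) (hb : ∀ x, 0 ≤ b x) {t : ℝ}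
    (ht : t ∈ Icc (0 : ℝ) 1) (x : State N D) : 0 ≤ coevolve γ b t x :=
  Finset.sum_nonneg fun y _ => mul_nonneg
    (refKernel_nonneg hγ0 ht (right_mem_Icc.mpr zero_le_one) ht.2 _ _) (hb y)

theorem isProbabilityMeasure_bridgeMixture (hγ0 : ∀ t ∈ Icc (0 : ℝ) 1, 0 ≤ γ t)
    (hR : IsUniformRef γ R) (ha : ∀ x, 0 ≤ a x) (hb : ∀ x, 0 ≤ b x) (t : I)
    (hab : ∑ x, evolve γ a t x * coevolve γ b t x = 1) :
    IsProbabilityMeasure (bridgeMixture R a b) := by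
  refine ⟨?_⟩
  rw [measure_univ_eq_sum _ t, Finset.sum_congr rfl fun x _ => bridgeMixture_single hγ0 hR ha hb t x,
    ← ENNReal.ofReal_sum_of_nonneg fun x _ =>
      mul_nonneg (evolve_nonneg hγ0 ha t.2 x) (coevolve_nonneg hγ0 hb t.2 x), hab,
    ENNReal.ofReal_one]

theorem hasRefBridges_bridgeMixture (hγ : ContinuousOn γ (Icc 0 1))
    (hγ0 : ∀ t ∈ Icc (0 : ℝ) 1, 0 ≤ γ t) (hγ1 : ∀ᵐ t ∂volume.restrict (Icc (0 : ℝ) 1), 0 < γ t)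
    (hR : IsUniformRef γ R) (ha : ∀ x, 0 ≤ a x) (hb : ∀ x, 0 ≤ b x) :
    HasRefBridges γ (bridgeMixture R a b) := by
  intro t x x₀ x₁
  have hK := refKernel_pos hγ hγ0 hγ1 (left_mem_Icc.mpr zero_le_one)
    (right_mem_Icc.mpr (zero_le_one' ℝ)) zero_lt_one x₁ x₀
  rw [bridgeMixture_triple hγ0 hR ha hb, bridgeMixture_endpoints hγ0 hR ha hb,
    ← ENNReal.ofReal_mul (mul_nonneg (mul_nonneg (ha _) hK.le) (hb _))]
  congr 1
  rw [refBridge]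
  field_simp

/-! ### The rates of these path measures -/

/-- The Doob transform of the reference rate by the positive functions `c t`. -/
noncomputable def doobRate (γ : ℝ → ℝ) (c : ℝ → State N D → ℝ) :
    ℝ → State N D → State N D → ℝ :=
  rateMatrix fun t y x => c t y / c t x * refRate γ t x y

/-- The controller associated with a positive function on the state space. -/
noncomputable def ratioController (γ : ℝ → ℝ) (b : State N D → ℝ) (t : ℝ) (x : State N D)
    (d : Fin D) (n : ZMod N) : ℝ :=
  coevolve γ b t (upd x d n) / coevolve γ b t x

/-- A state at Hamming distance 1 from `x` is `upd x d n` with `n ≠ x d` for exactly one pair `(d,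
n)`. -/
theorem sum_jumps (x y : State N D) (g : ℝ) :
    (∑ d, ∑ n ∈ Finset.univ.filter (fun n => n ≠ x d), if y = upd x d n then g else 0) =
      if hammingDist x y = 1 then g else 0 := by
  have h := sum_hammingDist_one x fun z => if y = z then g else 0
  rw [← h]
  have : ∀ z, (if hammingDist x z = 1 then if y = z then g else 0 else 0) =
      if y = z then (if hammingDist x y = 1 then g else 0) else 0 := by
    intro z
    by_cases hz : y = z
    · subst hz; simp
    · simp [hz]
  simp only [this, Finset.sum_ite_eq, Finset.mem_univ, if_true]

theorem rateMatrix_congr {f g : ℝ → State N D → State N D → ℝ} {t : ℝ}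
    (h : ∀ y x, y ≠ x → f t y x = g t y x) : rateMatrix f t = rateMatrix g t := by
  funext y x
  unfold rateMatrix
  split_ifs with hyx
  · congr 1
    exact Finset.sum_congr rfl fun z hz => h z x (Finset.mem_filter.mp hz).2
  · exact h y x hyx

/-- On jumps of a single entry both rates are the reference rate times a ratio of `coevolve`; on
other jumps both vanish, and the diagonal is determined by the rest. -/
theorem ctrlRate_ratioController (t : ℝ) :
    ctrlRate γ (ratioController γ b) t = doobRate γ (coevolve γ b) t := by
  refine rateMatrix_congr fun y x hyx => ?_
  have h1 : ∀ d n, (if y = upd x d n then refRate γ t y x * ratioController γ b t x d n else 0) =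
      if y = upd x d n then refRate γ t y x * (coevolve γ b t y / coevolve γ b t x) else 0 := by
    intro d n
    split_ifs with h
    · rw [ratioController, ← h]
    · rfl
  simp only [h1]
  rw [sum_jumps]
  split_ifs with h
  · rw [refRate_comm, mul_comm]
  · rw [refRate, if_neg h, if_neg hyx.symm, mul_zero]

/-- The right side is, up to sign, what the product rule gives for `k * c` when `k` and `c` solve
reference equations in opposite time directions. Since the reference rate is symmetric, the same
identity serves the forward and the backward chain. -/
theorem sum_doobRate {c : ℝ → State N D → ℝ} {t : ℝ} (hc : ∀ x, c t x ≠ 0) (k : State N D → ℝ)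
    (y : State N D) :
    ∑ z, doobRate γ c t y z * (k z * c t z) =
      c t y * ∑ z, refRate γ t y z * k z - k y * ∑ z, refRate γ t y z * c t z := by
  have h1 : ∀ z, doobRate γ c t y z * (k z * c t z) = c t y * (refRate γ t y z * k z) -
      if y = z then k y * ∑ w, refRate γ t y w * c t w else 0 := by
    intro z
    by_cases hz : y = z
    · subst hz
      have hs := Finset.sum_filter_add_sum_filter_not Finset.univ (fun z => z ≠ y)
        (fun w => refRate γ t y w * c t w)
      have h3 : (Finset.univ.filter fun z => ¬ (z ≠ y)) = {y} := by ext n; simp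
      rw [h3, Finset.sum_singleton] at hs
      rw [if_pos rfl, ← hs, doobRate, rateMatrix, if_pos rfl]
      have : ∑ w ∈ Finset.univ.filter (fun z => z ≠ y), c t w / c t y * refRate γ t y w =
          (∑ w ∈ Finset.univ.filter (fun z => z ≠ y), refRate γ t y w * c t w) / c t y := by
        rw [Finset.sum_div]
        exact Finset.sum_congr rfl fun w _ => by ring
      rw [this]
      have := hc y
      field_simp
      ring
    · rw [if_neg hz, doobRate, rateMatrix, if_neg hz, refRate_comm t z y]
      have := hc z
      field_simp
      ring
  rw [Finset.sum_congr rfl fun z _ => h1 z, Finset.sum_sub_distrib, ← Finset.mul_sum,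
    Finset.sum_ite_eq, if_pos (Finset.mem_univ _)]

theorem hasDerivAt_evolve (hγ : ContinuousOn γ (Icc 0 1)) {t : ℝ} (ht : t ∈ Ioo (0 : ℝ) 1)
    (a : State N D → ℝ) (x : State N D) :
    HasDerivAt (fun t' => evolve γ a t' x) (∑ z, refRate γ t x z * evolve γ a t z) t := by
  have h := HasDerivAt.fun_sum (u := Finset.univ) fun y _ =>
    (hasDerivAt_refKernel_right hγ (left_mem_Icc.mpr zero_le_one) ht x y).mul_const (a y)
  refine h.congr_deriv ?_
  simp only [evolve, Finset.sum_mul, Finset.mul_sum]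
  rw [Finset.sum_comm]
  exact Finset.sum_congr rfl fun z _ => Finset.sum_congr rfl fun y _ => by ring

theorem hasDerivAt_coevolve (hγ : ContinuousOn γ (Icc 0 1)) {t : ℝ} (ht : t ∈ Ioo (0 : ℝ) 1)
    (b : State N D → ℝ) (x : State N D) :
    HasDerivAt (fun t' => coevolve γ b t' x) (-∑ z, refRate γ t x z * coevolve γ b t z) t := by
  have h := HasDerivAt.fun_sum (u := Finset.univ) fun y _ =>
    (hasDerivAt_refKernel_left hγ (right_mem_Icc.mpr zero_le_one) ht y x).mul_const (b y)
  refine h.congr_deriv ?_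
  simp only [coevolve, neg_mul, Finset.sum_mul, Finset.mul_sum, Finset.sum_neg_distrib]
  rw [Finset.sum_comm]
  congr 1
  exact Finset.sum_congr rfl fun z _ => Finset.sum_congr rfl fun y _ => by
    rw [refRate_comm t z x]; ring

theorem continuousOn_evolve (hγ : ContinuousOn γ (Icc 0 1)) (a : State N D → ℝ) (x : State N D) :
    ContinuousOn (fun t => evolve γ a t x) (Icc 0 1) :=
  continuousOn_finsetSum _ fun y _ =>
    (continuousOn_refKernel_right hγ (left_mem_Icc.mpr zero_le_one) x y).mul continuousOn_const

theorem continuousOn_coevolve (hγ : ContinuousOn γ (Icc 0 1)) (b : State N D → ℝ) (x : State N D) :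
    ContinuousOn (fun t => coevolve γ b t x) (Icc 0 1) :=
  continuousOn_finsetSum _ fun y _ =>
    (continuousOn_refKernel_left hγ (right_mem_Icc.mpr zero_le_one) y x).mul continuousOn_const

/-- At time 1 the kernel is the identity, so positivity rests on its total mass 1 and on `b > 0`
everywhere. In `evolve_pos`, `a` may have zeros; there the kernel itself must be positive, which
excludes time 0. -/
theorem coevolve_pos (hγ0 : ∀ t ∈ Icc (0 : ℝ) 1, 0 ≤ γ t)
    (hb : ∀ x, 0 < b x) {t : ℝ} (ht : t ∈ Icc (0 : ℝ) 1) (x : State N D) : 0 < coevolve γ b t x := by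
  have h0 := fun y => refKernel_nonneg hγ0 ht (right_mem_Icc.mpr zero_le_one) ht.2 y x
  refine (coevolve_nonneg hγ0 (fun x => (hb x).le) ht x).lt_of_ne' fun h => ?_
  have h1 := (Finset.sum_eq_zero_iff_of_nonneg fun y _ => mul_nonneg (h0 y) (hb y).le).mp h
  have h2 : ∑ y, refKernel γ t 1 y x = 0 := Finset.sum_eq_zero fun y hy =>
    (mul_eq_zero.mp (h1 y hy)).resolve_right (hb y).ne'
  rw [refKernel_sum] at h2
  exact one_ne_zero h2

theorem evolve_pos (hγ : ContinuousOn γ (Icc 0 1)) (hγ0 : ∀ t ∈ Icc (0 : ℝ) 1, 0 ≤ γ t)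
    (hγ1 : ∀ᵐ t ∂volume.restrict (Icc (0 : ℝ) 1), 0 < γ t) (ha : ∀ x, 0 ≤ a x) (ha1 : ∃ x, 0 < a x)
    {t : ℝ} (ht : t ∈ Ioc (0 : ℝ) 1) (x : State N D) : 0 < evolve γ a t x := by
  obtain ⟨y, hy⟩ := ha1
  have h0 := fun y => refKernel_pos hγ hγ0 hγ1 (left_mem_Icc.mpr zero_le_one) (Ioc_subset_Icc_self ht)
    ht.1 x y
  exact Finset.sum_pos' (fun z _ => mul_nonneg (h0 z).le (ha z))
    ⟨y, Finset.mem_univ y, mul_pos (h0 y) hy⟩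

/-- The forward description of a path measure with reference bridges. -/
theorem isForwardCTMC_bridgeMixture (hγ : ContinuousOn γ (Icc 0 1))
    (hγ0 : ∀ t ∈ Icc (0 : ℝ) 1, 0 ≤ γ t) (hR : IsUniformRef γ R) {μ : State N D → ℝ}
    (hμ : IsProbVec μ) (ha : ∀ x, 0 ≤ a x) (hb : ∀ x, 0 < b x)
    (hab : ∀ x, a x * coevolve γ b 0 x = μ x) :
    IsForwardCTMC μ (doobRate γ (coevolve γ b)) (bridgeMixture R a b) := by
  have hb' : ∀ x, 0 ≤ b x := fun x => (hb x).le
  have hpos : ∀ t ∈ Icc (0 : ℝ) 1, ∀ x, 0 < coevolve γ b t x := fun t ht x => coevolve_pos hγ0 hb ht x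
  -- The kernel is the Doob transform of the reference kernel. In path probabilities the quotients
  -- of `coevolve` telescope, leaving its value at the last time over its value at time 0.
  refine ⟨isProbabilityMeasure_bridgeMixture hγ0 hR ha hb' 0 ?_,
    fun s t y x => refKernel γ s t y x * coevolve γ b t y / coevolve γ b s x, ⟨?_, ?_, ?_⟩, ?_⟩
  · simp only [Icc.coe_zero, evolve_zero, hab, hμ.2]
  · intro s hs y x
    simp only [refKernel_self]
    split_ifs with h
    · subst h
      rw [one_mul, div_self (hpos s hs y).ne']
    · simp
  · intro s hs y x
    exact (((continuousOn_refKernel_right hγ hs y x).mul ((continuousOn_coevolve hγ b y).mono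
      (Icc_subset_Icc_left hs.1))).div_const _)
  · intro s hs t ht y x
    have ht0 : t ∈ Ioo (0 : ℝ) 1 := ⟨hs.1.trans_lt ht.1, ht.2⟩
    have h := ((hasDerivAt_refKernel_right hγ hs ht y x).mul
      (hasDerivAt_coevolve hγ ht0 b y)).div_const (coevolve γ b s x)
    refine h.congr_deriv ?_
    have h2 := sum_doobRate (γ := γ) (c := coevolve γ b)
      (fun z => (hpos t (Ioo_subset_Icc_self ht0) z).ne') (fun z => refKernel γ s t z x) y
    have h3 : ∑ z, doobRate γ (coevolve γ b) t y z *
        (refKernel γ s t z x * coevolve γ b t z / coevolve γ b s x) =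
        (∑ z, doobRate γ (coevolve γ b) t y z * (refKernel γ s t z x * coevolve γ b t z)) /
          coevolve γ b s x := by
      rw [Finset.sum_div]
      exact Finset.sum_congr rfl fun z _ => by ring
    rw [h3, h2]
    ring
  · intro n t x ht ht0
    have h := bridgeMixture_follow hγ0 hR ha hb' (fun i => (t i, x i)) ht
    refine h.trans ?_
    congr 1
    have h2 := prod_fin_telescope (fun i => coevolve γ b (t i) (x i))
      (fun i : Fin n => refKernel γ (t i.castSucc) (t i.succ) (x i.succ) (x i.castSucc))
      (fun i : Fin n => refKernel γ (t i.castSucc) (t i.succ) (x i.succ) (x i.castSucc) *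
        coevolve γ b (t i.succ) (x i.succ) / coevolve γ b (t i.castSucc) (x i.castSucc)) (by
        intro i
        have := (hpos _ (t i.castSucc).2 (x i.castSucc)).ne'
        field_simp)
    simp only [ht0, Icc.coe_zero] at h2 ⊢
    rw [evolve_zero, mul_assoc, ← h2, ← hab]
    ring

/-- The backward description of a path measure with reference bridges. -/
theorem isBackwardCTMC_bridgeMixture (hγ : ContinuousOn γ (Icc 0 1))
    (hγ0 : ∀ t ∈ Icc (0 : ℝ) 1, 0 ≤ γ t) (hγ1 : ∀ᵐ t ∂volume.restrict (Icc (0 : ℝ) 1), 0 < γ t)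
    (hR : IsUniformRef γ R) {ν : State N D → ℝ}
    (hν : IsProbVec ν) (ha : ∀ x, 0 ≤ a x) (ha1 : ∃ x, 0 < a x) (hb : ∀ x, 0 ≤ b x)
    (hab : ∀ x, evolve γ a 1 x * b x = ν x) :
    IsBackwardCTMC ν (doobRate γ (evolve γ a)) (bridgeMixture R a b) := by
  classical
  have hpos : ∀ t ∈ Ioc (0 : ℝ) 1, ∀ x, 0 < evolve γ a t x := fun t ht x =>
    evolve_pos hγ hγ0 hγ1 ha ha1 ht x
  -- At time 0 `evolve γ a` equals `a`, which may vanish, so the quotient is replaced there by the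
  -- identity. This suffices, since a backward chain at time 0 has no time left.
  set K : ℝ → ℝ → State N D → State N D → ℝ := fun t s y x => if t = 0 then (if y = x then 1 else 0)
    else refKernel γ s t x y * evolve γ a s y / evolve γ a t x with hK
  refine ⟨isProbabilityMeasure_bridgeMixture hγ0 hR ha hb 1 ?_, K, ⟨?_, ?_, ?_⟩, ?_⟩
  · simp only [Icc.coe_one, coevolve_one, hab, hν.2]
  · intro t ht y x
    simp only [hK]
    by_cases h0 : t = 0
    · rw [if_pos h0]
    · rw [if_neg h0, refKernel_self]
      have := (hpos t ⟨ht.1.lt_of_ne' h0, ht.2⟩ x).ne'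
      by_cases h : y = x
      · subst h; simp [this]
      · simp [h, Ne.symm h]
  · intro t ht y x
    simp only [hK]
    by_cases h0 : t = 0
    · simp only [h0, if_true]; exact continuousOn_const
    · simp only [h0, if_false]
      exact (((continuousOn_refKernel_left hγ ht x y).mul ((continuousOn_evolve hγ a y).mono
        (Icc_subset_Icc_right ht.2))).div_const _)
  · intro t ht s hs y x
    have h0 : t ≠ 0 := (hs.1.trans hs.2).ne'
    have hs0 : s ∈ Ioo (0 : ℝ) 1 := ⟨hs.1, hs.2.trans_le ht.2⟩
    simp only [hK, h0, if_false]
    have h := ((hasDerivAt_refKernel_left hγ ht hs x y).mul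
      (hasDerivAt_evolve hγ hs0 a y)).div_const (evolve γ a t x)
    refine h.congr_deriv ?_
    have h2 := sum_doobRate (γ := γ) (c := evolve γ a)
      (fun z => (hpos s (Ioo_subset_Ioc_self hs0) z).ne') (fun z => refKernel γ s t x z) y
    have h3 : ∑ z, doobRate γ (evolve γ a) s y z *
        (refKernel γ s t x z * evolve γ a s z / evolve γ a t x) =
        (∑ z, doobRate γ (evolve γ a) s y z * (refKernel γ s t x z * evolve γ a s z)) /
          evolve γ a t x := by
      rw [Finset.sum_div]
      exact Finset.sum_congr rfl fun z _ => by ring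
    rw [h3, h2]
    simp only [refRate_comm s _ y]
    ring
  · intro n t x ht ht0
    have h := bridgeMixture_follow hγ0 hR ha hb (fun i : Fin (n + 1) => (t i.rev, x i.rev))
      (fun i j hij => ht (Fin.rev_le_rev.mpr hij))
    have hset : {ω : PathSpace N D | ∀ i, ω (t i) = x i} =
        {ω | ∀ i : Fin (n + 1), ω (t i.rev) = x i.rev} := by
      ext ω
      exact ⟨fun h i => h i.rev, fun h i => by simpa using h i.rev⟩
    rw [hset]
    refine h.trans ?_
    congr 1
    have hprod : ∏ i : Fin n, refKernel γ (t i.castSucc.rev) (t i.succ.rev) (x i.succ.rev)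
          (x i.castSucc.rev) =
        ∏ i : Fin n, refKernel γ (t i.succ) (t i.castSucc) (x i.castSucc) (x i.succ) := by
      rw [← Equiv.prod_comp Fin.revPerm]
      refine Finset.prod_congr rfl fun i _ => ?_
      simp only [Fin.revPerm_apply, Fin.rev_castSucc, Fin.rev_succ, Fin.rev_rev]
    have h2 := prod_fin_telescope (fun i => evolve γ a (t i) (x i))
      (fun i : Fin n => refKernel γ (t i.succ) (t i.castSucc) (x i.castSucc) (x i.succ))
      (fun i : Fin n => K (t i.castSucc) (t i.succ) (x i.succ) (x i.castSucc)) (by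
        intro i
        simp only [hK]
        by_cases h0 : (t i.castSucc : ℝ) = 0
        · have h1 : (t i.succ : ℝ) = 0 := by
            refine le_antisymm ?_ (t i.succ).2.1
            rw [← h0]
            exact ht (Fin.castSucc_lt_succ).le
          rw [if_pos h0, h0, h1, refKernel_self]
          by_cases hx : x i.succ = x i.castSucc
          · simp [hx]
          · simp [hx, Ne.symm hx]
        · rw [if_neg h0]
          have := (hpos _ ⟨(t i.castSucc).2.1.lt_of_ne' h0, (t i.castSucc).2.2⟩
            (x i.castSucc)).ne'
          field_simp)
    simp only [Fin.rev_last, Fin.rev_zero, hprod, ht0, Icc.coe_one, coevolve_one] at h2 ⊢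
    rw [mul_comm (evolve γ a _ _), ← h2, ← hab]
    ring

end BridgeMixture

/-! ### Kullback–Leibler divergence -/

section KL

variable {Ω α : Type*} [MeasurableSpace Ω] [MeasurableSpace α]

theorem klDiv_withDensity {Q : Measure Ω} [IsFiniteMeasure Q] {g : Ω → ℝ≥0∞} (hg : Measurable g)
    [IsFiniteMeasure (Q.withDensity g)] :
    klDiv (Q.withDensity g) Q = ∫⁻ ω, ENNReal.ofReal (klFun (g ω).toReal) ∂Q := by
  rw [klDiv_eq_lintegral_klFun_of_ac (withDensity_absolutelyContinuous Q g)]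
  refine lintegral_congr_ae ?_
  filter_upwards [Q.rnDeriv_withDensity hg] with ω hω
  rw [hω]

theorem map_withDensity_comp {Q : Measure Ω} {T : Ω → α} (hT : Measurable T) {g : α → ℝ≥0∞}
    (hg : Measurable g) :
    (Q.withDensity fun ω => g (T ω)).map T = (Q.map T).withDensity g := by
  ext s hs
  rw [Measure.map_apply hT hs, withDensity_apply _ (hT hs), withDensity_apply _ hs,
    setLIntegral_map hs hg hT]

/-- No information is lost under a map through which the density factors. -/
theorem klDiv_map_withDensity_comp {Q : Measure Ω} [IsFiniteMeasure Q] {T : Ω → α}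
    (hT : Measurable T) {g : α → ℝ≥0∞} (hg : Measurable g)
    [IsFiniteMeasure (Q.withDensity fun ω => g (T ω))] :
    klDiv ((Q.withDensity fun ω => g (T ω)).map T) (Q.map T) =
      klDiv (Q.withDensity fun ω => g (T ω)) Q := by
  have h : IsFiniteMeasure ((Q.map T).withDensity g) := by
    rw [← map_withDensity_comp hT hg]; infer_instance
  rw [map_withDensity_comp hT hg, klDiv_withDensity hg, klDiv_withDensity (g := fun ω => g (T ω)) (hg.comp hT),
    lintegral_map (by fun_prop) hT]

/-- From `log g ≤ g - 1` one gets `g log g + 1 - g ≤ (g - 1) ^ 2`, which also holds at `g = 0`. -/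
theorem klDiv_withDensity_le {Q : Measure Ω} [IsProbabilityMeasure Q] {g : Ω → ℝ}
    (hg : Measurable g) (hg0 : ∀ ω, 0 ≤ g ω) {δ : ℝ} (hδ : ∀ ω, |g ω - 1| ≤ δ)
    [IsFiniteMeasure (Q.withDensity fun ω => ENNReal.ofReal (g ω))] :
    klDiv (Q.withDensity fun ω => ENNReal.ofReal (g ω)) Q ≤ ENNReal.ofReal (δ ^ 2) := by
  rw [klDiv_withDensity (by fun_prop)]
  calc _ ≤ ∫⁻ _, ENNReal.ofReal (δ ^ 2) ∂Q := lintegral_mono fun ω => ENNReal.ofReal_le_ofReal ?_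
    _ = ENNReal.ofReal (δ ^ 2) := by simp
  rw [ENNReal.toReal_ofReal (hg0 ω), klFun_apply]
  have h1 : (g ω - 1) ^ 2 ≤ δ ^ 2 := sq_le_sq' (neg_le_of_abs_le (hδ ω)) (le_of_abs_le (hδ ω))
  refine le_trans ?_ h1
  rcases (hg0 ω).eq_or_lt with h | h
  · rw [← h]; norm_num
  · nlinarith [Real.log_le_sub_one_of_pos h]

/-- A tilted measure minimizes the divergence among the measures with the same mean of the
tilting function. -/
theorem klDiv_tilted_le {p R : Measure Ω} [IsProbabilityMeasure p] [IsProbabilityMeasure R]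
    {f : Ω → ℝ} {C : ℝ} (hf : Measurable f) (hC : ∀ ω, |f ω| ≤ C)
    (hp : ∫ ω, f ω ∂p = ∫ ω, f ω ∂(R.tilted f)) : klDiv (R.tilted f) R ≤ klDiv p R := by
  have hexp : Integrable (fun ω => Real.exp (f ω)) R :=
    Integrable.of_bound (by fun_prop) (Real.exp C) (ae_of_all _ fun ω => by
      rw [Real.norm_eq_abs, Real.abs_exp]
      exact Real.exp_le_exp.mpr (le_of_abs_le (hC ω)))
  have hfi : ∀ m : Measure Ω, IsFiniteMeasure m → Integrable f m := fun m _ =>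
    Integrable.of_bound hf.aestronglyMeasurable C (ae_of_all _ hC)
  have hT : IsProbabilityMeasure (R.tilted f) := isProbabilityMeasure_tilted hexp
  by_cases htop : klDiv p R = ∞
  · rw [htop]; exact le_top
  obtain ⟨hac, hint⟩ := klDiv_ne_top_iff.mp htop
  have hself : llr (R.tilted f) R =ᵐ[R.tilted f]
      fun ω => f ω - Real.log (∫ z, Real.exp (f z) ∂ R) :=
    (tilted_absolutelyContinuous R f).ae_le (log_rnDeriv_tilted_left_self hexp)
  have hint' : Integrable (llr (R.tilted f) R) (R.tilted f) := by
    rw [integrable_congr hself]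
    exact (hfi _ inferInstance).sub (integrable_const _)
  -- The divergence of `p` from `R` is its divergence from the tilted measure, which is nonnegative,
  -- plus the mean of `f` minus the log-normalizer. The tilted measure has the same mean and the
  -- first term zero.
  have h1 := integral_llr_tilted_right hac (hfi p inferInstance) hexp hint
  have h2 := integral_llr_add_sub_measure_univ_nonneg
    (hac.trans (absolutelyContinuous_tilted hexp))
    (integrable_llr_tilted_right hac (hfi p inferInstance) hint hexp)
  rw [← ENNReal.toReal_le_toReal (klDiv_ne_top (tilted_absolutelyContinuous R f) hint') htop,
    toReal_klDiv_of_measure_eq (tilted_absolutelyContinuous R f) (by simp),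
    toReal_klDiv_of_measure_eq hac (by simp), integral_congr_ae hself,
    integral_sub (hfi _ inferInstance) (integrable_const _), ← hp]
  simp only [probReal_univ, integral_const, smul_eq_mul, one_mul] at h2 ⊢
  linarith

end KL

/-! ### Optimality in the half-bridge and bridge problems from the form of the density. -/

section KLPaths

variable {N D : ℕ} [NeZero N] {γ : ℝ → ℝ} {R P Q : Measure (PathSpace N D)}
  {a b a' b' : State N D → ℝ}

theorem map_eval_eq_of_hasMarginal {t : I} {μ : State N D → ℝ} (hP : HasMarginal P t μ)
    (hQ : HasMarginal Q t μ) : P.map (fun ω => ω t) = Q.map fun ω => ω t := by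
  refine Measure.ext_of_singleton fun x => ?_
  rw [Measure.map_apply (measurable_eval t) (measurableSet_singleton x),
    Measure.map_apply (measurable_eval t) (measurableSet_singleton x)]
  exact (hP x).trans (hQ x).symm

/-- The hypothesis is a product identity rather than a formula for a quotient, so that the endpoint
factors may have zeros. -/
theorem bridgeMixture_withDensity {g : State N D → State N D → ℝ}
    (ha : ∀ x, 0 ≤ a x) (hb : ∀ x, 0 ≤ b x) (h : ∀ x y, a' x * b' y = a x * b y * g x y) :
    bridgeMixture R a' b' =
      (bridgeMixture R a b).withDensity fun ω => ENNReal.ofReal (g (ω 0) (ω 1)) := by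
  have hm : ∀ g : State N D → State N D → ℝ≥0∞, Measurable fun ω : PathSpace N D => g (ω 0) (ω 1) :=
    fun g => (measurable_of_finite fun p : State N D × State N D => g p.1 p.2).comp
      ((measurable_eval (N := N) (D := D) 0).prodMk (measurable_eval 1))
  unfold bridgeMixture
  rw [← withDensity_mul _ (hm fun x y => ENNReal.ofReal (Fintype.card (State N D) * (a x * b y)))
    (hm fun x y => ENNReal.ofReal (g x y))]
  congr 1
  funext ω
  rw [h, Pi.mul_apply, ← ENNReal.ofReal_mul (mul_nonneg (Nat.cast_nonneg _)
    (mul_nonneg (ha _) (hb _)))]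
  congr 1
  ring

/-- As the density depends on `ω 0` only, the divergence of `P` from `Q` equals that of their
marginals at time 0. Every competitor has the same marginal as `P` there, and passing to marginals
cannot increase its divergence. -/
theorem solvesForwardHalfBridge_withDensity {μ : State N D → ℝ} [IsProbabilityMeasure P]
    [IsProbabilityMeasure Q] (hP : HasMarginal P 0 μ) {g : State N D → ℝ≥0∞}
    (hPQ : P = Q.withDensity fun ω => g (ω 0)) : SolvesForwardHalfBridge μ Q P := by
  refine ⟨inferInstance, hP, fun p _ hp => ?_⟩
  have : IsFiniteMeasure (Q.withDensity fun ω => g (ω 0)) := hPQ ▸ inferInstance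
  rw [hPQ, ← klDiv_map_withDensity_comp (measurable_eval 0) (measurable_of_finite g), ← hPQ,
    ← map_eval_eq_of_hasMarginal hp hP]
  exact klDiv_map_le _ _ (measurable_eval 0)

/-- The same argument at time 1, where now the second argument of the divergence varies and its
marginal is prescribed. -/
theorem solvesBackwardHalfBridge_withDensity {ν : State N D → ℝ} [IsProbabilityMeasure P]
    [IsProbabilityMeasure Q] (hQ : HasMarginal Q 1 ν) {g : State N D → ℝ≥0∞}
    (hPQ : P = Q.withDensity fun ω => g (ω 1)) : SolvesBackwardHalfBridge ν P Q := by
  refine ⟨inferInstance, hQ, fun q _ hq => ?_⟩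
  have : IsFiniteMeasure (Q.withDensity fun ω => g (ω 1)) := hPQ ▸ inferInstance
  have h : klDiv P Q = klDiv (P.map fun ω => ω 1) (Q.map fun ω => ω 1) := by
    rw [hPQ, klDiv_map_withDensity_comp (measurable_eval 1) (measurable_of_finite g)]
  rw [h, ← map_eval_eq_of_hasMarginal hq hQ]
  exact klDiv_map_le _ _ (measurable_eval 1)

/-- The logarithm of the density is a sum of functions of the two endpoints, so its mean is the same
for all measures with the prescribed marginals, and `klDiv_tilted_le` applies. -/
theorem solvesBridge_of_product_density {μ ν : State N D → ℝ} [IsProbabilityMeasure P]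
    [IsProbabilityMeasure R] (hP0 : HasMarginal P 0 μ) (hP1 : HasMarginal P 1 ν)
    {g h : State N D → ℝ} (hg : ∀ x, 0 < g x) (hh : ∀ x, 0 < h x)
    (hPR : P = R.withDensity fun ω => ENNReal.ofReal (g (ω 0) * h (ω 1))) :
    SolvesBridge μ ν R P := by
  refine ⟨inferInstance, hP0, hP1, fun p _ hp0 hp1 => ?_⟩
  have hmeas : ∀ (t : I) (g : State N D → ℝ), Measurable fun ω : PathSpace N D => g (ω t) :=
    fun t g => (measurable_of_finite g).comp (measurable_eval t)
  set f : PathSpace N D → ℝ := fun ω => Real.log (g (ω 0)) + Real.log (h (ω 1)) with hf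
  have hfm : Measurable f := (hmeas 0 fun x => Real.log (g x)).add (hmeas 1 fun x => Real.log (h x))
  have hexp : ∀ ω, Real.exp (f ω) = g (ω 0) * h (ω 1) := fun ω => by
    rw [hf]; simp only [Real.exp_add, Real.exp_log (hg _), Real.exp_log (hh _)]
  have hgb : ∀ g : State N D → ℝ, ∃ C, ∀ x, |g x| ≤ C := fun g =>
    ⟨∑ x, |g x|, fun x => Finset.single_le_sum (f := fun x => |g x|) (fun _ _ => abs_nonneg _)
      (Finset.mem_univ x)⟩
  obtain ⟨C₁, hC₁⟩ := hgb fun x => Real.log (g x)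
  obtain ⟨C₂, hC₂⟩ := hgb fun x => Real.log (h x)
  have hone : ∫ ω, Real.exp (f ω) ∂ R = 1 := by
    rw [integral_eq_lintegral_of_nonneg_ae (ae_of_all _ fun ω => (Real.exp_pos _).le)
      (by fun_prop)]
    simp only [hexp]
    rw [← setLIntegral_univ, ← withDensity_apply _ MeasurableSet.univ, ← hPR]
    simp
  have htilt : P = R.tilted f := by
    rw [hPR, Measure.tilted]
    rw [hone]
    simp only [div_one, hexp]
  have hint : ∀ (m : Measure (PathSpace N D)) (_ : IsProbabilityMeasure m) (t : I)
      (g : State N D → ℝ), Integrable (fun ω => g (ω t)) m := fun m _ t g => by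
    obtain ⟨C, hC⟩ := hgb g
    exact Integrable.of_bound (hmeas t g).aestronglyMeasurable C (ae_of_all _ fun ω => hC _)
  have hmean : ∀ (t : I) (κ : State N D → ℝ) (g : State N D → ℝ), HasMarginal p t κ →
      HasMarginal P t κ → ∫ ω, g (ω t) ∂p = ∫ ω, g (ω t) ∂P := by
    intro t κ g h1 h2
    rw [← integral_map (φ := fun ω : PathSpace N D => ω t) (f := g)
      (measurable_eval t).aemeasurable (measurable_of_finite g).aestronglyMeasurable,
      map_eval_eq_of_hasMarginal h1 h2, integral_map (φ := fun ω : PathSpace N D => ω t) (f := g)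
      (measurable_eval t).aemeasurable (measurable_of_finite g).aestronglyMeasurable]
  rw [htilt]
  refine klDiv_tilted_le (C := C₁ + C₂) hfm (fun ω => (abs_add_le _ _).trans
    (add_le_add (hC₁ _) (hC₂ _))) ?_
  rw [← htilt]
  simp only [hf]
  rw [integral_add (hint p inferInstance 0 fun x => Real.log (g x))
    (hint p inferInstance 1 fun x => Real.log (h x)),
    integral_add (hint P inferInstance 0 fun x => Real.log (g x))
    (hint P inferInstance 1 fun x => Real.log (h x)),
    hmean 0 μ (fun x => Real.log (g x)) hp0 hP0, hmean 1 ν (fun x => Real.log (h x)) hp1 hP1]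

end KLPaths

/-! ### The Sinkhorn iteration -/

section Sinkhorn

variable {S : Type*} [Fintype S] {K : S → S → ℝ} {μ ν : S → ℝ}

/-- The matrix `K` applied from the left. -/
def colSum (K : S → S → ℝ) (b : S → ℝ) (x : S) : ℝ := ∑ y, K y x * b y

/-- One step of the Sinkhorn iteration. -/
noncomputable def sinkhornStep (K : S → S → ℝ) (μ ν : S → ℝ) (b : S → ℝ) (y : S) : ℝ :=
  ν y / ∑ x, K y x * (μ x / colSum K b x)

theorem colSum_pos [Nonempty S] (hK : ∀ y x, 0 < K y x) {b : S → ℝ} (hb : ∀ y, 0 < b y) (x : S) :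
    0 < colSum K b x :=
  Finset.sum_pos (fun y _ => mul_pos (hK y x) (hb y)) Finset.univ_nonempty

theorem exists_pos_of_sum_eq_one (hμ : ∀ x, 0 ≤ μ x) (hμ1 : ∑ x, μ x = 1) : ∃ x, 0 < μ x := by
  by_contra! h
  have : ∑ x, μ x = 0 := Finset.sum_eq_zero fun x _ => le_antisymm (h x) (hμ x)
  rw [hμ1] at this
  exact one_ne_zero this

theorem sinkhorn_denominator_pos [Nonempty S] (hK : ∀ y x, 0 < K y x) (hμ : ∀ x, 0 ≤ μ x)
    (hμ1 : ∑ x, μ x = 1) {b : S → ℝ} (hb : ∀ y, 0 < b y) (y : S) :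
    0 < ∑ x, K y x * (μ x / colSum K b x) := by
  obtain ⟨x, hx⟩ := exists_pos_of_sum_eq_one hμ hμ1
  exact Finset.sum_pos' (fun z _ => mul_nonneg (hK _ _).le (div_nonneg (hμ z) (colSum_pos hK hb z).le))
    ⟨x, Finset.mem_univ x, mul_pos (hK _ _) (div_pos hx (colSum_pos hK hb x))⟩

/-- The dual objective of the Schrödinger problem. -/
noncomputable def sinkhornDual (K : S → S → ℝ) (μ ν : S → ℝ) (b : S → ℝ) : ℝ :=
  ∑ y, ν y * Real.log (b y) - ∑ x, μ x * Real.log (colSum K b x)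

/-- The exponential `G` of the dual objective is continuous on the closed simplex and vanishes where
a coordinate is zero, because `ν` is positive. So it has a maximizer with positive coordinates. The
objective is invariant under scaling, as `μ` and `ν` have equal mass, so the maximum over the
simplex is one over all positive vectors. -/
theorem exists_sinkhornDual_max [Nonempty S] (hK : ∀ y x, 0 < K y x)
    (hμ1 : ∑ x, μ x = 1) (hν : ∀ x, 0 < ν x) (hν1 : ∑ x, ν x = 1) :
    ∃ b : S → ℝ, (∀ y, 0 < b y) ∧ ∀ b' : S → ℝ, (∀ y, 0 < b' y) →
      sinkhornDual K μ ν b' ≤ sinkhornDual K μ ν b := by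
  classical
  set G : (S → ℝ) → ℝ := fun b => (∏ y, b y ^ ν y) * ∏ x, colSum K b x ^ (-μ x) with hG
  have hc : ∀ b ∈ stdSimplex ℝ S, ∀ x, 0 < colSum K b x := by
    intro b hb x
    obtain ⟨y, hy⟩ := exists_pos_of_sum_eq_one hb.1 hb.2
    exact Finset.sum_pos' (fun z _ => mul_nonneg (hK _ _).le (hb.1 z))
      ⟨y, Finset.mem_univ y, mul_pos (hK _ _) hy⟩
  have hcont : ContinuousOn G (stdSimplex ℝ S) := by
    refine ContinuousOn.mul (continuousOn_finsetProd _ fun y _ => ?_)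
      (continuousOn_finsetProd _ fun x _ => ?_)
    · exact ContinuousOn.rpow_const (by fun_prop) fun b _ => Or.inr (hν y).le
    · refine ContinuousOn.rpow_const ?_ fun b hb => Or.inl (hc b hb x).ne'
      unfold colSum
      fun_prop
  have hlog : ∀ b : S → ℝ, (∀ y, 0 < b y) → Real.log (G b) = sinkhornDual K μ ν b := by
    intro b hb
    have h1 : ∀ y, 0 < b y ^ ν y := fun y => Real.rpow_pos_of_pos (hb y) _
    have h2 : ∀ x, 0 < colSum K b x ^ (-μ x) := fun x => Real.rpow_pos_of_pos (colSum_pos hK hb x) _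
    rw [hG, Real.log_mul (Finset.prod_pos fun y _ => h1 y).ne' (Finset.prod_pos fun x _ => h2 x).ne',
      Real.log_prod (fun y _ => (h1 y).ne'), Real.log_prod (fun x _ => (h2 x).ne'), sinkhornDual,
      sub_eq_add_neg, ← Finset.sum_neg_distrib]
    congr 1
    · exact Finset.sum_congr rfl fun y _ => Real.log_rpow (hb y) _
    · exact Finset.sum_congr rfl fun x _ => by rw [Real.log_rpow (colSum_pos hK hb x)]; ring
  have hGpos : ∀ b : S → ℝ, (∀ y, 0 < b y) → 0 < G b := fun b hb =>
    mul_pos (Finset.prod_pos fun y _ => Real.rpow_pos_of_pos (hb y) _)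
      (Finset.prod_pos fun x _ => Real.rpow_pos_of_pos (colSum_pos hK hb x) _)
  obtain ⟨b, hbs, hb⟩ := (isCompact_stdSimplex ℝ S).exists_isMaxOn ⟨ν, fun x => (hν x).le, hν1⟩ hcont
  have hbpos : ∀ y, 0 < b y := by
    intro y
    refine (hbs.1 y).lt_of_ne' fun h0 => ?_
    have h1 : G ν ≤ G b := hb ⟨fun x => (hν x).le, hν1⟩
    have h2 : G b = 0 := by
      simp only [hG]
      rw [Finset.prod_eq_zero (Finset.mem_univ y) (by rw [h0, Real.zero_rpow (hν y).ne']), zero_mul]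
    linarith [hGpos ν hν]
  refine ⟨b, hbpos, fun b' hb' => ?_⟩
  set s := ∑ y, b' y with hs
  have hspos : 0 < s := Finset.sum_pos (fun y _ => hb' y) Finset.univ_nonempty
  have hb'' : ∀ y, 0 < b' y / s := fun y => div_pos (hb' y) hspos
  have hmem : (fun y => b' y / s) ∈ stdSimplex ℝ S :=
    ⟨fun y => (hb'' y).le, by rw [← Finset.sum_div, ← hs, div_self hspos.ne']⟩
  have h1 := Real.log_le_log (hGpos _ hb'') (hb hmem)
  rw [hlog _ hb'', hlog _ hbpos] at h1
  refine le_trans (le_of_eq ?_) h1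
  have h2 : ∀ x, colSum K (fun y => b' y / s) x = colSum K b' x / s := fun x => by
    simp only [colSum, Finset.sum_div, mul_div_assoc]
  simp only [sinkhornDual, h2]
  simp only [Real.log_div (hb' _).ne' hspos.ne', Real.log_div (colSum_pos hK hb' _).ne' hspos.ne',
    mul_sub, Finset.sum_sub_distrib, ← Finset.sum_mul, hμ1, hν1]
  ring

/-- The Schrödinger system has a positive solution. -/
theorem exists_sinkhorn_fixedPoint [Nonempty S] (hK : ∀ y x, 0 < K y x)
    (hμ1 : ∑ x, μ x = 1) (hν : ∀ x, 0 < ν x) (hν1 : ∑ x, ν x = 1) :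
    ∃ b : S → ℝ, (∀ y, 0 < b y) ∧ ∀ y, b y * ∑ x, K y x * (μ x / colSum K b x) = ν y := by
  classical
  obtain ⟨b, hb, hmax⟩ := exists_sinkhornDual_max hK hμ1 hν hν1
  refine ⟨b, hb, fun y => ?_⟩
  -- Only the coordinate `y` is perturbed; the vanishing of this derivative at the maximizer is the
  -- equation at `y`.
  set B : ℝ → S → ℝ := fun t z => b z + if z = y then t else 0 with hB
  have hB0 : B 0 = b := by funext z; simp [hB]
  have hBd : ∀ z, HasDerivAt (fun t => B t z) (if z = y then 1 else 0) 0 := by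
    intro z
    simp only [hB]
    split_ifs
    · exact (hasDerivAt_id (0 : ℝ)).const_add _
    · exact hasDerivAt_const _ _
  have hcd : ∀ x, HasDerivAt (fun t => colSum K (B t) x) (K y x) 0 := by
    intro x
    refine (HasDerivAt.fun_sum (u := Finset.univ) fun z _ => (hBd z).const_mul (K z x)).congr_deriv ?_
    simp
  have hd : HasDerivAt (fun t => sinkhornDual K μ ν (B t))
      ((∑ z, ν z * ((if z = y then 1 else 0) / b z)) - ∑ x, μ x * (K y x / colSum K b x)) 0 := by
    refine HasDerivAt.sub (HasDerivAt.fun_sum fun z _ => ?_) (HasDerivAt.fun_sum fun x _ => ?_)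
    · have h := (hBd z).log (by rw [hB0]; exact (hb z).ne')
      rw [hB0] at h
      exact h.const_mul _
    · have h := (hcd x).log (by rw [hB0]; exact (colSum_pos hK hb x).ne')
      rw [hB0] at h
      exact h.const_mul _
  have hloc : IsLocalMax (fun t => sinkhornDual K μ ν (B t)) 0 := by
    filter_upwards [Ioi_mem_nhds (neg_lt_zero.mpr (hb y))] with t ht
    rw [hB0]
    refine hmax _ fun z => ?_
    simp only [hB]
    split_ifs with hz
    · subst hz
      have : -b z < t := ht
      linarith
    · simpa using hb z
  have h0 := hloc.hasDerivAt_eq_zero hd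
  have h1 : ∑ z, ν z * ((if z = y then 1 else 0) / b z) = ν y / b y := by
    rw [Finset.sum_eq_single y]
    · simp [div_eq_mul_inv]
    · intro z _ hz; simp [hz]
    · simp
  have h2 : ∑ x, K y x * (μ x / colSum K b x) = ∑ x, μ x * (K y x / colSum K b x) :=
    Finset.sum_congr rfl fun x _ => by ring
  rw [h1] at h0
  rw [h2, ← sub_eq_zero.mp h0]
  have := (hb y).ne'
  field_simp

variable {bs : S → ℝ}

/-- The ratio of the column sums of `b` and `bs` is an average of the ratios `b y / bs y`, in which
`y₀` has weight at least `ε`. So both bounds move towards the ratio at `y₀`, and their distance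
shrinks by the factor `1 - ε`. -/
theorem colSum_between [Nonempty S] (hK : ∀ y x, 0 < K y x) {b : S → ℝ} {m M : ℝ} {y₀ : S} {ε : ℝ}
    (hbs : ∀ y, 0 < bs y)
    (hε : ∀ x, ε * colSum K bs x ≤ K y₀ x * bs y₀) (hm : ∀ y, m * bs y ≤ b y)
    (hM : ∀ y, b y ≤ M * bs y) (x : S) :
    (m + ε * (b y₀ / bs y₀ - m)) * colSum K bs x ≤ colSum K b x ∧
      colSum K b x ≤ (M - ε * (M - b y₀ / bs y₀)) * colSum K bs x := by
  have hb0 := hbs y₀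
  set v := b y₀ / bs y₀ with hv
  have hvb : b y₀ = v * bs y₀ := by rw [hv]; field_simp
  have hvm : m ≤ v := by rw [hv, le_div_iff₀ hb0]; exact hm y₀
  have hvM : v ≤ M := by rw [hv, div_le_iff₀ hb0]; exact hM y₀
  constructor
  · have h1 : K y₀ x * (b y₀ - m * bs y₀) ≤ ∑ y, K y x * (b y - m * bs y) :=
      Finset.single_le_sum (f := fun y => K y x * (b y - m * bs y))
        (fun y _ => mul_nonneg (hK y x).le (sub_nonneg.mpr (hm y))) (Finset.mem_univ y₀)
    have h2 : ∑ y, K y x * (b y - m * bs y) = colSum K b x - m * colSum K bs x := by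
      simp only [colSum, Finset.mul_sum, ← Finset.sum_sub_distrib]
      exact Finset.sum_congr rfl fun y _ => by ring
    have h3 := mul_le_mul_of_nonneg_left (hε x) (sub_nonneg.mpr hvm)
    rw [h2, hvb] at h1
    nlinarith
  · have h1 : K y₀ x * (M * bs y₀ - b y₀) ≤ ∑ y, K y x * (M * bs y - b y) :=
      Finset.single_le_sum (f := fun y => K y x * (M * bs y - b y))
        (fun y _ => mul_nonneg (hK y x).le (sub_nonneg.mpr (hM y))) (Finset.mem_univ y₀)
    have h2 : ∑ y, K y x * (M * bs y - b y) = M * colSum K bs x - colSum K b x := by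
      simp only [colSum, Finset.mul_sum, ← Finset.sum_sub_distrib]
      exact Finset.sum_congr rfl fun y _ => by ring
    have h3 := mul_le_mul_of_nonneg_left (hε x) (sub_nonneg.mpr hvM)
    rw [h2, hvb] at h1
    nlinarith

/-- The step inverts the column sums, averages with positive weights, and inverts again, so bounds
on the ratio to the fixed point survive with their order. -/
theorem sinkhornStep_between [Nonempty S] (hK : ∀ y x, 0 < K y x) (hμ : ∀ x, 0 ≤ μ x)
    (hμ1 : ∑ x, μ x = 1) (hbs : ∀ y, 0 < bs y)
    (hfix : ∀ y, bs y * ∑ x, K y x * (μ x / colSum K bs x) = ν y) {b : S → ℝ} (hb : ∀ y, 0 < b y)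
    {m M : ℝ}
    (hmM : ∀ x, m * colSum K bs x ≤ colSum K b x ∧ colSum K b x ≤ M * colSum K bs x) (y : S) :
    m * bs y ≤ sinkhornStep K μ ν b y ∧ sinkhornStep K μ ν b y ≤ M * bs y := by
  have hden := sinkhorn_denominator_pos hK hμ hμ1 hb y
  have hdens := sinkhorn_denominator_pos hK hμ hμ1 hbs y
  set ψ := ∑ x, K y x * (μ x / colSum K b x) with hψ
  set ψs := ∑ x, K y x * (μ x / colSum K bs x) with hψs
  have h1 : m * ψ ≤ ψs := by
    rw [hψ, hψs, Finset.mul_sum]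
    refine Finset.sum_le_sum fun x _ => ?_
    have hc := colSum_pos hK hb x
    have hcs := colSum_pos hK hbs x
    have h : m * (μ x / colSum K b x) ≤ μ x / colSum K bs x := by
      rw [mul_div_assoc', div_le_div_iff₀ hc hcs]
      nlinarith [mul_le_mul_of_nonneg_left (hmM x).1 (hμ x)]
    nlinarith [mul_le_mul_of_nonneg_left h (hK y x).le]
  have h2 : ψs ≤ M * ψ := by
    rw [hψ, hψs, Finset.mul_sum]
    refine Finset.sum_le_sum fun x _ => ?_
    have hc := colSum_pos hK hb x
    have hcs := colSum_pos hK hbs x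
    have h : μ x / colSum K bs x ≤ M * (μ x / colSum K b x) := by
      rw [mul_div_assoc', div_le_div_iff₀ hcs hc]
      nlinarith [mul_le_mul_of_nonneg_left (hmM x).2 (hμ x)]
    nlinarith [mul_le_mul_of_nonneg_left h (hK y x).le]
  rw [sinkhornStep, ← hψ, ← hfix y, le_div_iff₀ hden, div_le_iff₀ hden]
  constructor <;> nlinarith [mul_le_mul_of_nonneg_left h1 (hbs y).le,
    mul_le_mul_of_nonneg_left h2 (hbs y).le]

theorem sinkhornStep_pos [Nonempty S] (hK : ∀ y x, 0 < K y x) (hμ : ∀ x, 0 ≤ μ x)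
    (hμ1 : ∑ x, μ x = 1) (hν : ∀ x, 0 < ν x) {b : S → ℝ} (hb : ∀ y, 0 < b y) (y : S) :
    0 < sinkhornStep K μ ν b y :=
  div_pos (hν y) (sinkhorn_denominator_pos hK hμ hμ1 hb y)

/-- Convergence of the Sinkhorn iteration, up to scaling. -/
theorem sinkhorn_converges [Nonempty S] (hK : ∀ y x, 0 < K y x) (hμ : ∀ x, 0 ≤ μ x)
    (hμ1 : ∑ x, μ x = 1) (hν : ∀ x, 0 < ν x) (hbs : ∀ y, 0 < bs y)
    (hfix : ∀ y, bs y * ∑ x, K y x * (μ x / colSum K bs x) = ν y) {b : ℕ → S → ℝ}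
    (hb0 : ∀ y, 0 < b 0 y) (hb : ∀ k, b (k + 1) = sinkhornStep K μ ν (b k)) :
    ∃ δ : ℕ → ℝ, Tendsto δ atTop (𝓝 0) ∧ ∀ k x y,
      |colSum K (b k) x / colSum K bs x * (bs y / b k y) - 1| ≤ δ k ∧
      |colSum K (b k) x / colSum K bs x * (bs y / b (k + 1) y) - 1| ≤ δ k := by
  have hbpos : ∀ k y, 0 < b k y := by
    intro k
    induction k with
    | zero => exact hb0
    | succ k ih => rw [hb]; exact sinkhornStep_pos hK hμ hμ1 hν ih
  obtain ⟨y₀⟩ := ‹Nonempty S›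
  have : Nonempty S := ⟨y₀⟩
  -- `ε` is the smallest weight of `y₀` among the averages over all `x`; it is positive since the
  -- kernel is.
  obtain ⟨x₁, hx₁⟩ := Finite.exists_min fun x => K y₀ x * bs y₀ / colSum K bs x
  set ε := K y₀ x₁ * bs y₀ / colSum K bs x₁ with hεdef
  have hε0 : 0 < ε := div_pos (mul_pos (hK _ _) (hbs _)) (colSum_pos hK hbs _)
  have hε : ∀ x, ε * colSum K bs x ≤ K y₀ x * bs y₀ := fun x =>
    (le_div_iff₀ (colSum_pos hK hbs x)).mp (hx₁ x)
  have hε1 : ε ≤ 1 := by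
    rw [hεdef, div_le_one (colSum_pos hK hbs _)]
    exact Finset.single_le_sum (f := fun y => K y x₁ * bs y)
      (fun y _ => (mul_pos (hK _ _) (hbs _)).le) (Finset.mem_univ y₀)
  obtain ⟨ym, hym⟩ := Finite.exists_min fun y => b 0 y / bs y
  obtain ⟨yM, hyM⟩ := Finite.exists_max fun y => b 0 y / bs y
  set m₀ := b 0 ym / bs ym
  set M₀ := b 0 yM / bs yM
  have hm₀ : 0 < m₀ := div_pos (hb0 _) (hbs _)
  -- The lower bound never falls below `m₀`; this later turns the additive contraction of `M - m`
  -- into a relative one.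
  have key : ∀ k, ∃ m M, m₀ ≤ m ∧ m ≤ M ∧ M - m ≤ (1 - ε) ^ k * (M₀ - m₀) ∧
      ∀ y, m * bs y ≤ b k y ∧ b k y ≤ M * bs y := by
    intro k
    induction k with
    | zero =>
      exact ⟨m₀, M₀, le_rfl, hyM ym, by simp, fun y => ⟨(le_div_iff₀ (hbs y)).mp (hym y),
        (div_le_iff₀ (hbs y)).mp (hyM y)⟩⟩
    | succ k ih =>
      obtain ⟨m, M, h1, h2, h3, h4⟩ := ih
      have hvm : m ≤ b k y₀ / bs y₀ := by rw [le_div_iff₀ (hbs y₀)]; exact (h4 y₀).1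
      have hvM : b k y₀ / bs y₀ ≤ M := by rw [div_le_iff₀ (hbs y₀)]; exact (h4 y₀).2
      have h5 := colSum_between hK hbs hε (fun y => (h4 y).1) (fun y => (h4 y).2)
      set v := b k y₀ / bs y₀
      have h6 : m ≤ m + ε * (v - m) := by nlinarith
      have h7 : m + ε * (v - m) ≤ M - ε * (M - v) := by nlinarith
      refine ⟨m + ε * (v - m), M - ε * (M - v), h1.trans h6, h7, ?_, ?_⟩
      · rw [pow_succ]
        nlinarith [mul_le_mul_of_nonneg_left h3 (sub_nonneg.mpr hε1)]
      · rw [hb]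
        exact sinkhornStep_between hK hμ hμ1 hbs hfix (hbpos k) h5
  refine ⟨fun k => (1 - ε) ^ k * (M₀ - m₀) / m₀, ?_, fun k x y => ?_⟩
  · have h := (tendsto_pow_atTop_nhds_zero_of_lt_one (r := 1 - ε) (by linarith) (by linarith))
    simpa using (h.mul_const (M₀ - m₀)).div_const m₀
  · obtain ⟨m, M, h1, h2, h3, h4⟩ := key k
    have hm : 0 < m := hm₀.trans_le h1
    have hM : 0 < M := hm.trans_le h2
    have h5 : ∀ x, m * colSum K bs x ≤ colSum K (b k) x ∧ colSum K (b k) x ≤ M * colSum K bs x := by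
      intro x
      simp only [colSum, Finset.mul_sum]
      exact ⟨Finset.sum_le_sum fun y _ => by nlinarith [mul_le_mul_of_nonneg_left (h4 y).1 (hK y x).le],
        Finset.sum_le_sum fun y _ => by nlinarith [mul_le_mul_of_nonneg_left (h4 y).2 (hK y x).le]⟩
    have h6 : ∀ y, m * bs y ≤ b (k + 1) y ∧ b (k + 1) y ≤ M * bs y := by
      rw [hb]
      exact sinkhornStep_between hK hμ hμ1 hbs hfix (hbpos k) h5
    -- The product of the two ratios lies between `m / M` and `M / m`. Both `b k` and `b (k + 1)`
    -- satisfy the bounds on `β`, which yields the two estimates.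
    have key2 : ∀ β, m * bs y ≤ β → β ≤ M * bs y →
        |colSum K (b k) x / colSum K bs x * (bs y / β) - 1| ≤ (1 - ε) ^ k * (M₀ - m₀) / m₀ := by
      intro β hβ1 hβ2
      have hcs := colSum_pos hK hbs x
      have hβ : 0 < β := lt_of_lt_of_le (mul_pos hm (hbs y)) hβ1
      have hu1 : m ≤ colSum K (b k) x / colSum K bs x := by rw [le_div_iff₀ hcs]; exact (h5 x).1
      have hu2 : colSum K (b k) x / colSum K bs x ≤ M := by rw [div_le_iff₀ hcs]; exact (h5 x).2
      have hw1 : 1 / M ≤ bs y / β := by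
        rw [div_le_div_iff₀ hM hβ]; linarith
      have hw2 : bs y / β ≤ 1 / m := by
        rw [div_le_div_iff₀ hβ hm]; linarith
      set u := colSum K (b k) x / colSum K bs x
      set w := bs y / β
      have hw0 : 0 < w := div_pos (hbs y) hβ
      have hup : u * w ≤ M / m := by
        calc u * w ≤ M * (1 / m) := mul_le_mul hu2 hw2 hw0.le hM.le
          _ = M / m := by ring
      have hlo : m / M ≤ u * w := by
        calc m / M = m * (1 / M) := by ring
          _ ≤ u * w := mul_le_mul hu1 hw1 (by positivity) (hm.le.trans hu1)
      have h7 : M / m - 1 ≤ (1 - ε) ^ k * (M₀ - m₀) / m₀ := by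
        calc M / m - 1 = (M - m) / m := by field_simp
          _ ≤ (M - m) / m₀ := div_le_div_of_nonneg_left (by linarith) hm₀ h1
          _ ≤ _ := by gcongr
      have h8 : 1 - m / M ≤ M / m - 1 := by
        have e1 : 1 - m / M = (M - m) / M := by field_simp
        have e2 : M / m - 1 = (M - m) / m := by field_simp
        rw [e1, e2]
        exact div_le_div_of_nonneg_left (by linarith) hm h2
      rw [abs_le]
      constructor <;> linarith
    exact ⟨key2 _ (h4 y).1 (h4 y).2, key2 _ (h6 y).1 (h6 y).2⟩

end Sinkhorn

/-! ### Bregman divergences and regression losses -/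

section Bregman

variable {f : ℝ → ℝ}

theorem bregman_self (f : ℝ → ℝ) (a : ℝ) : bregman f a a = 0 := by simp [bregman]

theorem differentiableAt_of_pos (hf' : DifferentiableOn ℝ f (Ioi 0)) {a : ℝ} (ha : 0 < a) :
    DifferentiableAt ℝ f a := hf'.differentiableAt (Ioi_mem_nhds ha)

theorem bregman_pos (hf : StrictConvexOn ℝ (Ioi 0) f) (hf' : DifferentiableOn ℝ f (Ioi 0)) {a b : ℝ}
    (ha : 0 < a) (hb : 0 < b) (hab : a ≠ b) : 0 < bregman f a b := by
  have hd := differentiableAt_of_pos hf' hb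
  rcases lt_or_gt_of_ne hab with h | h
  · have h1 := hf.slope_lt_deriv ha hb h hd
    rw [slope_def_field, div_lt_iff₀ (sub_pos.mpr h)] at h1
    unfold bregman
    linarith
  · have h1 := hf.deriv_lt_slope hb ha h hd
    rw [slope_def_field, lt_div_iff₀ (sub_pos.mpr h)] at h1
    unfold bregman
    linarith

theorem bregman_nonneg (hf : StrictConvexOn ℝ (Ioi 0) f) (hf' : DifferentiableOn ℝ f (Ioi 0)) {a b : ℝ}
    (ha : 0 < a) (hb : 0 < b) : 0 ≤ bregman f a b := by
  rcases eq_or_ne a b with rfl | h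
  · rw [bregman_self]
  · exact (bregman_pos hf hf' ha hb h).le

/-- Moving the second argument towards the first one decreases the divergence. -/
theorem bregman_add_le (hf : StrictConvexOn ℝ (Ioi 0) f) (hf' : DifferentiableOn ℝ f (Ioi 0))
    {a b m : ℝ} (ha : 0 < a) (hb : 0 < b) (hm : 0 ≤ m) :
    bregman f ((b + m * a) / (1 + m)) b + bregman f a ((b + m * a) / (1 + m)) ≤ bregman f a b := by
  set c := (b + m * a) / (1 + m) with hc
  have hm1 : 0 < 1 + m := by linarith
  have hc0 : 0 < c := div_pos (by positivity) hm1
  have h1 : a - c = (a - b) / (1 + m) := by rw [hc]; field_simp; ring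
  have h2 : c - b = m * (a - b) / (1 + m) := by rw [hc]; field_simp; ring
  have hmono := hf.convexOn.monotoneOn_deriv fun x hx => differentiableAt_of_pos hf' hx
  have h3 : 0 ≤ (a - c) * (deriv f c - deriv f b) := by
    rcases le_total b a with h | h
    · have hcb : b ≤ c := by
        have : 0 ≤ c - b := by rw [h2]; exact div_nonneg (mul_nonneg hm (by linarith)) hm1.le
        linarith
      refine mul_nonneg ?_ (sub_nonneg.mpr (hmono hb hc0 hcb))
      rw [h1]; exact div_nonneg (by linarith) hm1.le
    · have hcb : c ≤ b := by
        have : c - b ≤ 0 := by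
          rw [h2]; exact div_nonpos_of_nonpos_of_nonneg (mul_nonpos_of_nonneg_of_nonpos hm (by linarith))
            hm1.le
        linarith
      refine mul_nonneg_of_nonpos_of_nonpos ?_ (sub_nonpos.mpr (hmono hc0 hb hcb))
      rw [h1]; exact div_nonpos_of_nonpos_of_nonneg (by linarith) hm1.le
  have h4 : bregman f a b - bregman f a c =
      bregman f c b + (a - c) * (deriv f c - deriv f b) := by
    unfold bregman; ring
  linarith

/-- The Pythagorean identity for Bregman divergences at the mean `g`. The hypothesis is not divided
by the total weight, so it makes sense for total weight zero. -/
theorem sum_bregman {ι : Type*} (s : Finset ι) (p G : ι → ℝ) (f : ℝ → ℝ) (g b : ℝ)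
    (h : ∑ i ∈ s, p i * G i = (∑ i ∈ s, p i) * g) :
    ∑ i ∈ s, p i * bregman f (G i) b =
      ∑ i ∈ s, p i * bregman f (G i) g + (∑ i ∈ s, p i) * bregman f g b := by
  have key : ∀ c, ∑ i ∈ s, p i * bregman f (G i) c = ∑ i ∈ s, p i * f (G i) -
      (∑ i ∈ s, p i) * f c - ((∑ i ∈ s, p i) * g - (∑ i ∈ s, p i) * c) * deriv f c := by
    intro c
    rw [← h, Finset.sum_mul, Finset.sum_mul, ← Finset.sum_sub_distrib, ← Finset.sum_sub_distrib,
      Finset.sum_mul, ← Finset.sum_sub_distrib]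
    exact Finset.sum_congr rfl fun i _ => by unfold bregman; ring
  rw [key, key]
  unfold bregman
  ring

/-- On a compact subinterval of the positive half-line `f` is continuous, and its derivative is
monotone by convexity, hence bounded. -/
theorem exists_bregman_le (hf : StrictConvexOn ℝ (Ioi 0) f) (hf' : DifferentiableOn ℝ f (Ioi 0))
    (a : ℝ) {α β : ℝ} (hα : 0 < α) : ∃ C, ∀ b ∈ Icc α β, bregman f a b ≤ C := by
  have hsub : Icc α β ⊆ Ioi 0 := fun x hx => hα.trans_le hx.1
  obtain ⟨C₁, hC₁⟩ := isCompact_Icc.exists_bound_of_continuousOn (hf'.continuousOn.mono hsub)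
  have hmono := hf.convexOn.monotoneOn_deriv fun x hx => differentiableAt_of_pos hf' hx
  set C₂ := max |deriv f α| |deriv f β|
  have hC₂ : ∀ b ∈ Icc α β, |deriv f b| ≤ C₂ := by
    intro b hb
    have h1 : deriv f α ≤ deriv f b := hmono hα (hsub hb) hb.1
    have h2 : deriv f b ≤ deriv f β := hmono (hsub hb) (hα.trans_le (hb.1.trans hb.2)) hb.2
    exact abs_le_max_abs_abs h1 h2
  refine ⟨f a + C₁ + (|a| + max |α| |β|) * C₂, fun b hb => ?_⟩
  have h1 := hC₁ b hb
  rw [Real.norm_eq_abs] at h1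
  have h2 : |(a - b) * deriv f b| ≤ (|a| + max |α| |β|) * C₂ := by
    rw [abs_mul]
    refine mul_le_mul ((abs_sub _ _).trans ?_) (hC₂ b hb) (abs_nonneg _)
      (add_nonneg (abs_nonneg _) (le_max_of_le_left (abs_nonneg _)))
    gcongr
    exact abs_le_max_abs_abs hb.1 hb.2
  unfold bregman
  linarith [neg_abs_le (f b), neg_abs_le ((a - b) * deriv f b)]

end Bregman

/-! ### Bregman regression and conditional expectations. -/

section Regression

variable {N D : ℕ} [NeZero N] {f : ℝ → ℝ} {p : State N D → State N D → ℝ}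
  {T : State N D → State N D → Fin D → ZMod N → ℝ} {g Ψ : State N D → Fin D → ZMod N → ℝ}

theorem eq_zero_of_add_le {u v : ℝ≥0∞} (hu : u ≠ ⊤) (h : u + v ≤ u) : v = 0 := by
  have h1 : u + v ≤ u + 0 := by simpa using h
  simpa using (ENNReal.add_le_add_iff_left hu).mp h1

/-- The loss of regressing the targets `T x y`, with `(x, y)` of law `p`, by a function of `x`. -/
noncomputable def regressionLoss (f : ℝ → ℝ) (p : State N D → State N D → ℝ)
    (T : State N D → State N D → Fin D → ZMod N → ℝ) (Ψ : State N D → Fin D → ZMod N → ℝ) : ℝ≥0∞ :=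
  ∑ x, ∑ y, (∑ d, ∑ n ∈ Finset.univ.filter (fun n => n ≠ x d),
    ENNReal.ofReal (bregman f (T x y d n) (Ψ x d n))) * ENNReal.ofReal (p x y)

/-- The excess of the loss of `Ψ` over the loss of the conditional expectation `g`. -/
noncomputable def regressionExcess (f : ℝ → ℝ) (p : State N D → State N D → ℝ)
    (g Ψ : State N D → Fin D → ZMod N → ℝ) : ℝ≥0∞ :=
  ∑ x, ∑ d, ∑ n ∈ Finset.univ.filter (fun n => n ≠ x d),
    ENNReal.ofReal (∑ y, p x y) * ENNReal.ofReal (bregman f (g x d n) (Ψ x d n))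

theorem regressionLoss_eq (f : ℝ → ℝ) (p : State N D → State N D → ℝ)
    (T : State N D → State N D → Fin D → ZMod N → ℝ) (Ψ : State N D → Fin D → ZMod N → ℝ) :
    regressionLoss f p T Ψ = ∑ x, ∑ d, ∑ n ∈ Finset.univ.filter (fun n => n ≠ x d), ∑ y,
      ENNReal.ofReal (bregman f (T x y d n) (Ψ x d n)) * ENNReal.ofReal (p x y) := by
  unfold regressionLoss
  refine Finset.sum_congr rfl fun x _ => ?_
  simp only [Finset.sum_mul]
  rw [Finset.sum_comm]
  refine Finset.sum_congr rfl fun d _ => ?_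
  rw [Finset.sum_comm]

/-- `sum_bregman` applied entrywise: the mixed terms cancel because `g` is the conditional
expectation of the targets. Targets need to be positive only where `p` charges them. -/
theorem regressionLoss_eq_add (hf : StrictConvexOn ℝ (Ioi 0) f) (hf' : DifferentiableOn ℝ f (Ioi 0))
    (hp : ∀ x y, 0 ≤ p x y) (hT : ∀ x y d n, n ≠ x d → 0 < p x y → 0 < T x y d n)
    (hg : ∀ x d n, n ≠ x d → 0 < g x d n)
    (hgT : ∀ x d n, n ≠ x d → ∑ y, p x y * T x y d n = (∑ y, p x y) * g x d n)
    (hΨ : ∀ x d n, n ≠ x d → 0 < Ψ x d n) :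
    regressionLoss f p T Ψ = regressionLoss f p T g + regressionExcess f p g Ψ := by
  rw [regressionLoss_eq, regressionLoss_eq, regressionExcess, ← Finset.sum_add_distrib]
  refine Finset.sum_congr rfl fun x _ => ?_
  rw [← Finset.sum_add_distrib]
  refine Finset.sum_congr rfl fun d _ => ?_
  rw [← Finset.sum_add_distrib]
  refine Finset.sum_congr rfl fun n hn => ?_
  have hn' := (Finset.mem_filter.mp hn).2
  have key : ∀ b, 0 < b → ∀ y, ENNReal.ofReal (bregman f (T x y d n) b) * ENNReal.ofReal (p x y) =
      ENNReal.ofReal (p x y * bregman f (T x y d n) b) := fun b _ y => by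
    rw [mul_comm, ENNReal.ofReal_mul (hp x y)]
  have h0 : ∀ b, 0 < b → ∀ y, 0 ≤ p x y * bregman f (T x y d n) b := by
    intro b hb y
    rcases (hp x y).eq_or_lt with h | h
    · rw [← h, zero_mul]
    · exact mul_nonneg h.le (bregman_nonneg hf hf' (hT x y d n hn' h) hb)
  have hs : 0 ≤ ∑ y, p x y := Finset.sum_nonneg fun y _ => hp x y
  simp only [key _ (hΨ x d n hn'), key _ (hg x d n hn')]
  rw [← ENNReal.ofReal_sum_of_nonneg fun y _ => h0 _ (hΨ x d n hn') y,
    ← ENNReal.ofReal_sum_of_nonneg fun y _ => h0 _ (hg x d n hn') y, ← ENNReal.ofReal_mul hs,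
    ← ENNReal.ofReal_add (Finset.sum_nonneg fun y _ => h0 _ (hg x d n hn') y)
      (mul_nonneg hs (bregman_nonneg hf hf' (hg x d n hn') (hΨ x d n hn'))),
    sum_bregman _ _ _ _ _ _ (hgT x d n hn')]

theorem eq_of_regressionExcess_eq_zero (hf : StrictConvexOn ℝ (Ioi 0) f)
    (hf' : DifferentiableOn ℝ f (Ioi 0)) (hg : ∀ x d n, n ≠ x d → 0 < g x d n)
    (hΨ : ∀ x d n, n ≠ x d → 0 < Ψ x d n) (h : regressionExcess f p g Ψ = 0) {x : State N D}
    (hx : 0 < ∑ y, p x y) {d : Fin D} {n : ZMod N} (hn : n ≠ x d) : Ψ x d n = g x d n := by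
  by_contra hne
  have hpos := bregman_pos hf hf' (hg x d n hn) (hΨ x d n hn) (Ne.symm hne)
  rw [regressionExcess, Finset.sum_eq_zero_iff] at h
  have h1 := Finset.sum_eq_zero_iff.mp (h x (Finset.mem_univ x)) d (Finset.mem_univ d)
  have h2 := Finset.sum_eq_zero_iff.mp h1 n (Finset.mem_filter.mpr ⟨Finset.mem_univ n, hn⟩)
  rw [mul_eq_zero, ENNReal.ofReal_eq_zero, ENNReal.ofReal_eq_zero] at h2
  rcases h2 with h2 | h2 <;> linarith

theorem regressionExcess_ne_top : regressionExcess f p g Ψ ≠ ⊤ := by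
  refine ENNReal.sum_ne_top.mpr fun x _ => ENNReal.sum_ne_top.mpr fun d _ =>
    ENNReal.sum_ne_top.mpr fun n _ => ENNReal.mul_ne_top ENNReal.ofReal_ne_top ENNReal.ofReal_ne_top

theorem regressionLoss_ne_top : regressionLoss f p T Ψ ≠ ⊤ := by
  rw [regressionLoss_eq]
  exact ENNReal.sum_ne_top.mpr fun x _ => ENNReal.sum_ne_top.mpr fun d _ =>
    ENNReal.sum_ne_top.mpr fun n _ => ENNReal.sum_ne_top.mpr fun y _ =>
      ENNReal.mul_ne_top ENNReal.ofReal_ne_top ENNReal.ofReal_ne_top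

end Regression

/-! ### The losses as regression losses -/

section Losses

variable {N D : ℕ} [NeZero N] {γ w f : ℝ → ℝ} {R P : Measure (PathSpace N D)}
  {a b μ ν φ : State N D → ℝ}

theorem upd_self (x : State N D) (d : Fin D) : upd x d (x d) = x := Function.update_eq_self _ _

theorem upd_eq_add (x : State N D) (d : Fin D) (n : ZMod N) :
    upd x d n = x + Pi.single d (n - x d) := by
  funext j
  by_cases hj : j = d
  · subst hj; simp
  · simp [hj]

/-- The shifted entry in the losses translates `y` by the same group element that takes `x` to `upd
x d n`; this is what makes translation invariance of the kernel applicable. -/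
theorem upd_shift_eq_add (x y : State N D) (d : Fin D) (n : ZMod N) :
    upd y d (y d + n - x d) = y + Pi.single d (n - x d) := by
  rw [upd_eq_add]
  congr 2
  abel

theorem sum_refKernel_shift (s t : ℝ) (b : State N D → ℝ) (x c : State N D) :
    ∑ y, refKernel γ s t y x * b (y + c) = ∑ y, refKernel γ s t y (x + c) * b y := by
  rw [← Equiv.sum_comp (Equiv.addRight c) fun y => refKernel γ s t y (x + c) * b y]
  simp only [Equiv.coe_addRight, refKernel_add]

/-- If the bridges of `P` are the reference ones, resampling the intermediate state from them does
not change its joint law with the terminal state. -/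
theorem lintegral_bridge (hP : HasRefBridges γ P) (t : I) (F : State N D → State N D → ℝ≥0∞) :
    ∫⁻ ω, ∑ x, ENNReal.ofReal (refBridge γ t x (ω 0) (ω 1)) * F x (ω 1) ∂P =
      ∫⁻ ω, F (ω t) (ω 1) ∂P := by
  rw [lintegral_endpoints P 0 1 fun x₀ x₁ => ∑ x, ENNReal.ofReal (refBridge γ t x x₀ x₁) * F x x₁,
    lintegral_endpoints P t 1 F]
  have h1 : ∀ x x₁, P {ω | ω t = x ∧ ω 1 = x₁} = ∑ x₀, P {ω | ω 0 = x₀ ∧ ω t = x ∧ ω 1 = x₁} := by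
    intro x x₁
    have hA : MeasurableSet {ω : PathSpace N D | ω t = x ∧ ω 1 = x₁} :=
      (measurable_eval t (measurableSet_singleton x)).inter
        (measurable_eval 1 (measurableSet_singleton x₁))
    have h := measure_univ_eq_sum (P.restrict {ω | ω t = x ∧ ω 1 = x₁}) 0
    rw [Measure.restrict_apply_univ] at h
    rw [h]
    refine Finset.sum_congr rfl fun x₀ _ => ?_
    rw [Measure.restrict_apply' hA]
    rfl
  simp only [h1, hP t, Finset.sum_mul, Finset.mul_sum]
  rw [Finset.sum_comm]
  have h2 : ∀ x₁ : State N D, ∑ x₀, ∑ x, ENNReal.ofReal (refBridge γ t x x₀ x₁) * F x x₁ *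
      P {ω | ω 0 = x₀ ∧ ω 1 = x₁} = ∑ x, ∑ x₀, F x x₁ * (P {ω | ω 0 = x₀ ∧ ω 1 = x₁} *
      ENNReal.ofReal (refBridge γ t x x₀ x₁)) := by
    intro x₁
    rw [Finset.sum_comm]
    exact Finset.sum_congr rfl fun x _ => Finset.sum_congr rfl fun x₀ _ => by ring
  simp only [h2]
  rw [Finset.sum_comm]

/-- The regression targets of the controller adjoint-matching loss. -/
noncomputable def ctrlTarget (ν : State N D → ℝ) (Φh : State N D → Fin D → ZMod N → ℝ)
    (x x₁ : State N D) (d : Fin D) (n : ZMod N) : ℝ :=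
  ν (upd x₁ d (x₁ d + n - x d)) / ν x₁ / Φh x₁ d (x₁ d + n - x d)

theorem lintegral_ctrlAMTerm [IsFiniteMeasure P] (ν : State N D → ℝ)
    (Φh : State N D → Fin D → ZMod N → ℝ) (Φ : ℝ → State N D → Fin D → ZMod N → ℝ) (t : I) :
    ∫⁻ ω, ctrlAMTerm f ν Φh Φ t (ω t) (ω 1) ∂P = regressionLoss f
      (fun x x₁ => (P {ω | ω t = x ∧ ω 1 = x₁}).toReal) (ctrlTarget ν Φh) (Φ t) := by
  rw [lintegral_endpoints P t 1 (ctrlAMTerm f ν Φh Φ t), regressionLoss]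
  simp only [ENNReal.ofReal_toReal (measure_ne_top P _)]
  rfl

theorem ctrlAMBridgeLoss_eq (hP : HasRefBridges γ P) (ν : State N D → ℝ)
    (Φh : State N D → Fin D → ZMod N → ℝ) (Φ : ℝ → State N D → Fin D → ZMod N → ℝ) :
    ctrlAMBridgeLoss γ w f ν Φh P Φ = ctrlAMLoss w f ν Φh P Φ := by
  unfold ctrlAMBridgeLoss ctrlAMLoss
  refine lintegral_congr fun t => ?_
  rw [lintegral_bridge hP t fun x x₁ => ctrlAMTerm f ν Φh Φ t x x₁]

theorem ctrlTarget_pos (hν : ∀ x, 0 < ν x) {Φh : State N D → Fin D → ZMod N → ℝ}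
    (hΦh : ∀ x d n, 0 < Φh x d n) (x x₁ : State N D) (d : Fin D) (n : ZMod N) :
    0 < ctrlTarget ν Φh x x₁ d n := div_pos (div_pos (hν _) (hν _)) (hΦh _ _ _)

/-- For a corrector of ratio form the target is a score of `ν / φ`. The same identity is used for
the corrector loss, with `μ` and `coevolve γ b 0` in the roles of `ν` and `φ`. -/
theorem ctrlTarget_ratio (hφ : ∀ x, 0 < φ x) (x x₁ : State N D) (d : Fin D) (n : ZMod N) :
    ctrlTarget ν (fun x d n => φ (upd x d n) / φ x) x x₁ d n =
      (ν (x₁ + Pi.single d (n - x d)) / φ (x₁ + Pi.single d (n - x d))) / (ν x₁ / φ x₁) := by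
  have h1 := (hφ x₁).ne'
  have h2 := (hφ (x₁ + Pi.single d (n - x d))).ne'
  rw [ctrlTarget, upd_shift_eq_add]
  field_simp

/-- Under the law of the chain, the controller is the conditional expectation of the targets. -/
theorem sum_refKernel_mul_ctrlTarget (hν : ∀ x, 0 < ν x) (hφ : ∀ x, 0 < φ x) (t : ℝ)
    (x : State N D) (d : Fin D) (n : ZMod N) :
    ∑ x₁, refKernel γ t 1 x₁ x * (ν x₁ / φ x₁) *
      ctrlTarget ν (fun x d n => φ (upd x d n) / φ x) x x₁ d n =
      coevolve γ (fun x => ν x / φ x) t (upd x d n) := by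
  rw [upd_eq_add, coevolve, ← sum_refKernel_shift t 1 (fun x => ν x / φ x) x]
  refine Finset.sum_congr rfl fun x₁ _ => ?_
  rw [ctrlTarget_ratio hφ, mul_assoc, mul_div_cancel₀ _ (div_pos (hν x₁) (hφ x₁)).ne']

theorem isController_ratioController (hγ : ContinuousOn γ (Icc 0 1))
    (hγ0 : ∀ t ∈ Icc (0 : ℝ) 1, 0 ≤ γ t) (hb : ∀ x, 0 < b x) :
    IsController (ratioController γ b) := by
  intro x d n
  refine ⟨(continuousOn_coevolve hγ b _).div (continuousOn_coevolve hγ b _)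
    fun t ht => (coevolve_pos hγ0 hb ht x).ne', fun t ht =>
    ⟨div_pos (coevolve_pos hγ0 hb ht _) (coevolve_pos hγ0 hb ht _), ?_⟩⟩
  rintro rfl
  rw [ratioController, upd_self, div_self (coevolve_pos hγ0 hb ht x).ne']

/-- At every time the ratio controller is the conditional expectation of the targets given `ω t`, so
it minimizes the integrand pointwise. -/
theorem ctrlAMLoss_ratioController_le (hγ : ContinuousOn γ (Icc 0 1))
    (hγ0 : ∀ t ∈ Icc (0 : ℝ) 1, 0 ≤ γ t)
    (hf : StrictConvexOn ℝ (Ioi 0) f) (hf' : DifferentiableOn ℝ f (Ioi 0)) (hR : IsUniformRef γ R)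
    [IsProbabilityMeasure (bridgeMixture R a fun x => ν x / φ x)]
    (ha : ∀ x, 0 ≤ a x) (hν : ∀ x, 0 < ν x) (hφ : ∀ x, 0 < φ x)
    {Φ' : ℝ → State N D → Fin D → ZMod N → ℝ} (hΦ' : IsController Φ') :
    ctrlAMLoss w f ν (fun x d n => φ (upd x d n) / φ x) (bridgeMixture R a fun x => ν x / φ x)
        (ratioController γ fun x => ν x / φ x) ≤
      ctrlAMLoss w f ν (fun x d n => φ (upd x d n) / φ x) (bridgeMixture R a fun x => ν x / φ x)
        Φ' := by
  have hb : ∀ x, 0 < ν x / φ x := fun x => div_pos (hν x) (hφ x)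
  have hΦ := isController_ratioController hγ hγ0 hb
  refine lintegral_mono fun t => mul_le_mul_right ?_ _
  rw [lintegral_ctrlAMTerm, lintegral_ctrlAMTerm]
  have hp : ∀ x x₁, (bridgeMixture R a (fun x => ν x / φ x) {ω | ω t = x ∧ ω 1 = x₁}).toReal =
      evolve γ a t x * (refKernel γ t 1 x₁ x * (ν x₁ / φ x₁)) := by
    intro x x₁
    rw [bridgeMixture_pair hγ0 hR ha (fun x => (hb x).le) unitInterval.le_one', Icc.coe_one,
      coevolve_one, ENNReal.toReal_ofReal, mul_assoc]
    exact mul_nonneg (mul_nonneg (evolve_nonneg hγ0 ha t.2 x) (refKernel_nonneg hγ0 t.2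
      (right_mem_Icc.mpr zero_le_one) t.2.2 _ _)) (hb _).le
  rw [regressionLoss_eq_add hf hf' (Ψ := Φ' t) (g := ratioController γ (fun x => ν x / φ x) t)
    (fun _ _ => ENNReal.toReal_nonneg) (fun x y d n _ _ => ctrlTarget_pos hν
      (fun _ _ _ => div_pos (hφ _) (hφ _)) _ _ _ _) (fun x d n _ => ((hΦ x d n).2 t t.2).1) ?_
      (fun x d n _ => ((hΦ' x d n).2 t t.2).1)]
  · exact le_self_add
  · intro x d n _
    simp only [hp]
    simp only [mul_assoc, ← Finset.mul_sum]
    congr 1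
    have h := sum_refKernel_mul_ctrlTarget (γ := γ) hν hφ t x d n
    simp only [mul_assoc] at h
    rw [h, ratioController]
    exact (mul_div_cancel₀ _ (coevolve_pos hγ0 hb t.2 x).ne').symm

/-- The corrector associated with a positive function on the state space. -/
noncomputable def ratioCorrector (φ : State N D → ℝ) (x : State N D) (d : Fin D) (n : ZMod N) : ℝ :=
  φ (upd x d n) / φ x

theorem isCorrector_ratioCorrector (hφ : ∀ x, 0 < φ x) : IsCorrector (ratioCorrector φ) := by
  intro x d n
  refine ⟨div_pos (hφ _) (hφ _), ?_⟩
  rintro rfl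
  rw [ratioCorrector, upd_self, div_self (hφ x).ne']

theorem corrector_ext {Ψ Ψ' : State N D → Fin D → ZMod N → ℝ} (h : IsCorrector Ψ)
    (h' : IsCorrector Ψ') (heq : ∀ x d n, n ≠ x d → Ψ x d n = Ψ' x d n) : Ψ = Ψ' := by
  funext x d n
  by_cases hn : n = x d
  · rw [(h x d n).2 hn, (h' x d n).2 hn]
  · exact heq x d n hn

theorem sum_refKernel_mul_evolve (hγ : ContinuousOn γ (Icc 0 1)) (a : State N D → ℝ) {t : ℝ}
    (ht : t ∈ Icc (0 : ℝ) 1) (y : State N D) :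
    ∑ x, refKernel γ t 1 y x * evolve γ a t x = evolve γ a 1 y := by
  simp only [evolve, Finset.mul_sum]
  rw [Finset.sum_comm]
  refine Finset.sum_congr rfl fun z _ => ?_
  rw [← refKernel_comp hγ (left_mem_Icc.mpr zero_le_one) ht (right_mem_Icc.mpr zero_le_one) y z,
    Finset.sum_mul]
  exact Finset.sum_congr rfl fun x _ => by ring

theorem corrAMLoss_eq [IsFiniteMeasure P] (μ : State N D → ℝ)
    (Φ : ℝ → State N D → Fin D → ZMod N → ℝ) (Ψ : State N D → Fin D → ZMod N → ℝ) :
    corrAMLoss f μ Φ P Ψ = regressionLoss f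
      (fun x₁ x₀ => (P {ω | ω 0 = x₀ ∧ ω 1 = x₁}).toReal)
      (fun x₁ x₀ => ctrlTarget μ (Φ 0) x₁ x₀) Ψ := by
  refine (lintegral_endpoints P 0 1 fun x₀ x₁ => ∑ d, ∑ n ∈ Finset.univ.filter
    (fun n => n ≠ x₁ d), ENNReal.ofReal (bregman f (ctrlTarget μ (Φ 0) x₁ x₀ d n) (Ψ x₁ d n))).trans ?_
  rw [regressionLoss, Finset.sum_comm]
  simp only [ENNReal.ofReal_toReal (measure_ne_top P _)]

theorem corrDMLoss_eq [IsFiniteMeasure P] (hP : HasRefBridges γ P)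
    (Ψ : State N D → Fin D → ZMod N → ℝ) :
    corrDMLoss γ w f P Ψ = ∫⁻ t : I, ENNReal.ofReal (w t) * regressionLoss f
      (fun x₁ x => (P {ω | ω t = x ∧ ω 1 = x₁}).toReal)
      (fun x₁ x d n => refKernel γ t 1 (upd x₁ d n) x / refKernel γ t 1 x₁ x) Ψ := by
  unfold corrDMLoss
  refine lintegral_congr fun t => ?_
  congr 1
  rw [lintegral_bridge hP t fun x x₁ => ∑ d, ∑ n ∈ Finset.univ.filter (fun n => n ≠ x₁ d),
    ENNReal.ofReal (bregman f (refKernel γ t 1 (upd x₁ d n) x / refKernel γ t 1 x₁ x) (Ψ x₁ d n)),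
    lintegral_endpoints P t 1 fun x x₁ => ∑ d, ∑ n ∈ Finset.univ.filter (fun n => n ≠ x₁ d),
    ENNReal.ofReal (bregman f (refKernel γ t 1 (upd x₁ d n) x / refKernel γ t 1 x₁ x) (Ψ x₁ d n)),
    regressionLoss, Finset.sum_comm]
  simp only [ENNReal.ofReal_toReal (measure_ne_top P _)]

theorem bridgeMixture_pair_toReal (hγ0 : ∀ t ∈ Icc (0 : ℝ) 1, 0 ≤ γ t) (hR : IsUniformRef γ R)
    (ha : ∀ x, 0 ≤ a x) (hb : ∀ x, 0 ≤ b x) (t : I) (x x₁ : State N D) :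
    (bridgeMixture R a b {ω | ω t = x ∧ ω 1 = x₁}).toReal =
      b x₁ * (refKernel γ t 1 x₁ x * evolve γ a t x) := by
  rw [bridgeMixture_pair hγ0 hR ha hb unitInterval.le_one', Icc.coe_one,
    coevolve_one, ENNReal.toReal_ofReal]
  · ring
  · exact mul_nonneg (mul_nonneg (evolve_nonneg hγ0 ha t.2 x) (refKernel_nonneg hγ0 t.2
      (right_mem_Icc.mpr zero_le_one) t.2.2 _ _)) (hb _)

/-- The target is a ratio `a (x₀ + c) / a x₀`. Weighted by the joint law it cancels `a x₀`, and
symmetry and translation invariance of the kernel give `evolve γ a 1` at the translated terminal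
state. Uniqueness holds because every terminal state has positive probability. -/
theorem isUniqueCorrectorMin_corrAMLoss (hγ : ContinuousOn γ (Icc 0 1))
    (hγ0 : ∀ t ∈ Icc (0 : ℝ) 1, 0 ≤ γ t) (hγ1 : ∀ᵐ t ∂volume.restrict (Icc (0 : ℝ) 1), 0 < γ t)
    (hf : StrictConvexOn ℝ (Ioi 0) f) (hf' : DifferentiableOn ℝ f (Ioi 0)) (hR : IsUniformRef γ R)
    [IsProbabilityMeasure (bridgeMixture R a b)] (hμ : ∀ x, 0 < μ x) (hb : ∀ x, 0 < b x)
    (ha : ∀ x, a x = μ x / coevolve γ b 0 x) :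
    IsUniqueCorrectorMin (corrAMLoss f μ (ratioController γ b) (bridgeMixture R a b))
      (ratioCorrector (evolve γ a 1)) := by
  have hc : ∀ x, 0 < coevolve γ b 0 x := coevolve_pos hγ0 hb (left_mem_Icc.mpr zero_le_one)
  have ha0 : ∀ x, 0 < a x := fun x => by rw [ha]; exact div_pos (hμ x) (hc x)
  have hA : ∀ x, 0 < evolve γ a 1 x :=
    evolve_pos hγ hγ0 hγ1 (fun x => (ha0 x).le) ⟨default, ha0 _⟩ (right_mem_Ioc.mpr zero_lt_one)
  have hcorr := isCorrector_ratioCorrector hA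
  have hp : ∀ x₁ x₀, (bridgeMixture R a b {ω | ω 0 = x₀ ∧ ω 1 = x₁}).toReal =
      b x₁ * (refKernel γ 0 1 x₁ x₀ * a x₀) := by
    intro x₁ x₀
    have h := bridgeMixture_pair_toReal hγ0 hR (fun x => (ha0 x).le) (fun x => (hb x).le) 0 x₀ x₁
    simpa [evolve_zero] using h
  have hs : ∀ x₁, ∑ x₀, (bridgeMixture R a b {ω | ω 0 = x₀ ∧ ω 1 = x₁}).toReal =
      b x₁ * evolve γ a 1 x₁ := fun x₁ => by
    simp only [hp, ← Finset.mul_sum]; rfl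
  have hadd : ∀ Ψ, IsCorrector Ψ →
      corrAMLoss f μ (ratioController γ b) (bridgeMixture R a b) Ψ =
      corrAMLoss f μ (ratioController γ b) (bridgeMixture R a b) (ratioCorrector (evolve γ a 1)) +
      regressionExcess f (fun x₁ x₀ => (bridgeMixture R a b {ω | ω 0 = x₀ ∧ ω 1 = x₁}).toReal)
        (ratioCorrector (evolve γ a 1)) Ψ := by
    intro Ψ hΨ
    rw [corrAMLoss_eq, corrAMLoss_eq]
    refine regressionLoss_eq_add hf hf' (fun _ _ => ENNReal.toReal_nonneg)
      (fun x y d n _ _ => ctrlTarget_pos hμ (fun x d n => div_pos (hc _) (hc _)) _ _ _ _)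
      (fun x d n _ => (hcorr x d n).1) (fun x₁ d n _ => ?_) (fun x d n _ => (hΨ x d n).1)
    rw [hs]
    have h1 : ∀ x₀, (bridgeMixture R a b {ω | ω 0 = x₀ ∧ ω 1 = x₁}).toReal *
        ctrlTarget μ (ratioController γ b 0) x₁ x₀ d n =
        b x₁ * (refKernel γ 0 1 x₀ x₁ * a (x₀ + Pi.single d (n - x₁ d))) := by
      intro x₀
      rw [hp]
      have h2 : ctrlTarget μ (ratioController γ b 0) x₁ x₀ d n =
          a (x₀ + Pi.single d (n - x₁ d)) / a x₀ := by
        rw [ha, ha]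
        exact ctrlTarget_ratio hc x₁ x₀ d n
      rw [h2, refKernel_comm]
      have := (ha0 x₀).ne'
      field_simp
    simp only [h1]
    rw [← Finset.mul_sum, sum_refKernel_shift, ratioCorrector, upd_eq_add]
    have h3 : ∑ y, refKernel γ 0 1 y (x₁ + Pi.single d (n - x₁ d)) * a y =
        evolve γ a 1 (x₁ + Pi.single d (n - x₁ d)) :=
      Finset.sum_congr rfl fun y _ => by rw [refKernel_comm]
    rw [h3]
    have := (hA x₁).ne'
    field_simp
  refine ⟨hcorr, fun Ψ hΨ => by rw [hadd Ψ hΨ]; exact le_self_add, fun Ψ hΨ hle => ?_⟩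
  rw [hadd Ψ hΨ] at hle
  have hfin : corrAMLoss f μ (ratioController γ b) (bridgeMixture R a b)
      (ratioCorrector (evolve γ a 1)) ≠ ⊤ := by
    rw [corrAMLoss_eq]; exact regressionLoss_ne_top
  have h0 := eq_zero_of_add_le hfin hle
  refine corrector_ext hΨ hcorr fun x d n hn => ?_
  refine eq_of_regressionExcess_eq_zero hf hf' (fun x d n _ => (hcorr x d n).1)
    (fun x d n _ => (hΨ x d n).1) h0 ?_ hn
  rw [hs]
  exact mul_pos (hb x) (hA x)

theorem measurePreserving_unitInterval :
    MeasurePreserving (Subtype.val : I → ℝ) volume (volume.restrict (Icc 0 1)) :=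
  measurePreserving_subtype_coe measurableSet_Icc

theorem aemeasurable_weight (hw : IntegrableOn w (Icc 0 1)) :
    AEMeasurable (fun t : I => ENNReal.ofReal (w t)) :=
  (hw.aestronglyMeasurable.aemeasurable.comp_quasiMeasurePreserving
    measurePreserving_unitInterval.quasiMeasurePreserving).ennreal_ofReal

theorem lintegral_weight_ne_top (hw : IntegrableOn w (Icc 0 1)) :
    ∫⁻ t : I, ENNReal.ofReal (w t) ≠ ⊤ := by
  rw [measurePreserving_unitInterval.lintegral_comp_emb (MeasurableEmbedding.subtype_coe
    measurableSet_Icc) fun t => ENNReal.ofReal (w t)]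
  exact (Integrable.lintegral_lt_top hw).ne

theorem ae_unitInterval {p : ℝ → Prop} (h : ∀ᵐ t ∂volume.restrict (Icc (0 : ℝ) 1), p t) :
    ∀ᵐ t : I, p t := measurePreserving_unitInterval.quasiMeasurePreserving.ae h

theorem lintegral_weight_ne_zero (hw : IntegrableOn w (Icc 0 1))
    (hw1 : ∀ᵐ t ∂volume.restrict (Icc (0 : ℝ) 1), 0 < w t) :
    ∫⁻ t : I, ENNReal.ofReal (w t) ≠ 0 := by
  intro h
  rw [lintegral_eq_zero_iff' (aemeasurable_weight hw)] at h
  obtain ⟨t, h1, h2⟩ := (h.and (ae_unitInterval hw1)).exists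
  simp only [Pi.zero_apply, ENNReal.ofReal_eq_zero] at h1
  linarith

/-- Given `ω 1 = x₁`, the state at time `t` has weights proportional to `refKernel γ t 1 x₁ x *
evolve γ a t x`. The denominator of the target cancels the first factor, and Chapman–Kolmogorov sums
the rest. Finiteness of the loss somewhere is needed to conclude from equality of losses that the
excess vanishes. -/
theorem isUniqueCorrectorMin_corrDMLoss (hγ : ContinuousOn γ (Icc 0 1))
    (hγ0 : ∀ t ∈ Icc (0 : ℝ) 1, 0 ≤ γ t) (hγ1 : ∀ᵐ t ∂volume.restrict (Icc (0 : ℝ) 1), 0 < γ t)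
    (hw : IntegrableOn w (Icc 0 1)) (hw1 : ∀ᵐ t ∂volume.restrict (Icc (0 : ℝ) 1), 0 < w t)
    (hf : StrictConvexOn ℝ (Ioi 0) f) (hf' : DifferentiableOn ℝ f (Ioi 0)) (hR : IsUniformRef γ R)
    [IsProbabilityMeasure (bridgeMixture R a b)] (ha : ∀ x, 0 ≤ a x) (ha1 : ∃ x, 0 < a x)
    (hb : ∀ x, 0 < b x)
    (hfin : ∃ Ψ, IsCorrector Ψ ∧ corrDMLoss γ w f (bridgeMixture R a b) Ψ ≠ ⊤) :
    IsUniqueCorrectorMin (corrDMLoss γ w f (bridgeMixture R a b))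
      (ratioCorrector (evolve γ a 1)) := by
  have hA : ∀ x, 0 < evolve γ a 1 x :=
    evolve_pos hγ hγ0 hγ1 ha ha1 (right_mem_Ioc.mpr zero_lt_one)
  have hcorr := isCorrector_ratioCorrector hA
  have hbr := hasRefBridges_bridgeMixture hγ hγ0 hγ1 hR ha fun x => (hb x).le
  have hp := bridgeMixture_pair_toReal hγ0 hR ha fun x => (hb x).le
  have hs : ∀ (t : I) x₁, ∑ x, (bridgeMixture R a b {ω | ω t = x ∧ ω 1 = x₁}).toReal =
      b x₁ * evolve γ a 1 x₁ := fun t x₁ => by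
    simp only [hp, ← Finset.mul_sum, sum_refKernel_mul_evolve hγ a t.2]
  -- The excess depends on the joint law only through the marginal at time 1, so its value computed
  -- at time 0 serves for all `t`.
  set E : (State N D → Fin D → ZMod N → ℝ) → ℝ≥0∞ := fun Ψ => regressionExcess f
    (fun x₁ x => (bridgeMixture R a b {ω | ω 0 = x ∧ ω 1 = x₁}).toReal)
    (ratioCorrector (evolve γ a 1)) Ψ with hE
  have hadd : ∀ Ψ, IsCorrector Ψ → corrDMLoss γ w f (bridgeMixture R a b) Ψ =
      corrDMLoss γ w f (bridgeMixture R a b) (ratioCorrector (evolve γ a 1)) +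
      (∫⁻ t : I, ENNReal.ofReal (w t)) * E Ψ := by
    intro Ψ hΨ
    rw [corrDMLoss_eq hbr, corrDMLoss_eq hbr, ← lintegral_mul_const' _ _ regressionExcess_ne_top,
      ← lintegral_add_right' _ ((aemeasurable_weight hw).mul_const _)]
    refine lintegral_congr_ae ?_
    -- At `t = 1` the kernel is the identity and the target divides by zero; this single time is
    -- negligible.
    filter_upwards [Measure.ae_ne volume (1 : I)] with t ht
    have ht1 : (t : ℝ) < 1 := unitInterval.lt_one_iff_ne_one.mpr ht
    have hK : ∀ y x : State N D, 0 < refKernel γ t 1 y x :=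
      refKernel_pos hγ hγ0 hγ1 t.2 (right_mem_Icc.mpr zero_le_one) ht1
    rw [← mul_add]
    congr 1
    have hEt : E Ψ = regressionExcess f
        (fun x₁ x => (bridgeMixture R a b {ω | ω t = x ∧ ω 1 = x₁}).toReal)
        (ratioCorrector (evolve γ a 1)) Ψ := by
      simp only [hE, regressionExcess, hs]
    refine Eq.trans ?_ (congrArg (_ + ·) hEt.symm)
    refine regressionLoss_eq_add hf hf' (fun _ _ => ENNReal.toReal_nonneg)
      (fun x y d n _ _ => div_pos (hK _ _) (hK _ _))
      (fun x d n _ => (hcorr x d n).1) (fun x₁ d n _ => ?_) (fun x d n _ => (hΨ x d n).1)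
    rw [hs]
    have h1 : ∀ x, (bridgeMixture R a b {ω | ω t = x ∧ ω 1 = x₁}).toReal *
        (refKernel γ t 1 (upd x₁ d n) x / refKernel γ t 1 x₁ x) =
        b x₁ * (refKernel γ t 1 (upd x₁ d n) x * evolve γ a t x) := by
      intro x
      rw [hp]
      have := (hK x₁ x).ne'
      field_simp
    simp only [h1]
    rw [← Finset.mul_sum, sum_refKernel_mul_evolve hγ a t.2, ratioCorrector]
    have := (hA x₁).ne'
    field_simp
  refine ⟨hcorr, fun Ψ hΨ => by rw [hadd Ψ hΨ]; exact le_self_add, fun Ψ hΨ hle => ?_⟩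
  rw [hadd Ψ hΨ] at hle
  have hfin' : corrDMLoss γ w f (bridgeMixture R a b) (ratioCorrector (evolve γ a 1)) ≠ ⊤ := by
    obtain ⟨Ψ₀, h1, h2⟩ := hfin
    rw [hadd Ψ₀ h1] at h2
    exact (ENNReal.add_ne_top.mp h2).1
  have h0 := (mul_eq_zero.mp (eq_zero_of_add_le hfin' hle)).resolve_left
    (lintegral_weight_ne_zero hw hw1)
  refine corrector_ext hΨ hcorr fun x d n hn => ?_
  refine eq_of_regressionExcess_eq_zero hf hf' (fun x d n _ => (hcorr x d n).1)
    (fun x d n _ => (hΨ x d n).1) h0 ?_ hn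
  rw [hs]
  exact mul_pos (hb x) (hA x)

end Losses

/-! ### Markov chains with bounded rates -/

section BoundedRates

variable {N D : ℕ} [NeZero N]

/-- Rates that are nonnegative off the diagonal, conservative, and bounded by `C`. -/
structure IsBoundedRate (U : ℝ → State N D → State N D → ℝ) (C : ℝ) : Prop where
  nonneg : ∀ t ∈ Icc (0 : ℝ) 1, ∀ y x, y ≠ x → 0 ≤ U t y x
  sum_eq_zero : ∀ t x, ∑ y, U t y x = 0
  abs_le : ∀ t ∈ Icc (0 : ℝ) 1, ∀ y x, |U t y x| ≤ C

variable {U : ℝ → State N D → State N D → ℝ} {C : ℝ} {K : ℝ → ℝ → State N D → State N D → ℝ}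
  {μ : State N D → ℝ} {P : Measure (PathSpace N D)}

theorem measure_eq_sum_inter (m : Measure (PathSpace N D)) (t : I) {A : Set (PathSpace N D)}
    (hA : MeasurableSet A) : m A = ∑ x, m ({ω | ω t = x} ∩ A) := by
  have h := measure_univ_eq_sum (m.restrict A) t
  rw [Measure.restrict_apply_univ] at h
  rw [h]
  exact Finset.sum_congr rfl fun x _ => Measure.restrict_apply' hA

theorem measurableSet_eval_eq (t : I) (x : State N D) : MeasurableSet {ω : PathSpace N D | ω t = x} :=
  measurable_eval t (measurableSet_singleton x)

/-- The mean value theorem replaces integration of the forward equation, so no integrability in time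
is needed. -/
theorem exists_slope_kernel (hK : IsForwardKernel U K) {s t : ℝ} (hs : s ∈ Icc (0 : ℝ) 1)
    (ht : t ∈ Icc (0 : ℝ) 1) (hst : s < t) (c : State N D → ℝ) (x : State N D) :
    ∃ τ ∈ Ioo s t, ∑ y, c y * K s t y x - ∑ y, c y * K s s y x =
      (t - s) * ∑ y, c y * ∑ z, U τ y z * K s τ z x := by
  obtain ⟨τ, hτ, h⟩ := exists_hasDerivAt_eq_slope (fun t => ∑ y, c y * K s t y x)
    (fun τ => ∑ y, c y * ∑ z, U τ y z * K s τ z x) hst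
    (continuousOn_finsetSum _ fun y _ => continuousOn_const.mul
      ((hK.2.1 s hs y x).mono (Icc_subset_Icc_right ht.2)))
    (fun τ hτ => HasDerivAt.fun_sum fun y _ =>
      (hK.2.2 s hs τ ⟨hτ.1, hτ.2.trans_le ht.2⟩ y x).const_mul (c y))
  refine ⟨τ, hτ, ?_⟩
  rw [h]
  have : t - s ≠ 0 := (sub_pos.mpr hst).ne'
  field_simp

theorem sum_kernel (hU : IsBoundedRate U C) (hK : IsForwardKernel U K) {s t : ℝ}
    (hs : s ∈ Icc (0 : ℝ) 1) (ht : t ∈ Icc (0 : ℝ) 1) (hst : s ≤ t) (x : State N D) :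
    ∑ y, K s t y x = 1 := by
  have h0 : ∑ y, K s s y x = 1 := by simp [hK.1 s hs]
  rcases hst.eq_or_lt with rfl | h
  · exact h0
  · obtain ⟨τ, hτ, hτ'⟩ := exists_slope_kernel hK hs ht h (fun _ => 1) x
    simp only [one_mul, h0] at hτ'
    rw [Finset.sum_comm] at hτ'
    simp only [← Finset.sum_mul, hU.sum_eq_zero, zero_mul, Finset.sum_const_zero, mul_zero] at hτ'
    linarith

/-- The finite-dimensional distributions of a chain with kernel `K`. -/
def HasKernel (μ : State N D → ℝ) (K : ℝ → ℝ → State N D → State N D → ℝ)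
    (P : Measure (PathSpace N D)) : Prop :=
  ∀ (n : ℕ) (t : Fin (n + 1) → I) (x : Fin (n + 1) → State N D), Monotone t → t 0 = 0 →
    P {ω | ∀ i, ω (t i) = x i} = ENNReal.ofReal
      (μ (x 0) * ∏ i : Fin n, K (t i.castSucc) (t i.succ) (x i.succ) (x i.castSucc))

theorem HasKernel.initial (hP : HasKernel μ K P) (x : State N D) :
    P {ω | ω 0 = x} = ENNReal.ofReal (μ x) := by
  have h := hP 0 ![0] ![x] (by intro i j _; fin_cases i; fin_cases j; simp) rfl
  simpa using h

theorem HasKernel.pair (hP : HasKernel μ K P) (s : I) (x₀ x : State N D) :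
    P {ω | ω 0 = x₀ ∧ ω s = x} = ENNReal.ofReal (μ x₀ * K 0 s x x₀) := by
  have h := hP 1 ![0, s] ![x₀, x] (by
    intro i j hij; fin_cases i <;> fin_cases j <;> simp_all) rfl
  simpa [Fin.forall_fin_two] using h

theorem HasKernel.triple (hP : HasKernel μ K P) {s t : I} (hst : s ≤ t) (x₀ x y : State N D) :
    P {ω | ω 0 = x₀ ∧ ω s = x ∧ ω t = y} =
      ENNReal.ofReal (μ x₀ * (K 0 s x x₀ * K s t y x)) := by
  have h := hP 2 ![0, s, t] ![x₀, x, y] (by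
    intro i j hij; fin_cases i <;> fin_cases j <;> simp_all) rfl
  simpa [Fin.forall_fin_succ, Fin.prod_univ_two] using h

/-- The marginals of a path measure, as real numbers. -/
noncomputable def marginal (P : Measure (PathSpace N D)) (t : I) (x : State N D) : ℝ :=
  (P {ω | ω t = x}).toReal

/-- The joint laws of a path measure at two times, as real numbers. -/
noncomputable def jointLaw (P : Measure (PathSpace N D)) (s t : I) (x y : State N D) : ℝ :=
  (P {ω | ω s = x ∧ ω t = y}).toReal

theorem sum_jointLaw [IsFiniteMeasure P] (s t : I) (x : State N D) :
    ∑ y, jointLaw P s t x y = marginal P s x := by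
  unfold jointLaw marginal
  rw [measure_eq_sum_inter P t (measurableSet_eval_eq s x),
    ENNReal.toReal_sum fun _ _ => measure_ne_top P _]
  refine Finset.sum_congr rfl fun y _ => ?_
  rw [inter_comm]
  rfl

/-- `ENNReal.ofReal` truncates negative numbers at 0, so the sum can stay 1 only if nothing is
truncated. -/
theorem nonneg_of_sum_ofReal_eq {ι : Type*} [Fintype ι] {k : ι → ℝ} (h1 : ∑ i, k i = 1)
    (h : ∑ i, ENNReal.ofReal (k i) = 1) (i : ι) : 0 ≤ k i := by
  have h2 : ∑ i, max (k i) 0 = 1 := by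
    have h3 := congrArg ENNReal.toReal h
    rw [ENNReal.toReal_sum fun _ _ => ENNReal.ofReal_ne_top] at h3
    simpa [ENNReal.toReal_ofReal'] using h3
  have h4 : ∑ i, (max (k i) 0 - k i) = 0 := by rw [Finset.sum_sub_distrib, h1, h2, sub_self]
  have h5 := (Finset.sum_eq_zero_iff_of_nonneg fun i _ => sub_nonneg.mpr (le_max_left (k i) 0)).mp h4 i
    (Finset.mem_univ i)
  have := le_max_right (k i) 0
  linarith

/-- A kernel is only known to solve the forward equation, and path probabilities see it through
`ENNReal.ofReal`. From a state that is reached, additivity of `P` makes the truncated transition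
numbers sum to 1, as the numbers themselves do; so they are nonnegative and are the conditional
probabilities. -/
theorem kernel_of_marginal_pos [IsProbabilityMeasure P] (hU : IsBoundedRate U C)
    (hK : IsForwardKernel U K) (hP : HasKernel μ K P) {s t : I} (hst : s ≤ t) {x : State N D}
    (hx : 0 < marginal P s x) :
    (∀ y, 0 ≤ K s t y x) ∧ ∀ y, jointLaw P s t x y = marginal P s x * K s t y x := by
  have hsum := sum_kernel hU hK s.2 t.2 hst x
  have hx' : P {ω | ω s = x} ≠ 0 := fun h => by simp [marginal, h] at hx
  rw [measure_eq_sum_inter P 0 (measurableSet_eval_eq s x)] at hx'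
  obtain ⟨x₀, -, hx₀⟩ := Finset.exists_ne_zero_of_sum_ne_zero hx'
  have h2 : ({ω | ω 0 = x₀} ∩ {ω : PathSpace N D | ω s = x}) = {ω | ω 0 = x₀ ∧ ω s = x} := rfl
  rw [h2, hP.pair] at hx₀
  have hc : 0 < μ x₀ * K 0 s x x₀ := by
    by_contra hneg
    exact hx₀ (ENNReal.ofReal_eq_zero.mpr (not_lt.mp hneg))
  have hnn : ∀ y, 0 ≤ K s t y x := by
    refine nonneg_of_sum_ofReal_eq hsum ?_
    have h3 := measure_eq_sum_inter P t ((measurableSet_eval_eq 0 x₀).inter (measurableSet_eval_eq s x))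
    have h4 : ∀ y, {ω : PathSpace N D | ω t = y} ∩ ({ω | ω 0 = x₀} ∩ {ω | ω s = x}) =
        {ω | ω 0 = x₀ ∧ ω s = x ∧ ω t = y} := fun y => by ext ω; simp; tauto
    simp only [h4, hP.triple hst] at h3
    rw [h2, hP.pair] at h3
    simp only [← mul_assoc, ENNReal.ofReal_mul hc.le] at h3
    rw [← Finset.mul_sum] at h3
    have hc' : ENNReal.ofReal (μ x₀ * K 0 s x x₀) ≠ 0 := by simpa using hc
    refine ((ENNReal.mul_right_inj hc' ENNReal.ofReal_ne_top).mp ?_).symm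
    rw [mul_one, ← h3]
  refine ⟨hnn, fun y => ?_⟩
  have h5 : P {ω | ω s = x ∧ ω t = y} = P {ω | ω s = x} * ENNReal.ofReal (K s t y x) := by
    rw [measure_eq_sum_inter P 0 (measurableSet_eval_eq s x),
      measure_eq_sum_inter P 0 (A := {ω | ω s = x ∧ ω t = y})
        ((measurableSet_eval_eq s x).inter (measurableSet_eval_eq t y)), Finset.sum_mul]
    refine Finset.sum_congr rfl fun z _ => ?_
    refine (hP.triple hst z x y).trans ?_
    rw [← mul_assoc, ENNReal.ofReal_mul' (hnn y)]
    congr 1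
    exact (hP.pair s z x).symm
  rw [jointLaw, h5, ENNReal.toReal_mul, ENNReal.toReal_ofReal (hnn y)]
  rfl

theorem abs_sum_mul_kernel_le [IsProbabilityMeasure P] (hU : IsBoundedRate U C)
    (hK : IsForwardKernel U K) (hP : HasKernel μ K P) {s t : I} (hst : s ≤ t) {x : State N D}
    (hx : 0 < marginal P s x) {c : State N D → ℝ} {B : ℝ} (hc : ∀ y, |c y| ≤ B) :
    |∑ y, c y * K s t y x| ≤ B := by
  have hnn := (kernel_of_marginal_pos hU hK hP hst hx).1
  calc |∑ y, c y * K s t y x| ≤ ∑ y, |c y * K s t y x| := Finset.abs_sum_le_sum_abs _ _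
    _ ≤ ∑ y, B * K s t y x := Finset.sum_le_sum fun y _ => by
        rw [abs_mul, abs_of_nonneg (hnn y)]
        exact mul_le_mul_of_nonneg_right (hc y) (hnn y)
    _ = B := by rw [← Finset.mul_sum, sum_kernel hU hK s.2 t.2 hst x, mul_one]

theorem one_sub_kernel_self_le [IsProbabilityMeasure P] (hU : IsBoundedRate U C)
    (hK : IsForwardKernel U K) (hP : HasKernel μ K P) {s t : I} (hst : s ≤ t) {x : State N D}
    (hx : 0 < marginal P s x) : 1 - K s t x x ≤ C * (t - s) := by
  rcases hst.eq_or_lt with rfl | h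
  · simp [hK.1 s s.2]
  · obtain ⟨τ, hτ, hτ'⟩ := exists_slope_kernel hK s.2 t.2 h (fun y => if y = x then 1 else 0) x
    simp only [ite_mul, one_mul, zero_mul, Finset.sum_ite_eq', Finset.mem_univ, if_true,
      hK.1 s s.2] at hτ'
    have hτI : τ ∈ Icc (0 : ℝ) 1 := ⟨s.2.1.trans hτ.1.le, hτ.2.le.trans t.2.2⟩
    have hb := abs_sum_mul_kernel_le hU hK hP (s := s) (t := ⟨τ, hτI⟩) hτ.1.le hx
      (c := fun z => U τ x z) (fun z => hU.abs_le τ hτI x z)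
    have hts : (0 : ℝ) < t - s := sub_pos.mpr h
    nlinarith [neg_le_of_abs_le hb]

theorem sum_marginal [IsProbabilityMeasure P] (t : I) : ∑ x, marginal P t x = 1 := by
  unfold marginal
  rw [← ENNReal.toReal_sum fun _ _ => measure_ne_top P _, ← measure_univ_eq_sum P t]
  simp

/-- Conditionally on a reached state, the probability of being elsewhere at time `t` is at most `C *
(t - s)` by `one_sub_kernel_self_le`; averaging over the states keeps the bound. -/
theorem measure_ne_le [IsProbabilityMeasure P] (hU : IsBoundedRate U C)
    (hK : IsForwardKernel U K) (hP : HasKernel μ K P) {s t : I} (hst : s ≤ t) :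
    (P {ω | ω s ≠ ω t}).toReal ≤ C * (t - s) := by
  have hmeas : MeasurableSet {ω : PathSpace N D | ω s ≠ ω t} :=
    (measurableSet_eq_fun (measurable_eval s) (measurable_eval t)).compl
  have hx : ∀ x, (P ({ω | ω s = x} ∩ {ω | ω s ≠ ω t})).toReal ≤ marginal P s x * (C * (t - s)) := by
    intro x
    have h1 : P ({ω | ω s = x} ∩ {ω | ω s ≠ ω t}) + P {ω | ω s = x ∧ ω t = x} = P {ω | ω s = x} := by
      rw [← measure_inter_add_sdiff {ω | ω s = x} hmeas]
      congr 2
      ext ω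
      change ω s = x ∧ ω t = x ↔ ω s = x ∧ ¬ (ω s ≠ ω t)
      rw [not_not]
      constructor
      · rintro ⟨h1, h2⟩; exact ⟨h1, h1.trans h2.symm⟩
      · rintro ⟨h1, h2⟩; exact ⟨h1, h2 ▸ h1⟩
    have h2 := congrArg ENNReal.toReal h1
    rw [ENNReal.toReal_add (measure_ne_top P _) (measure_ne_top P _)] at h2
    have hm0 : 0 ≤ marginal P s x := ENNReal.toReal_nonneg
    rcases hm0.eq_or_lt with h0 | h0
    · have h3 : (0 : ℝ) ≤ (P {ω | ω s = x ∧ ω t = x}).toReal := ENNReal.toReal_nonneg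
      have h4 : (P {ω | ω s = x}).toReal = 0 := h0.symm
      rw [← h0, zero_mul]
      linarith
    · have h3 := (kernel_of_marginal_pos hU hK hP hst h0).2 x
      have h4 := one_sub_kernel_self_le hU hK hP hst h0
      unfold jointLaw at h3
      rw [h3] at h2
      change _ = marginal P s x at h2
      nlinarith
  rw [measure_eq_sum_inter P s hmeas, ENNReal.toReal_sum fun _ _ => measure_ne_top P _]
  calc _ ≤ ∑ x, marginal P s x * (C * (t - s)) := Finset.sum_le_sum fun x _ => hx x
    _ = C * (t - s) := by rw [← Finset.sum_mul, sum_marginal, one_mul]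

/-- Two joint laws differ by at most the probability that the path takes different values at the two
times, which is Lipschitz. The continuity makes the averaged controller below admissible. -/
theorem continuous_jointLaw_left [IsProbabilityMeasure P] (hU : IsBoundedRate U C)
    (hK : IsForwardKernel U K) (hP : HasKernel μ K P) (r : I) (x y : State N D) :
    Continuous fun t => jointLaw P t r x y := by
  have hC : 0 ≤ C := (abs_nonneg _).trans (hU.abs_le 0 (left_mem_Icc.mpr zero_le_one) x x)
  have key : ∀ s t : I, jointLaw P s r x y ≤ jointLaw P t r x y + (P {ω | ω s ≠ ω t}).toReal := by
    intro s t
    unfold jointLaw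
    rw [← ENNReal.toReal_add (measure_ne_top P _) (measure_ne_top P _)]
    refine ENNReal.toReal_mono (ENNReal.add_ne_top.mpr ⟨measure_ne_top P _, measure_ne_top P _⟩) ?_
    refine (measure_mono ?_).trans (measure_union_le _ _)
    rintro ω ⟨h1, h2⟩
    by_cases h : ω s = ω t
    · exact Or.inl ⟨h ▸ h1, h2⟩
    · exact Or.inr h
  have hsymm : ∀ s t : I, {ω : PathSpace N D | ω s ≠ ω t} = {ω | ω t ≠ ω s} := fun s t => by
    ext ω; exact ne_comm
  refine LipschitzWith.continuous (K := C.toNNReal) (LipschitzWith.of_dist_le_mul fun s t => ?_)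
  rw [Real.dist_eq, abs_sub_le_iff, Subtype.dist_eq, Real.dist_eq]
  have h1 := key s t
  have h2 := key t s
  rw [hsymm t s] at h2
  have h3 : (P {ω | ω s ≠ ω t}).toReal ≤ C * |(s : ℝ) - t| := by
    rcases le_total s t with h | h
    · have hr : (s : ℝ) ≤ t := h
      rw [abs_sub_comm, abs_of_nonneg (sub_nonneg.mpr hr)]
      exact measure_ne_le hU hK hP h
    · have hr : (t : ℝ) ≤ s := h
      rw [hsymm, abs_of_nonneg (sub_nonneg.mpr hr)]
      exact measure_ne_le hU hK hP h
  rw [Real.coe_toNNReal C hC]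
  constructor <;> linarith

/-! #### Positivity of the marginals -/

theorem marginal_eq_sum [IsProbabilityMeasure P] (hμ : ∀ x, 0 ≤ μ x) (hU : IsBoundedRate U C)
    (hK : IsForwardKernel U K) (hP : HasKernel μ K P) (t : I) (x : State N D) :
    marginal P t x = ∑ x₀, μ x₀ * K 0 t x x₀ := by
  have h0 : ∀ x₀, 0 ≤ μ x₀ * K 0 t x x₀ := by
    intro x₀
    rcases (hμ x₀).eq_or_lt with h | h
    · rw [← h, zero_mul]
    · refine mul_nonneg h.le ?_
      have hm : 0 < marginal P 0 x₀ := by rwa [marginal, hP.initial, ENNReal.toReal_ofReal h.le]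
      simpa using (kernel_of_marginal_pos hU hK hP (s := 0) (t := t) unitInterval.nonneg' hm).1 x
  rw [marginal, measure_eq_sum_inter P 0 (measurableSet_eval_eq t x),
    ENNReal.toReal_sum fun _ _ => measure_ne_top P _]
  refine Finset.sum_congr rfl fun x₀ _ => ?_
  rw [← ENNReal.toReal_ofReal (h0 x₀), ← hP.pair t x₀ x]
  rfl

theorem hasDerivAt_sum_kernel (hK : IsForwardKernel U K) {t : ℝ} (ht : t ∈ Ioo (0 : ℝ) 1)
    (μ : State N D → ℝ) (x : State N D) :
    HasDerivAt (fun t => ∑ x₀, μ x₀ * K 0 t x x₀) (∑ z, U t x z * ∑ x₀, μ x₀ * K 0 t z x₀) t := by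
  have h := HasDerivAt.fun_sum (u := Finset.univ) fun x₀ _ =>
    (hK.2.2 0 (left_mem_Icc.mpr zero_le_one) t ht x x₀).const_mul (μ x₀)
  refine h.congr_deriv ?_
  simp only [Finset.mul_sum]
  rw [Finset.sum_comm]
  exact Finset.sum_congr rfl fun z _ => Finset.sum_congr rfl fun y _ => by ring

theorem continuousOn_sum_kernel (hK : IsForwardKernel U K) (μ : State N D → ℝ) (x : State N D) :
    ContinuousOn (fun t => ∑ x₀, μ x₀ * K 0 t x x₀) (Icc 0 1) :=
  continuousOn_finsetSum _ fun x₀ _ =>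
    continuousOn_const.mul (hK.2.1 0 (left_mem_Icc.mpr zero_le_one) x x₀)

/-- The rate of leaving `x` is at most `C`, so `exp (C * t)` times the marginal is nondecreasing. -/
theorem marginal_pos_mono [IsProbabilityMeasure P] (hμ : ∀ x, 0 ≤ μ x) (hU : IsBoundedRate U C)
    (hK : IsForwardKernel U K) (hP : HasKernel μ K P) {s t : I} (hst : s ≤ t) {x : State N D}
    (hs : 0 < marginal P s x) : 0 < marginal P t x := by
  rcases hst.eq_or_lt with rfl | hlt
  · exact hs
  have hm := marginal_eq_sum hμ hU hK hP
  set m : ℝ → State N D → ℝ := fun t x => ∑ x₀, μ x₀ * K 0 t x x₀ with hmdef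
  have hm' : ∀ (t : I) x, marginal P t x = m t x := fun t x => hm t x
  have hmono : MonotoneOn (fun t => Real.exp (C * t) * m t x) (Icc 0 1) := by
    refine monotoneOn_of_deriv_nonneg (convex_Icc 0 1) (ContinuousOn.mul (by fun_prop)
      (continuousOn_sum_kernel hK μ x)) ?_ ?_
    · rw [interior_Icc]
      intro t ht
      exact (((((hasDerivAt_id t).const_mul C).exp).mul (hasDerivAt_sum_kernel hK ht μ x)
        ).differentiableAt).differentiableWithinAt
    · rw [interior_Icc]
      intro t ht
      have htI : t ∈ Icc (0 : ℝ) 1 := Ioo_subset_Icc_self ht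
      have hd : HasDerivAt (fun t => Real.exp (C * t) * m t x)
          (Real.exp (C * t) * C * m t x + Real.exp (C * t) * ∑ z, U t x z * m t z) t := by
        refine HasDerivAt.mul ?_ (hasDerivAt_sum_kernel hK ht μ x)
        simpa using ((hasDerivAt_id t).const_mul C).exp
      rw [hd.deriv]
      have h1 : -C * m t x ≤ ∑ z, U t x z * m t z := by
        have hnn : ∀ z, 0 ≤ m t z := fun z => by
          rw [← hm' ⟨t, htI⟩ z]; exact ENNReal.toReal_nonneg
        rw [← Finset.sum_erase_add _ _ (Finset.mem_univ x)]
        have h2 : 0 ≤ ∑ z ∈ Finset.univ.erase x, U t x z * m t z := Finset.sum_nonneg fun z hz =>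
          mul_nonneg (hU.nonneg t htI x z (Finset.ne_of_mem_erase hz).symm) (hnn z)
        have h3 := neg_le_of_abs_le (hU.abs_le t htI x x)
        nlinarith [hnn x]
      have h4 := Real.exp_pos (C * t)
      nlinarith
  have h := hmono s.2 t.2 hst
  simp only at h
  rw [hm'] at hs ⊢
  have h1 := Real.exp_pos (C * s)
  have h2 := Real.exp_pos (C * t)
  have h3 : 0 < Real.exp (C * t) * m t x := lt_of_lt_of_le (mul_pos h1 hs) h
  exact (mul_pos_iff_of_pos_left h2).mp h3

/-- If the marginal at `x` vanished at `t`, it would vanish on all of `[0, t]` by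
`marginal_pos_mono`. Its derivative would be zero there, although the inflow from `z` is positive at
almost every time. -/
theorem marginal_pos_of_rate_pos [IsProbabilityMeasure P] (hμ : ∀ x, 0 ≤ μ x) (hU : IsBoundedRate U C)
    (hK : IsForwardKernel U K) (hP : HasKernel μ K P) {x z : State N D}
    (hr : ∀ᵐ t ∂volume.restrict (Icc (0 : ℝ) 1), 0 < U t x z)
    (hz : ∀ t : I, t ≠ 0 → 0 < marginal P t z) (t : I) (ht : t ≠ 0) : 0 < marginal P t x := by
  have ht0 : (0 : ℝ) < t := unitInterval.pos_iff_ne_zero.mpr ht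
  refine lt_of_le_of_ne' ENNReal.toReal_nonneg fun h0 => ?_
  have hzero : ∀ s : I, s ≤ t → marginal P s x = 0 := by
    intro s hs
    by_contra hne
    have := marginal_pos_mono hμ hU hK hP hs (lt_of_le_of_ne' ENNReal.toReal_nonneg hne)
    exact this.ne' h0
  set m : ℝ → State N D → ℝ := fun t x => ∑ x₀, μ x₀ * K 0 t x x₀ with hmdef
  have hm' : ∀ (t : I) x, marginal P t x = m t x := fun t x => marginal_eq_sum hμ hU hK hP t x
  have hbad : ∀ s ∈ Ioo (0 : ℝ) t, ¬ 0 < U s x z := by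
    intro s hs hpos
    have hsI : s ∈ Icc (0 : ℝ) 1 := ⟨hs.1.le, hs.2.le.trans t.2.2⟩
    have hd := hasDerivAt_sum_kernel hK (t := s) ⟨hs.1, hs.2.trans_le t.2.2⟩ μ x
    have hd0 : HasDerivAt (fun t => m t x) 0 s := by
      refine (hasDerivAt_const s (0 : ℝ)).congr_of_eventuallyEq ?_
      filter_upwards [Ioo_mem_nhds hs.1 hs.2] with r hr
      have hrI : r ∈ Icc (0 : ℝ) 1 := ⟨hr.1.le, hr.2.le.trans t.2.2⟩
      rw [← hm' ⟨r, hrI⟩ x]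
      exact hzero ⟨r, hrI⟩ hr.2.le
    have h1 := hd.unique hd0
    have hnn : ∀ z, 0 ≤ m s z := fun z => by
      rw [← hm' ⟨s, hsI⟩ z]; exact ENNReal.toReal_nonneg
    have hx0 : m s x = 0 := by rw [← hm' ⟨s, hsI⟩ x]; exact hzero ⟨s, hsI⟩ hs.2.le
    have hzpos : 0 < m s z := by
      rw [← hm' ⟨s, hsI⟩ z]
      exact hz (⟨s, hsI⟩ : I) fun h => hs.1.ne' (congrArg Subtype.val h)
    have h2 : 0 < ∑ z, U s x z * m s z := by
      refine Finset.sum_pos' (fun w _ => ?_) ⟨z, Finset.mem_univ z, mul_pos hpos hzpos⟩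
      by_cases hw : x = w
      · rw [← hw, hx0, mul_zero]
      · exact mul_nonneg (hU.nonneg s hsI x w hw) (hnn w)
    exact h2.ne' h1
  have hsub : Ioo (0 : ℝ) t ⊆ Icc 0 1 := fun s hs => ⟨hs.1.le, hs.2.le.trans t.2.2⟩
  have h3 : ∀ᵐ s ∂volume.restrict (Ioo (0 : ℝ) t), 0 < U s x z :=
    ae_restrict_of_ae_restrict_of_subset hsub hr
  rw [ae_restrict_iff' measurableSet_Ioo] at h3
  have h4 : volume (Ioo (0 : ℝ) t) = 0 := by
    refine measure_mono_null (fun s hs => ?_) h3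
    exact fun h => hbad s hs (h hs)
  simp only [Real.volume_Ioo, sub_zero, ENNReal.ofReal_eq_zero] at h4
  linarith

end BoundedRates

/-! ### Controlled chains -/

section Controlled

variable {N D : ℕ} [NeZero N] {γ w f : ℝ → ℝ} {Φ : ℝ → State N D → Fin D → ZMod N → ℝ}
  {μ ν b : State N D → ℝ} {K : ℝ → ℝ → State N D → State N D → ℝ} {P : Measure (PathSpace N D)}

theorem hammingDist_upd {x : State N D} {d : Fin D} {n : ZMod N} (hn : n ≠ x d) :
    hammingDist (upd x d n) x = 1 := by
  refine Finset.card_eq_one.mpr ⟨d, ?_⟩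
  ext j
  by_cases hj : j = d
  · subst hj; simpa using hn
  · simp [hj]

theorem upd_ne {x : State N D} {d : Fin D} {n : ZMod N} (hn : n ≠ x d) : upd x d n ≠ x := by
  intro h
  have := hammingDist_upd hn
  rw [h, hammingDist_self] at this
  omega

/-- The generator of a rate matrix acting on functions. -/
theorem sum_rateMatrix_mul (off : ℝ → State N D → State N D → ℝ) (t : ℝ) (x : State N D)
    (h : State N D → ℝ) : ∑ z, rateMatrix off t z x * h z =
      ∑ z ∈ Finset.univ.filter (fun z => z ≠ x), off t z x * (h z - h x) := by
  have h1 := Finset.sum_filter_add_sum_filter_not Finset.univ (fun z => z ≠ x)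
    (fun z => rateMatrix off t z x * h z)
  have h3 : (Finset.univ.filter fun z => ¬ (z ≠ x)) = {x} := by ext n; simp
  rw [h3, Finset.sum_singleton] at h1
  rw [← h1, rateMatrix, if_pos rfl, neg_mul, Finset.sum_mul, ← sub_eq_add_neg,
    ← Finset.sum_sub_distrib]
  refine Finset.sum_congr rfl fun z hz => ?_
  have h2 : rateMatrix off t z x = off t z x := if_neg (Finset.mem_filter.mp hz).2
  rw [h2, mul_sub]

theorem sum_ctrlRate_mul (γ : ℝ → ℝ) (Φ : ℝ → State N D → Fin D → ZMod N → ℝ) (t : ℝ)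
    (x : State N D) (h : State N D → ℝ) : ∑ z, ctrlRate γ Φ t z x * h z =
      ∑ d, ∑ n ∈ Finset.univ.filter (fun n => n ≠ x d),
        γ t / N * Φ t x d n * (h (upd x d n) - h x) := by
  rw [ctrlRate, sum_rateMatrix_mul]
  simp only [Finset.sum_mul]
  rw [Finset.sum_comm]
  refine Finset.sum_congr rfl fun d _ => ?_
  rw [Finset.sum_comm]
  refine Finset.sum_congr rfl fun n hn => ?_
  have hn' : n ≠ x d := (Finset.mem_filter.mp hn).2
  have hne : upd x d n ∈ Finset.univ.filter (fun z => z ≠ x) :=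
    Finset.mem_filter.mpr ⟨Finset.mem_univ _, upd_ne hn'⟩
  refine (Finset.sum_eq_single_of_mem (upd x d n) hne fun z _ hz => ?_).trans ?_
  · rw [if_neg hz, zero_mul]
  · rw [if_pos rfl, refRate, if_pos (hammingDist_upd hn')]

theorem sum_refRate_mul (γ : ℝ → ℝ) (t : ℝ) (x : State N D) (g : State N D → ℝ) :
    ∑ z, refRate γ t x z * g z = ∑ d, ∑ n ∈ Finset.univ.filter (fun n => n ≠ x d),
      γ t / N * (g (upd x d n) - g x) := by
  have hN : (N : ℝ) ≠ 0 := Nat.cast_ne_zero.mpr (NeZero.ne N)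
  have hcard : ∀ d, ((Finset.univ.filter fun n : ZMod N => n ≠ x d).card : ℝ) = N - 1 := by
    intro d
    rw [Finset.filter_ne' Finset.univ (x d), Finset.card_erase_of_mem (Finset.mem_univ _),
      Finset.card_univ, ZMod.card, Nat.cast_sub (Nat.one_le_iff_ne_zero.mpr (NeZero.ne N)),
      Nat.cast_one]
  have hrate : ∀ z, refRate γ t x z * g z =
      (if hammingDist x z = 1 then γ t / N * g z else 0) +
        if x = z then -(γ t * D * (1 - 1 / N)) * g z else 0 := by
    intro z
    unfold refRate
    by_cases h1 : hammingDist x z = 1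
    · have : x ≠ z := by rintro rfl; simp at h1
      simp [h1, this]
    · by_cases h2 : x = z <;> simp [h1, h2]
  rw [Finset.sum_congr rfl fun z _ => hrate z, Finset.sum_add_distrib,
    sum_hammingDist_one x fun z => γ t / N * g z, Finset.sum_ite_eq, if_pos (Finset.mem_univ _)]
  simp only [mul_sub, Finset.sum_sub_distrib, Finset.sum_const, nsmul_eq_mul, hcard,
    Finset.card_univ, Fintype.card_fin]
  field_simp
  ring

theorem ctrlRate_nonneg (hγ0 : ∀ t ∈ Icc (0 : ℝ) 1, 0 ≤ γ t) (hΦ : IsController Φ) {t : ℝ}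
    (ht : t ∈ Icc (0 : ℝ) 1) {y x : State N D} (hyx : y ≠ x) : 0 ≤ ctrlRate γ Φ t y x := by
  have h := sum_ctrlRate_mul γ Φ t x fun z => if z = y then 1 else 0
  simp only [mul_ite, mul_one, mul_zero, Finset.sum_ite_eq', Finset.mem_univ, if_true,
    if_neg hyx.symm, sub_zero] at h
  rw [h]
  refine Finset.sum_nonneg fun d _ => Finset.sum_nonneg fun n _ => ?_
  split_ifs
  · exact mul_nonneg (div_nonneg (hγ0 t ht) (Nat.cast_nonneg N)) ((hΦ x d n).2 t ht).1.le
  · exact le_rfl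

theorem ctrlRate_pos (hΦ : IsController Φ) {t : ℝ}
    (ht : t ∈ Icc (0 : ℝ) 1) (hγt : 0 < γ t) {x : State N D} {d : Fin D} {n : ZMod N}
    (hn : n ≠ x d) : 0 < ctrlRate γ Φ t (upd x d n) x := by
  have hN : (0 : ℝ) < N := Nat.cast_pos.mpr (Nat.pos_of_ne_zero (NeZero.ne N))
  have h := sum_ctrlRate_mul γ Φ t x fun z => if z = upd x d n then 1 else 0
  simp only [mul_ite, mul_one, mul_zero, Finset.sum_ite_eq', Finset.mem_univ, if_true,
    if_neg (upd_ne hn).symm, sub_zero] at h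
  have hnn : ∀ d' n', 0 ≤ if upd x d' n' = upd x d n then γ t / N * Φ t x d' n' else 0 := by
    intro d' n'
    split_ifs
    · exact mul_nonneg (div_nonneg hγt.le hN.le) ((hΦ x d' n').2 t ht).1.le
    · exact le_rfl
  rw [h]
  refine Finset.sum_pos' (fun d' _ => Finset.sum_nonneg fun n' _ => hnn d' n')
    ⟨d, Finset.mem_univ d, Finset.sum_pos' (fun n' _ => hnn d n')
      ⟨n, Finset.mem_filter.mpr ⟨Finset.mem_univ n, hn⟩, ?_⟩⟩
  rw [if_pos rfl]
  exact mul_pos (div_pos hγt hN) ((hΦ x d n).2 t ht).1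

theorem exists_isBoundedRate (hγ : ContinuousOn γ (Icc 0 1)) (hγ0 : ∀ t ∈ Icc (0 : ℝ) 1, 0 ≤ γ t)
    (hΦ : IsController Φ) : ∃ C, IsBoundedRate (ctrlRate γ Φ) C := by
  have hcont : ContinuousOn (fun t => ∑ x, ∑ d, ∑ n, |γ t / N * Φ t x d n|) (Icc 0 1) :=
    continuousOn_finsetSum _ fun x _ => continuousOn_finsetSum _ fun d _ =>
      continuousOn_finsetSum _ fun n _ => ((hγ.div_const _).mul (hΦ x d n).1).abs
  obtain ⟨C, hC⟩ := isCompact_Icc.exists_bound_of_continuousOn hcont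
  refine ⟨C, fun t ht y x hyx => ctrlRate_nonneg hγ0 hΦ ht hyx, fun t x => ?_, fun t ht y x => ?_⟩
  · have h := sum_ctrlRate_mul γ Φ t x fun _ => 1
    simpa using h
  · have h := sum_ctrlRate_mul γ Φ t x fun z => if z = y then 1 else 0
    simp only [mul_ite, mul_one, mul_zero, Finset.sum_ite_eq', Finset.mem_univ, if_true] at h
    refine le_trans ?_ ((le_abs_self _).trans (hC t ht))
    rw [h]
    refine (Finset.abs_sum_le_sum_abs _ _).trans ((Finset.sum_le_sum fun d _ =>
      (Finset.abs_sum_le_sum_abs _ _).trans ((Finset.sum_le_sum fun n _ => ?_).trans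
      (Finset.sum_le_sum_of_subset_of_nonneg (Finset.filter_subset _ _)
        fun n _ _ => abs_nonneg (γ t / N * Φ t x d n)))).trans
      (Finset.single_le_sum (f := fun x => ∑ d, ∑ n, |γ t / N * Φ t x d n|)
        (fun x _ => Finset.sum_nonneg fun d _ => Finset.sum_nonneg fun n _ => abs_nonneg _)
        (Finset.mem_univ x)))
    rw [abs_mul]
    refine mul_le_of_le_one_right (abs_nonneg _) ?_
    split_ifs <;> simp

/-- Controlled chains reach every state immediately. -/
theorem marginal_pos_of_isController [IsProbabilityMeasure P] (hγ : ContinuousOn γ (Icc 0 1))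
    (hγ0 : ∀ t ∈ Icc (0 : ℝ) 1, 0 ≤ γ t) (hγ1 : ∀ᵐ t ∂volume.restrict (Icc (0 : ℝ) 1), 0 < γ t)
    (hμ : IsProbVec μ) (hΦ : IsController Φ) (hK : IsForwardKernel (ctrlRate γ Φ) K)
    (hP : HasKernel μ K P) {t : I} (ht : t ≠ 0) (x : State N D) : 0 < marginal P t x := by
  obtain ⟨C, hU⟩ := exists_isBoundedRate hγ hγ0 hΦ
  obtain ⟨x₀, -, hx₀⟩ := Finset.exists_ne_zero_of_sum_ne_zero (hμ.2.trans_ne one_ne_zero)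
  have hx₀' : 0 < μ x₀ := lt_of_le_of_ne' (hμ.1 x₀) hx₀
  -- `s` contains the entries in which `x` may differ from a state `x₀` of positive initial
  -- probability. Each induction step gains one entry by a single jump.
  have key : ∀ (s : Finset (Fin D)) (x : State N D), (∀ d, d ∉ s → x d = x₀ d) →
      ∀ t : I, t ≠ 0 → 0 < marginal P t x := by
    intro s
    induction s using Finset.induction with
    | empty =>
      intro x hx t _
      have : x = x₀ := funext fun d => hx d (Finset.notMem_empty d)
      subst this
      refine marginal_pos_mono hμ.1 hU hK hP (s := 0) unitInterval.nonneg' ?_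
      rwa [marginal, hP.initial, ENNReal.toReal_ofReal hx₀'.le]
    | insert d s _ ih =>
      intro x hx t ht
      by_cases hd : x d = x₀ d
      · refine ih x (fun e he => ?_) t ht
        by_cases hed : e = d
        · rw [hed, hd]
        · exact hx e (by simp [hed, he])
      · have hz : ∀ e, e ∉ s → upd x d (x₀ d) e = x₀ e := by
          intro e he
          by_cases hed : e = d
          · subst hed; simp
          · rw [upd, Function.update_of_ne hed]
            exact hx e (by simp [hed, he])
        have hxu : upd (upd x d (x₀ d)) d (x d) = x := by simp [upd]
        have hne : x d ≠ upd x d (x₀ d) d := by simpa using hd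
        refine marginal_pos_of_rate_pos hμ.1 hU hK hP (x := x) (z := upd x d (x₀ d)) ?_
          (ih _ hz) t ht
        filter_upwards [hγ1, ae_restrict_mem measurableSet_Icc] with t ht htI
        have := ctrlRate_pos hΦ htI ht hne
        rwa [hxu] at this
  exact key Finset.univ x (fun d hd => absurd (Finset.mem_univ d) hd) t ht

/-! #### The evolution of discrete scores -/

theorem refRate_add (t : ℝ) (y x c : State N D) :
    refRate γ t (y + c) (x + c) = refRate γ t y x := by
  have h : hammingDist (y + c) (x + c) = hammingDist y x := by
    simp [hammingDist]
  simp [refRate, h]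

/-- By translation invariance numerator and denominator both solve the backward equation of the
reference chain. Their quotient then solves the backward equation of the Doob transform by the
denominator, which is the chain of the ratio controller. -/
theorem hasDerivAt_score (hγ : ContinuousOn γ (Icc 0 1)) (hγ0 : ∀ t ∈ Icc (0 : ℝ) 1, 0 ≤ γ t)
    (hb : ∀ x, 0 < b x) {t : ℝ} (ht : t ∈ Ioo (0 : ℝ) 1) (c x : State N D) :
    HasDerivAt (fun t => coevolve γ b t (x + c) / coevolve γ b t x)
      (-∑ z, ctrlRate γ (ratioController γ b) t z x *
        (coevolve γ b t (z + c) / coevolve γ b t z)) t := by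
  have hpos := coevolve_pos hγ0 hb (Ioo_subset_Icc_self ht)
  have h := (hasDerivAt_coevolve hγ ht b (x + c)).div (hasDerivAt_coevolve hγ ht b x) (hpos x).ne'
  refine h.congr_deriv ?_
  have h1 : ∑ z, refRate γ t (x + c) z * coevolve γ b t z =
      ∑ z, refRate γ t x z * coevolve γ b t (z + c) := by
    rw [← Equiv.sum_comp (Equiv.addRight c)]
    simp only [Equiv.coe_addRight, refRate_add]
  rw [h1, sum_refRate_mul γ t x fun z => coevolve γ b t (z + c), sum_refRate_mul, sum_ctrlRate_mul]
  have hx := (hpos x).ne'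
  set S₁ := ∑ d, ∑ n ∈ Finset.univ.filter (fun n => n ≠ x d),
    γ t / N * (coevolve γ b t (upd x d n + c) - coevolve γ b t (x + c)) with hS₁
  set S₂ := ∑ d, ∑ n ∈ Finset.univ.filter (fun n => n ≠ x d),
    γ t / N * (coevolve γ b t (upd x d n) - coevolve γ b t x) with hS₂
  have h2 : ∑ d, ∑ n ∈ Finset.univ.filter (fun n => n ≠ x d),
      γ t / N * ratioController γ b t x d n *
        (coevolve γ b t (upd x d n + c) / coevolve γ b t (upd x d n) -
          coevolve γ b t (x + c) / coevolve γ b t x) =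
      S₁ / coevolve γ b t x - coevolve γ b t (x + c) / coevolve γ b t x ^ 2 * S₂ := by
    simp only [hS₁, hS₂, Finset.sum_div, Finset.mul_sum, ← Finset.sum_sub_distrib]
    refine Finset.sum_congr rfl fun d _ => Finset.sum_congr rfl fun n _ => ?_
    have hu := (hpos (upd x d n)).ne'
    rw [ratioController]
    field_simp
    ring
  rw [h2]
  field_simp
  ring

/-! #### Analytic lemmas -/

/-- The bound on the derivative makes `± V t - A / l * exp (l * (1 - t))` nondecreasing, so `V'`
need not be integrable. -/
theorem abs_sub_le_of_hasDerivAt {V V' : ℝ → ℝ} {s A l : ℝ} (hs : s ∈ Icc (0 : ℝ) 1) (hl : 0 < l)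
    (hA : 0 ≤ A) (hV : ContinuousOn V (Icc s 1)) (hd : ∀ t ∈ Ioo s 1, HasDerivAt V (V' t) t)
    (hb : ∀ t ∈ Ioo s 1, |V' t| ≤ A * Real.exp (l * (1 - t))) :
    |V 1 - V s| ≤ A / l * Real.exp (l * (1 - s)) := by
  have key : ∀ c : ℝ, |c| = 1 → c * V s - A / l * Real.exp (l * (1 - s)) ≤ c * V 1 - A / l := by
    intro c hc
    have hder : ∀ t ∈ Ioo s 1, HasDerivAt (fun t => c * V t - A / l * Real.exp (l * (1 - t)))
        (c * V' t + A * Real.exp (l * (1 - t))) t := by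
      intro t ht
      have h1 : HasDerivAt (fun t => Real.exp (l * (1 - t)))
          (Real.exp (l * (1 - t)) * (l * (0 - 1))) t :=
        (((hasDerivAt_const t (1 : ℝ)).sub (hasDerivAt_id t)).const_mul l).exp
      refine (((hd t ht).const_mul c).sub (h1.const_mul (A / l))).congr_deriv ?_
      field_simp
      ring
    have hmono : MonotoneOn (fun t => c * V t - A / l * Real.exp (l * (1 - t))) (Icc s 1) := by
      refine monotoneOn_of_deriv_nonneg (convex_Icc s 1)
        ((continuousOn_const.mul hV).sub (by fun_prop)) ?_ ?_
      · rw [interior_Icc]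
        exact fun t ht => (hder t ht).differentiableAt.differentiableWithinAt
      · rw [interior_Icc]
        intro t ht
        rw [(hder t ht).deriv]
        have h1 : |c * V' t| ≤ A * Real.exp (l * (1 - t)) := by
          rw [abs_mul, hc, one_mul]; exact hb t ht
        linarith [neg_abs_le (c * V' t)]
    have := hmono (left_mem_Icc.mpr hs.2) (right_mem_Icc.mpr hs.2) hs.2
    simpa using this
  have h1 := key 1 (by simp)
  have h2 := key (-1) (by simp)
  have h3 : 0 ≤ A / l := div_nonneg hA hl.le
  rw [abs_le]
  constructor <;> linarith

/-- A set of full measure is dense, and the inequality passes to limits by continuity. -/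
theorem le_of_ae_le {F : ℝ → ℝ} {m : ℝ} (hF : ContinuousOn F (Icc 0 1))
    (h : ∀ᵐ t ∂volume.restrict (Icc (0 : ℝ) 1), F t ≤ m) : ∀ t ∈ Icc (0 : ℝ) 1, F t ≤ m := by
  rw [ae_restrict_iff' measurableSet_Icc] at h
  have hd : Dense {t : ℝ | t ∈ Icc (0 : ℝ) 1 → F t ≤ m} := Measure.dense_of_ae h
  have h1 : IsClosed (Icc (0 : ℝ) 1 ∩ F ⁻¹' Iic m) :=
    hF.preimage_isClosed_of_isClosed isClosed_Icc isClosed_Iic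
  have h2 : Ioo (0 : ℝ) 1 ∩ {t : ℝ | t ∈ Icc (0 : ℝ) 1 → F t ≤ m} ⊆ Icc (0 : ℝ) 1 ∩ F ⁻¹' Iic m :=
    fun t ht => ⟨Ioo_subset_Icc_self ht.1, ht.2 (Ioo_subset_Icc_self ht.1)⟩
  have h3 : closure (Ioo (0 : ℝ) 1) ⊆ Icc (0 : ℝ) 1 ∩ F ⁻¹' Iic m :=
    closure_minimal ((hd.open_subset_closure_inter isOpen_Ioo).trans (closure_minimal h2 h1)) h1
  rw [closure_Ioo zero_ne_one] at h3
  exact fun t ht => (h3 ht).2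

/-- A backward Grönwall inequality in the form of a weighted supremum. -/
theorem eq_zero_of_gronwall {Δ : ℝ → ℝ} {C : ℝ} (hC : 0 ≤ C) (hΔ : ContinuousOn Δ (Icc 0 1))
    (hΔ0 : ∀ t ∈ Icc (0 : ℝ) 1, 0 ≤ Δ t)
    (h : ∀ A l, 0 ≤ A → 0 < l → (∀ t ∈ Icc (0 : ℝ) 1, Δ t ≤ A * Real.exp (l * (1 - t))) →
      ∀ᵐ s ∂volume.restrict (Icc (0 : ℝ) 1), Δ s ≤ C * A / l * Real.exp (l * (1 - s))) :
    ∀ t ∈ Icc (0 : ℝ) 1, Δ t = 0 := by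
  -- With `C < l` the improved bound, taken at the maximum of the weighted function `F`, forces this
  -- maximum to be zero.
  set l := 2 * (C + 1) with hl
  have hl0 : 0 < l := by positivity
  set F : ℝ → ℝ := fun t => Δ t * Real.exp (-(l * (1 - t))) with hFdef
  have hF : ContinuousOn F (Icc 0 1) := hΔ.mul (by fun_prop)
  have hexp : ∀ t, Real.exp (-(l * (1 - t))) * Real.exp (l * (1 - t)) = 1 := fun t => by
    rw [← Real.exp_add, neg_add_cancel, Real.exp_zero]
  have hΔF : ∀ t, Δ t = F t * Real.exp (l * (1 - t)) := fun t => by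
    rw [hFdef, mul_assoc, hexp, mul_one]
  obtain ⟨t₀, ht₀, hmax⟩ := isCompact_Icc.exists_isMaxOn (nonempty_Icc.mpr zero_le_one) hF
  have hF0 : ∀ t ∈ Icc (0 : ℝ) 1, 0 ≤ F t := fun t ht => mul_nonneg (hΔ0 t ht) (Real.exp_pos _).le
  have h1 := h (F t₀) l (hF0 t₀ ht₀) hl0 fun t ht => by
    rw [hΔF]; exact mul_le_mul_of_nonneg_right (hmax ht) (Real.exp_pos _).le
  have h2 := le_of_ae_le (m := C * F t₀ / l) hF (by
    filter_upwards [h1] with s hs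
    have := mul_le_mul_of_nonneg_right hs (Real.exp_pos (-(l * (1 - s)))).le
    rwa [mul_assoc _ (Real.exp _), mul_comm (Real.exp (l * (1 - s))), hexp, mul_one] at this) t₀ ht₀
  have h3 : F t₀ = 0 := by
    rw [le_div_iff₀ hl0, hl] at h2
    nlinarith [hF0 t₀ ht₀]
  intro t ht
  have h4 := hmax ht
  have h5 := hF0 t ht
  rw [hΔF, le_antisymm (h4.trans_eq h3) h5, zero_mul]

/-- The solution of the Kolmogorov forward equation is unique. -/
theorem forwardKernel_unique {U : ℝ → State N D → State N D → ℝ} {C : ℝ} (hU : IsBoundedRate U C)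
    {K K' : ℝ → ℝ → State N D → State N D → ℝ} (hK : IsForwardKernel U K)
    (hK' : IsForwardKernel U K') (y x : State N D) : K 0 1 y x = K' 0 1 y x := by
  have h01 : (0 : ℝ) ∈ Icc (0 : ℝ) 1 := left_mem_Icc.mpr zero_le_one
  set k : ℝ → State N D → ℝ := fun t y => K 0 t y x - K' 0 t y x with hk
  -- `M` bounds the quadratic form of the rate matrix, so the squared norm of the difference of two
  -- solutions, damped by `exp (-2 * M * t)`, is nonincreasing and starts at zero.
  set M : ℝ := C * Fintype.card (State N D) with hM
  set E : ℝ → ℝ := fun t => Real.exp (-(2 * M * t)) * ∑ y, k t y ^ 2 with hE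
  have hkd : ∀ t ∈ Ioo (0 : ℝ) 1, ∀ y, HasDerivAt (fun t => k t y) (∑ z, U t y z * k t z) t := by
    intro t ht y
    refine ((hK.2.2 0 h01 t ht y x).sub (hK'.2.2 0 h01 t ht y x)).congr_deriv ?_
    rw [← Finset.sum_sub_distrib]
    exact Finset.sum_congr rfl fun z _ => by rw [hk, mul_sub]
  have hEd : ∀ t ∈ Ioo (0 : ℝ) 1, HasDerivAt E (Real.exp (-(2 * M * t)) * (-(2 * M)) * ∑ y, k t y ^ 2 +
      Real.exp (-(2 * M * t)) * ∑ y, 2 * k t y * ∑ z, U t y z * k t z) t := by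
    intro t ht
    refine HasDerivAt.mul ?_ (HasDerivAt.fun_sum fun y _ => ?_)
    · simpa using ((hasDerivAt_id t).const_mul (2 * M)).neg.exp
    · simpa using (hkd t ht y).fun_pow 2
  have hanti : AntitoneOn E (Icc 0 1) := by
    refine antitoneOn_of_deriv_nonpos (convex_Icc 0 1) (ContinuousOn.mul (by fun_prop)
      (continuousOn_finsetSum _ fun y _ => ((hK.2.1 0 h01 y x).sub (hK'.2.1 0 h01 y x)).pow 2)) ?_ ?_
    · rw [interior_Icc]
      exact fun t ht => (hEd t ht).differentiableAt.differentiableWithinAt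
    · rw [interior_Icc]
      intro t ht
      rw [(hEd t ht).deriv]
      have h1 : ∑ y, 2 * k t y * ∑ z, U t y z * k t z ≤ ∑ y, ∑ z : State N D, C * (k t y ^ 2 + k t z ^ 2) := by
        refine Finset.sum_le_sum fun y _ => ?_
        rw [Finset.mul_sum]
        refine Finset.sum_le_sum fun z _ => ?_
        have h2 := hU.abs_le t (Ioo_subset_Icc_self ht) y z
        have h3 : U t y z * (k t y * k t z) ≤ C * |k t y * k t z| :=
          (le_abs_self _).trans (by rw [abs_mul]; exact mul_le_mul_of_nonneg_right h2 (abs_nonneg _))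
        have h4 : 2 * |k t y * k t z| ≤ k t y ^ 2 + k t z ^ 2 := by
          rw [abs_mul]
          nlinarith [sq_nonneg (|k t y| - |k t z|), sq_abs (k t y), sq_abs (k t z)]
        have hC : 0 ≤ C := (abs_nonneg _).trans h2
        nlinarith
      have h5 : ∑ y, ∑ z : State N D, C * (k t y ^ 2 + k t z ^ 2) = 2 * M * ∑ y, k t y ^ 2 := by
        simp only [mul_add, Finset.sum_add_distrib, Finset.sum_const, Finset.card_univ,
          nsmul_eq_mul, ← Finset.mul_sum, hM]
        ring
      have h6 := Real.exp_pos (-(2 * M * t))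
      nlinarith
  have h1 := hanti h01 (right_mem_Icc.mpr zero_le_one) zero_le_one
  have h0 : E 0 = 0 := by simp [hE, hk, hK.1 0 h01, hK'.1 0 h01]
  rw [h0] at h1
  have h2 : ∑ y, k 1 y ^ 2 ≤ 0 := by
    have := Real.exp_pos (-(2 * M * 1))
    by_contra hneg
    have := mul_pos this (not_le.mp hneg)
    linarith
  have h3 := (Finset.sum_eq_zero_iff_of_nonneg fun y _ => sq_nonneg (k 1 y)).mp
    (le_antisymm h2 (Finset.sum_nonneg fun y _ => sq_nonneg _)) y (Finset.mem_univ y)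
  have h4 : k 1 y = 0 := pow_eq_zero_iff two_ne_zero |>.mp h3
  linarith

end Controlled

/-! ### Uniqueness of the fixed points of the controller loss -/

section FixedPoint

variable {N D : ℕ} [NeZero N] {γ w f : ℝ → ℝ} {Φ : ℝ → State N D → Fin D → ZMod N → ℝ}
  {Φh : State N D → Fin D → ZMod N → ℝ}
  {μ ν φ : State N D → ℝ} {K : ℝ → ℝ → State N D → State N D → ℝ} {P : Measure (PathSpace N D)}

/-- The average of a controller and the conditional expectation of the regression targets, with
weights that depend continuously on time. -/
noncomputable def averagedController (ν : State N D → ℝ) (Φh : State N D → Fin D → ZMod N → ℝ)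
    (P : Measure (PathSpace N D)) (Φ : ℝ → State N D → Fin D → ZMod N → ℝ) (t : ℝ)
    (x : State N D) (d : Fin D) (n : ZMod N) : ℝ :=
  (Φ t x d n + ∑ x₁, jointLaw P (projIcc 0 1 zero_le_one t) 1 x x₁ * ctrlTarget ν Φh x x₁ d n) /
    (1 + marginal P (projIcc 0 1 zero_le_one t) x)

theorem averagedController_coe (t : I) (x : State N D) (d : Fin D) (n : ZMod N) :
    averagedController ν Φh P Φ t x d n = (Φ t x d n + ∑ x₁, jointLaw P t 1 x x₁ *
      ctrlTarget ν Φh x x₁ d n) / (1 + marginal P t x) := by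
  rw [averagedController, projIcc_val]

theorem marginal_nonneg (t : I) (x : State N D) : 0 ≤ marginal P t x := ENNReal.toReal_nonneg

theorem jointLaw_nonneg (s t : I) (x y : State N D) : 0 ≤ jointLaw P s t x y :=
  ENNReal.toReal_nonneg

theorem jointLaw_le_one [IsProbabilityMeasure P] (s t : I) (x y : State N D) :
    jointLaw P s t x y ≤ 1 :=
  ENNReal.toReal_le_of_le_ofReal zero_le_one (by simpa using prob_le_one)

theorem ctrlTarget_self (hν : ∀ x, 0 < ν x) (hΦh : IsCorrector Φh) (x x₁ : State N D) (d : Fin D) :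
    ctrlTarget ν Φh x x₁ d (x d) = 1 := by
  rw [ctrlTarget, add_sub_cancel_right, upd_self, div_self (hν x₁).ne', (hΦh x₁ d _).2 rfl, div_one]

theorem isController_averagedController [IsFiniteMeasure P] (hν : ∀ x, 0 < ν x)
    (hΦh : IsCorrector Φh) (hΦ : IsController Φ)
    (hc : ∀ x y, Continuous fun t => jointLaw P t 1 x y) :
    IsController (averagedController ν Φh P Φ) := by
  have hq : ∀ x, Continuous fun t => marginal P t x := fun x => by
    simp only [← sum_jointLaw (P := P) _ 1 x]
    exact continuous_finsetSum _ fun y _ => hc x y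
  have hT := fun x x₁ d n => ctrlTarget_pos hν (fun x d n => (hΦh x d n).1) x x₁ d n
  have hproj : Continuous (projIcc (0 : ℝ) 1 zero_le_one) := continuous_projIcc
  intro x d n
  have hq1 : ∀ t, 0 < 1 + marginal P t x := fun t => by linarith [marginal_nonneg (P := P) t x]
  refine ⟨?_, fun t ht => ⟨?_, ?_⟩⟩
  · refine ContinuousOn.div ((hΦ x d n).1.add (Continuous.continuousOn ?_))
      (Continuous.continuousOn ?_) fun t _ => (hq1 _).ne'
    · exact continuous_finsetSum _ fun x₁ _ => ((hc x x₁).comp hproj).mul continuous_const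
    · exact continuous_const.add ((hq x).comp hproj)
  · exact div_pos (add_pos_of_pos_of_nonneg ((hΦ x d n).2 t ht).1 (Finset.sum_nonneg fun x₁ _ =>
      mul_nonneg (jointLaw_nonneg _ _ _ _) (hT x x₁ d n).le)) (hq1 _)
  · rintro rfl
    simp only [averagedController, ctrlTarget_self hν hΦh, mul_one]
    rw [sum_jointLaw, ((hΦ x d _).2 t ht).2 rfl, div_self (hq1 _).ne']

theorem ctrlAMLoss_eq [IsFiniteMeasure P] (w f : ℝ → ℝ) (ν : State N D → ℝ)
    (Φh : State N D → Fin D → ZMod N → ℝ) (Φ : ℝ → State N D → Fin D → ZMod N → ℝ) :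
    ctrlAMLoss w f ν Φh P Φ = ∫⁻ t : I, ENNReal.ofReal (w t) *
      regressionLoss f (jointLaw P t 1) (ctrlTarget ν Φh) (Φ t) := by
  unfold ctrlAMLoss
  refine lintegral_congr fun t => ?_
  rw [lintegral_ctrlAMTerm]
  rfl

/-- A controller entry has a positive minimum and a finite maximum on `[0, 1]`. The resulting
finiteness of the loss allows equality of integrals to be turned into equality almost everywhere. -/
theorem exists_regressionLoss_le [IsProbabilityMeasure P]
    (hf : StrictConvexOn ℝ (Ioi 0) f) (hf' : DifferentiableOn ℝ f (Ioi 0)) (hΦ : IsController Φ)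
    (T : State N D → State N D → Fin D → ZMod N → ℝ) :
    ∃ C : ℝ≥0∞, C ≠ ⊤ ∧ ∀ t : I, regressionLoss f (jointLaw P t 1) T (Φ t) ≤ C := by
  have hB : ∀ x x₁ d n, ∃ C, ∀ t : I, bregman f (T x x₁ d n) (Φ t x d n) ≤ C := by
    intro x x₁ d n
    obtain ⟨t₀, ht₀, hmin⟩ := isCompact_Icc.exists_isMinOn (nonempty_Icc.mpr zero_le_one)
      (hΦ x d n).1
    obtain ⟨t₁, ht₁, hmax⟩ := isCompact_Icc.exists_isMaxOn (nonempty_Icc.mpr zero_le_one)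
      (hΦ x d n).1
    obtain ⟨C, hC⟩ := exists_bregman_le hf hf' (T x x₁ d n) (β := Φ t₁ x d n)
      ((hΦ x d n).2 t₀ ht₀).1
    exact ⟨C, fun t => hC _ ⟨hmin t.2, hmax t.2⟩⟩
  choose C hC using hB
  refine ⟨∑ x, ∑ y, ∑ d, ∑ n ∈ Finset.univ.filter (fun n => n ≠ x d), ENNReal.ofReal (C x y d n),
    ?_, fun t => Finset.sum_le_sum fun x _ => Finset.sum_le_sum fun y _ => ?_⟩
  · exact ENNReal.sum_ne_top.mpr fun x _ => ENNReal.sum_ne_top.mpr fun y _ =>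
      ENNReal.sum_ne_top.mpr fun d _ => ENNReal.sum_ne_top.mpr fun n _ => ENNReal.ofReal_ne_top
  · have h1 : ENNReal.ofReal (jointLaw P t 1 x y) ≤ 1 := by
      simpa using ENNReal.ofReal_le_ofReal (jointLaw_le_one (P := P) t 1 x y)
    refine (mul_le_of_le_one_right zero_le h1).trans ?_
    exact Finset.sum_le_sum fun d _ => Finset.sum_le_sum fun n _ =>
      ENNReal.ofReal_le_ofReal (hC x y d n t)

theorem measurable_regressionLoss
    (hf' : DifferentiableOn ℝ f (Ioi 0)) (hΦ : IsController Φ)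
    (hc : ∀ x y, Continuous fun t => jointLaw P t 1 x y)
    (T : State N D → State N D → Fin D → ZMod N → ℝ) :
    Measurable fun t : I => regressionLoss f (jointLaw P t 1) T (Φ t) := by
  unfold regressionLoss
  refine Finset.measurable_sum _ fun x _ => Finset.measurable_sum _ fun y _ =>
    Measurable.mul (Finset.measurable_sum _ fun d _ => Finset.measurable_sum _ fun n _ =>
      Measurable.ennreal_ofReal ?_) (hc x y).measurable.ennreal_ofReal
  have h1 : Continuous fun t : I => Φ t x d n :=
    (hΦ x d n).1.comp_continuous continuous_subtype_val fun t => t.2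
  have h2 : Continuous fun t : I => f (Φ t x d n) :=
    hf'.continuousOn.comp_continuous h1 fun t => ((hΦ x d n).2 t t.2).1
  unfold bregman
  exact (measurable_const.sub h2.measurable).sub
    ((measurable_const.sub h1.measurable).mul ((measurable_deriv f).comp h1.measurable))

/-- An optimal controller is the conditional expectation of its regression targets. -/
theorem ae_marginal_mul_eq_of_optimal [IsProbabilityMeasure P] (hw : IntegrableOn w (Icc 0 1))
    (hw1 : ∀ᵐ t ∂volume.restrict (Icc (0 : ℝ) 1), 0 < w t)
    (hf : StrictConvexOn ℝ (Ioi 0) f) (hf' : DifferentiableOn ℝ f (Ioi 0))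
    (hν : ∀ x, 0 < ν x) (hΦh : IsCorrector Φh) (hΦ : IsController Φ)
    (hc : ∀ x y, Continuous fun t => jointLaw P t 1 x y)
    (hpos : ∀ t : I, t ≠ 0 → ∀ x, 0 < marginal P t x)
    (hopt : ∀ Φ', IsController Φ' → ctrlAMLoss w f ν Φh P Φ ≤ ctrlAMLoss w f ν Φh P Φ') :
    ∀ᵐ t : I, ∀ x d n, n ≠ x d → marginal P t x * Φ t x d n =
      ∑ x₁, jointLaw P t 1 x x₁ * ctrlTarget ν Φh x x₁ d n := by
  have hT := fun x x₁ d n => ctrlTarget_pos hν (fun x d n => (hΦh x d n).1) x x₁ d n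
  have hav := isController_averagedController hν hΦh hΦ hc
  set T := ctrlTarget ν Φh with hTdef
  set c := averagedController ν Φh P Φ with hcdef
  set L : (ℝ → State N D → Fin D → ZMod N → ℝ) → I → ℝ≥0∞ := fun Ψ t =>
    regressionLoss f (jointLaw P t 1) T (Ψ t) with hL
  -- The conditional expectation itself may fail to extend continuously to time 0, where marginals
  -- may vanish, so the competitor is its average with `Φ`, with weight `marginal P t x`. By
  -- `bregman_add_le` this already lowers the loss by at least the divergence between the average
  -- and `Φ`.
  have hstep : ∀ t : I, t ≠ 0 →
      L c t + regressionExcess f (jointLaw P t 1) (c t) (Φ t) ≤ L Φ t := by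
    intro t ht
    have hq := hpos t ht
    set g : State N D → Fin D → ZMod N → ℝ := fun x d n =>
      (∑ x₁, jointLaw P t 1 x x₁ * T x x₁ d n) / marginal P t x with hg
    have hgq : ∀ x d n, marginal P t x * g x d n = ∑ x₁, jointLaw P t 1 x x₁ * T x x₁ d n :=
      fun x d n => mul_div_cancel₀ _ (hq x).ne'
    have hg0 : ∀ x d n, 0 < g x d n := by
      intro x d n
      refine div_pos ?_ (hq x)
      have h1 : 0 < ∑ y, jointLaw P t 1 x y := by rw [sum_jointLaw]; exact hq x
      obtain ⟨y, -, hy⟩ := Finset.exists_ne_zero_of_sum_ne_zero h1.ne'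
      exact Finset.sum_pos' (fun y _ => mul_nonneg (jointLaw_nonneg _ _ _ _) (hT x y d n).le)
        ⟨y, Finset.mem_univ y, mul_pos (lt_of_le_of_ne' (jointLaw_nonneg _ _ _ _) hy) (hT x y d n)⟩
    have hadd : ∀ Ψ, IsController Ψ → L Ψ t = regressionLoss f (jointLaw P t 1) T g +
        regressionExcess f (jointLaw P t 1) g (Ψ t) := fun Ψ hΨ =>
      regressionLoss_eq_add hf hf' (fun _ _ => jointLaw_nonneg _ _ _ _)
        (fun x y d n _ _ => hT x y d n) (fun x d n _ => hg0 x d n)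
        (fun x d n _ => by rw [sum_jointLaw, hgq]) (fun x d n _ => ((hΨ x d n).2 t t.2).1)
    rw [hadd c hav, hadd Φ hΦ, add_assoc]
    gcongr
    unfold regressionExcess
    rw [← Finset.sum_add_distrib]
    refine Finset.sum_le_sum fun x _ => ?_
    rw [← Finset.sum_add_distrib]
    refine Finset.sum_le_sum fun d _ => ?_
    rw [← Finset.sum_add_distrib]
    refine Finset.sum_le_sum fun n _ => ?_
    have hΦ0 := ((hΦ x d n).2 t t.2).1
    have hc0 := ((hav x d n).2 t t.2).1
    rw [← mul_add, ← ENNReal.ofReal_add (bregman_nonneg hf hf' (hg0 x d n) hc0)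
      (bregman_nonneg hf hf' hc0 hΦ0)]
    gcongr
    have h1 := bregman_add_le hf hf' (hg0 x d n) hΦ0 (hq x).le
    have h2 : c t x d n = (Φ t x d n + marginal P t x * g x d n) / (1 + marginal P t x) := by
      rw [hcdef, averagedController_coe, hgq]
    rw [h2]
    linarith
  have hle : (fun t : I => ENNReal.ofReal (w t) * L c t) ≤ᵐ[volume]
      fun t : I => ENNReal.ofReal (w t) * L Φ t := by
    filter_upwards [Measure.ae_ne volume (0 : I)] with t ht
    gcongr
    exact le_self_add.trans (hstep t ht)
  obtain ⟨C, hC, hCb⟩ := exists_regressionLoss_le (P := P) hf hf' hΦ T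
  have hfinΦ : ∫⁻ t : I, ENNReal.ofReal (w t) * L Φ t ≠ ⊤ := by
    refine ne_top_of_le_ne_top (ENNReal.mul_ne_top (lintegral_weight_ne_top hw) hC)
      ((lintegral_mono fun t => mul_le_mul_right (hCb t) _).trans ?_)
    rw [lintegral_mul_const' _ _ hC]
  have hmeas : AEMeasurable (fun t : I => ENNReal.ofReal (w t) * L Φ t) :=
    (aemeasurable_weight hw).mul (measurable_regressionLoss hf' hΦ hc T).aemeasurable
  have hopt' := hopt c hav
  rw [ctrlAMLoss_eq, ctrlAMLoss_eq] at hopt'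
  -- Optimality of `Φ` turns the pointwise inequality into equality almost everywhere, so the gap in
  -- `hstep` is zero and `Φ` equals the average, hence the conditional expectation.
  have heq := ae_eq_of_ae_le_of_lintegral_le hle
    (ne_top_of_le_ne_top hfinΦ (lintegral_mono_ae hle)) hmeas hopt'
  filter_upwards [heq, ae_unitInterval hw1, Measure.ae_ne volume (0 : I)] with t h1 h2 h3 x d n hn
  have h4 : L c t = L Φ t :=
    (ENNReal.mul_right_inj (by simpa using h2) ENNReal.ofReal_ne_top).mp h1
  have h5 := hstep t h3
  rw [← h4] at h5
  have h6 := eq_zero_of_add_le regressionLoss_ne_top h5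
  have h7 : Φ t x d n = c t x d n :=
    eq_of_regressionExcess_eq_zero hf hf' (fun x d n _ => ((hav x d n).2 t t.2).1)
      (fun x d n _ => ((hΦ x d n).2 t t.2).1) h6 (by rw [sum_jointLaw]; exact hpos t h3 x) hn
  rw [hcdef, averagedController_coe, eq_div_iff (by linarith [hpos t h3 x])] at h7
  linarith

/-- The controller loss has only one fixed point. -/
theorem eq_ratioController_of_optimal [IsProbabilityMeasure P] (hγ : ContinuousOn γ (Icc 0 1))
    (hγ0 : ∀ t ∈ Icc (0 : ℝ) 1, 0 ≤ γ t) (hγ1 : ∀ᵐ t ∂volume.restrict (Icc (0 : ℝ) 1), 0 < γ t)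
    (hw : IntegrableOn w (Icc 0 1)) (hw1 : ∀ᵐ t ∂volume.restrict (Icc (0 : ℝ) 1), 0 < w t)
    (hf : StrictConvexOn ℝ (Ioi 0) f) (hf' : DifferentiableOn ℝ f (Ioi 0))
    (hμ : IsProbVec μ) (hν : ∀ x, 0 < ν x) (hφ : ∀ x, 0 < φ x) (hΦ : IsController Φ)
    (hK : IsForwardKernel (ctrlRate γ Φ) K) (hP : HasKernel μ K P)
    (hopt : ∀ Φ', IsController Φ' → ctrlAMLoss w f ν (ratioCorrector φ) P Φ ≤
      ctrlAMLoss w f ν (ratioCorrector φ) P Φ') :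
    ∀ t ∈ Icc (0 : ℝ) 1, Φ t = ratioController γ (fun x => ν x / φ x) t := by
  obtain ⟨C₀, hU⟩ := exists_isBoundedRate hγ hγ0 hΦ
  have hb : ∀ x, 0 < ν x / φ x := fun x => div_pos (hν x) (hφ x)
  set b : State N D → ℝ := fun x => ν x / φ x with hbdef
  have hΦs := isController_ratioController hγ hγ0 hb
  have hpos : ∀ t : I, t ≠ 0 → ∀ x, 0 < marginal P t x := fun t ht x =>
    marginal_pos_of_isController hγ hγ0 hγ1 hμ hΦ hK hP ht x
  have hae := ae_marginal_mul_eq_of_optimal hw hw1 hf hf' hν (isCorrector_ratioCorrector hφ) hΦ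
    (fun x y => continuous_jointLaw_left hU hK hP 1 x y) hpos hopt
  -- The scores of `coevolve γ b`; at time 1 they are the regression targets.
  set h : State N D → ℝ → State N D → ℝ := fun c t x => coevolve γ b t (x + c) / coevolve γ b t x
    with hh
  have hhc : ∀ c x, ContinuousOn (fun t => h c t x) (Icc 0 1) := fun c x =>
    (continuousOn_coevolve hγ b _).div (continuousOn_coevolve hγ b _)
      fun t ht => (coevolve_pos hγ0 hb ht x).ne'
  obtain ⟨M, hM⟩ := isCompact_Icc.exists_bound_of_continuousOn
    (continuousOn_finsetSum Finset.univ fun c _ => continuousOn_finsetSum Finset.univ fun x _ =>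
      (hhc c x).abs)
  have hhM : ∀ c x, ∀ t ∈ Icc (0 : ℝ) 1, |h c t x| ≤ M := by
    intro c x t ht
    refine le_trans ?_ ((le_abs_self _).trans (hM t ht))
    exact (Finset.single_le_sum (f := fun x => |h c t x|) (fun _ _ => abs_nonneg _)
      (Finset.mem_univ x)).trans (Finset.single_le_sum (f := fun c => ∑ x, |h c t x|)
      (fun _ _ => Finset.sum_nonneg fun _ _ => abs_nonneg _) (Finset.mem_univ c))
  obtain ⟨G, hG⟩ := isCompact_Icc.exists_bound_of_continuousOn hγ
  have h01 : (0 : ℝ) ∈ Icc (0 : ℝ) 1 := left_mem_Icc.mpr zero_le_one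
  have hM0 : 0 ≤ M := (abs_nonneg _).trans (hhM 0 0 0 h01)
  have hG0 : 0 ≤ G := (norm_nonneg _).trans (hG 0 h01)
  set Δ : ℝ → ℝ := fun t => ∑ x, ∑ d, ∑ n, |Φ t x d n - ratioController γ b t x d n| with hΔ
  have hΔx : ∀ t x, ∑ d, ∑ n, |Φ t x d n - ratioController γ b t x d n| ≤ Δ t := fun t x =>
    Finset.single_le_sum (f := fun x => ∑ d, ∑ n, |Φ t x d n - ratioController γ b t x d n|)
      (fun _ _ => Finset.sum_nonneg fun _ _ => Finset.sum_nonneg fun _ _ => abs_nonneg _)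
      (Finset.mem_univ x)
  set C₁ := G * (2 * M) with hC₁
  have hC₁0 : 0 ≤ C₁ := by positivity
  -- The difference of the generators of the two controllers, applied to the score; it is linear in
  -- their difference.
  set k : State N D → ℝ → State N D → ℝ := fun c t y =>
    ∑ z, ctrlRate γ Φ t z y * h c t z - ∑ z, ctrlRate γ (ratioController γ b) t z y * h c t z with hk
  have hkb : ∀ c y, ∀ t ∈ Icc (0 : ℝ) 1, |k c t y| ≤ C₁ * Δ t := by
    intro c y t ht
    have hNinv : γ t / N ≤ G := by
      refine (div_le_self (hγ0 t ht) (Nat.one_le_cast.mpr (Nat.one_le_iff_ne_zero.mpr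
        (NeZero.ne N)))).trans ((le_abs_self _).trans (hG t ht))
    have h1 : k c t y = ∑ d, ∑ n ∈ Finset.univ.filter (fun n => n ≠ y d),
        γ t / N * (Φ t y d n - ratioController γ b t y d n) * (h c t (upd y d n) - h c t y) := by
      simp only [hk]
      rw [sum_ctrlRate_mul, sum_ctrlRate_mul, ← Finset.sum_sub_distrib]
      refine Finset.sum_congr rfl fun d _ => ?_
      rw [← Finset.sum_sub_distrib]
      exact Finset.sum_congr rfl fun n _ => by ring
    rw [h1]
    refine le_trans ?_ (mul_le_mul_of_nonneg_left (hΔx t y) hC₁0)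
    rw [Finset.mul_sum]
    refine (Finset.abs_sum_le_sum_abs _ _).trans (Finset.sum_le_sum fun d _ => ?_)
    rw [Finset.mul_sum]
    refine (Finset.abs_sum_le_sum_abs _ _).trans ((Finset.sum_le_sum fun n _ => ?_).trans
      (Finset.sum_le_sum_of_subset_of_nonneg (Finset.filter_subset _ _)
        fun n _ _ => mul_nonneg hC₁0 (abs_nonneg _)))
    rw [abs_mul, abs_mul, abs_of_nonneg (div_nonneg (hγ0 t ht) (Nat.cast_nonneg N))]
    have h2 : |h c t (upd y d n) - h c t y| ≤ 2 * M := by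
      have := abs_sub (h c t (upd y d n)) (h c t y)
      linarith [hhM c (upd y d n) t ht, hhM c y t ht]
    calc γ t / N * |Φ t y d n - ratioController γ b t y d n| * |h c t (upd y d n) - h c t y|
        ≤ G * |Φ t y d n - ratioController γ b t y d n| * (2 * M) := by gcongr
      _ = C₁ * |Φ t y d n - ratioController γ b t y d n| := by rw [hC₁]; ring
  set C₂ : ℝ := ∑ _x : State N D, ∑ _d : Fin D, ∑ _n : ZMod N, C₁ with hC₂
  have hΔ0 : ∀ t ∈ Icc (0 : ℝ) 1, Δ t = 0 := by
    refine eq_zero_of_gronwall (C := C₂) (Finset.sum_nonneg fun _ _ => Finset.sum_nonneg fun _ _ =>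
      Finset.sum_nonneg fun _ _ => hC₁0) (continuousOn_finsetSum _ fun x _ =>
      continuousOn_finsetSum _ fun d _ => continuousOn_finsetSum _ fun n _ =>
      ((hΦ x d n).1.sub (hΦs x d n).1).abs) (fun t _ => Finset.sum_nonneg fun _ _ =>
      Finset.sum_nonneg fun _ _ => Finset.sum_nonneg fun _ _ => abs_nonneg _) ?_
    intro A l hA hl hbound
    have hae' : ∀ᵐ t ∂volume.restrict (Icc (0 : ℝ) 1), ∀ ht : t ∈ Icc (0 : ℝ) 1, t ≠ 0 ∧
        ∀ x d n, n ≠ x d → marginal P ⟨t, ht⟩ x * Φ t x d n =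
          ∑ x₁, jointLaw P ⟨t, ht⟩ 1 x x₁ * ctrlTarget ν (ratioCorrector φ) x x₁ d n := by
      rw [← measurePreserving_unitInterval.map_eq,
        (MeasurableEmbedding.subtype_coe measurableSet_Icc).ae_map_iff]
      filter_upwards [hae, Measure.ae_ne volume (0 : I)] with t h1 h2 ht
      exact ⟨fun h => h2 (Subtype.ext h), h1⟩
    filter_upwards [hae', ae_restrict_mem measurableSet_Icc] with s hs hsI
    obtain ⟨hs0, hsx⟩ := hs hsI
    have hmain : ∀ x d n, |Φ s x d n - ratioController γ b s x d n| ≤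
        C₁ * A / l * Real.exp (l * (1 - s)) := by
      intro x d n
      by_cases hn : n = x d
      · rw [((hΦ x d n).2 s hsI).2 hn, ((hΦs x d n).2 s hsI).2 hn, sub_self, abs_zero]
        positivity
      set c : State N D := Pi.single d (n - x d) with hc
      have hq := hpos ⟨s, hsI⟩ (fun h => hs0 (congrArg Subtype.val h)) x
      -- The conditional mean, under the chain of `Φ` given state `x` at time `s`, of the score at
      -- time `t`. It starts at the ratio controller and, by optimality of `Φ`, ends at `Φ s x d n`.
      set V : ℝ → ℝ := fun t => ∑ y, h c t y * K s t y x with hV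
      have hVs : V s = ratioController γ b s x d n := by
        simp only [hV, hK.1 s hsI, mul_ite, mul_one, mul_zero, Finset.sum_ite_eq', Finset.mem_univ,
          if_true]
        rw [ratioController, upd_eq_add]
      have hV1 : V 1 = Φ s x d n := by
        have h1 := hsx x d n hn
        have hj := (kernel_of_marginal_pos hU hK hP (s := ⟨s, hsI⟩) (t := 1)
          unitInterval.le_one' hq).2
        simp only [hj, mul_assoc] at h1
        rw [← Finset.mul_sum] at h1
        rw [mul_left_cancel₀ hq.ne' h1]
        refine Finset.sum_congr rfl fun y _ => ?_
        have h2 : ctrlTarget ν (ratioCorrector φ) x y d n = h c 1 y := by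
          simp only [hh, coevolve_one]
          exact ctrlTarget_ratio hφ x y d n
        rw [h2, mul_comm]
        rfl
      have hVc : ContinuousOn V (Icc s 1) := continuousOn_finsetSum _ fun y _ =>
        ((hhc c y).mono (Icc_subset_Icc_left hsI.1)).mul (hK.2.1 s hsI y x)
      -- The score contributes minus the generator of the ratio controller, the kernel the generator
      -- of `Φ`; only the difference `k` remains.
      have hVd : ∀ t ∈ Ioo s 1, HasDerivAt V (∑ y, k c t y * K s t y x) t := by
        intro t ht
        have htI : t ∈ Ioo (0 : ℝ) 1 := ⟨hsI.1.trans_lt ht.1, ht.2⟩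
        refine (HasDerivAt.fun_sum fun y _ => (hasDerivAt_score hγ hγ0 hb htI c y).mul
          (hK.2.2 s hsI t ht y x)).congr_deriv ?_
        simp only [hk, sub_mul, neg_mul]
        rw [Finset.sum_add_distrib, Finset.sum_sub_distrib, Finset.sum_neg_distrib, neg_add_eq_sub]
        congr 1
        simp only [Finset.mul_sum, Finset.sum_mul]
        rw [Finset.sum_comm]
        exact Finset.sum_congr rfl fun y _ => Finset.sum_congr rfl fun z _ => by ring
      have hVb : ∀ t ∈ Ioo s 1, |∑ y, k c t y * K s t y x| ≤ C₁ * A * Real.exp (l * (1 - t)) := by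
        intro t ht
        have htI : t ∈ Icc (0 : ℝ) 1 := ⟨hsI.1.trans ht.1.le, ht.2.le⟩
        refine abs_sum_mul_kernel_le hU hK hP (s := ⟨s, hsI⟩) (t := ⟨t, htI⟩) ht.1.le hq
          fun y => (hkb c y t htI).trans ?_
        rw [mul_assoc C₁ A]
        exact mul_le_mul_of_nonneg_left (hbound t htI) hC₁0
      have := abs_sub_le_of_hasDerivAt hsI hl (mul_nonneg hC₁0 hA) hVc hVd hVb
      rwa [hVs, hV1] at this
    calc Δ s ≤ ∑ _x : State N D, ∑ _d : Fin D, ∑ _n : ZMod N,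
          C₁ * (A / l * Real.exp (l * (1 - s))) := Finset.sum_le_sum fun x _ =>
          Finset.sum_le_sum fun d _ => Finset.sum_le_sum fun n _ => (hmain x d n).trans_eq (by ring)
      _ = C₂ * A / l * Real.exp (l * (1 - s)) := by
          simp only [← Finset.sum_mul, ← hC₂]; ring
  intro t ht
  funext x d n
  have h1 := hΔ0 t ht
  have h2 := (Finset.sum_eq_zero_iff_of_nonneg fun _ _ => Finset.sum_nonneg fun _ _ =>
    Finset.sum_nonneg fun _ _ => abs_nonneg _).mp h1 x (Finset.mem_univ x)
  have h3 := (Finset.sum_eq_zero_iff_of_nonneg fun _ _ =>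
    Finset.sum_nonneg fun _ _ => abs_nonneg _).mp h2 d (Finset.mem_univ d)
  have h4 := (Finset.sum_eq_zero_iff_of_nonneg fun _ _ => abs_nonneg _).mp h3 n (Finset.mem_univ n)
  exact sub_eq_zero.mp (abs_eq_zero.mp h4)

theorem ctrlFixedPoint_unique (hγ : ContinuousOn γ (Icc 0 1))
    (hγ0 : ∀ t ∈ Icc (0 : ℝ) 1, 0 ≤ γ t) (hγ1 : ∀ᵐ t ∂volume.restrict (Icc (0 : ℝ) 1), 0 < γ t)
    (hw : IntegrableOn w (Icc 0 1)) (hw1 : ∀ᵐ t ∂volume.restrict (Icc (0 : ℝ) 1), 0 < w t)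
    (hf : StrictConvexOn ℝ (Ioi 0) f) (hf' : DifferentiableOn ℝ f (Ioi 0))
    (hμ : IsProbVec μ) (hν : ∀ x, 0 < ν x) (hφ : ∀ x, 0 < φ x)
    (hΦ : IsCtrlFixedPoint γ w f μ ν (ratioCorrector φ) Φ) :
    ∀ t ∈ Icc (0 : ℝ) 1, Φ t = ratioController γ (fun x => ν x / φ x) t := by
  obtain ⟨hc, P, ⟨hprob, K, hK, hP⟩, hopt⟩ := hΦ
  exact eq_ratioController_of_optimal hγ hγ0 hγ1 hw hw1 hf hf' hμ hν hφ hc hK hP hopt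

/-- Chains with the same bounded rate have the same bridge loss. -/
theorem ctrlAMBridgeLoss_congr {U : ℝ → State N D → State N D → ℝ} {C : ℝ} (hU : IsBoundedRate U C)
    {P P' : Measure (PathSpace N D)} (hP : IsForwardCTMC μ U P) (hP' : IsForwardCTMC μ U P')
    (Ψ : ℝ → State N D → Fin D → ZMod N → ℝ) :
    ctrlAMBridgeLoss γ w f ν Φh P Ψ = ctrlAMBridgeLoss γ w f ν Φh P' Ψ := by
  obtain ⟨_, K, hK, hPK⟩ := hP
  obtain ⟨_, K', hK', hPK'⟩ := hP'
  have h1 : ∀ x₀ x₁, P {ω | ω 0 = x₀ ∧ ω 1 = x₁} = P' {ω | ω 0 = x₀ ∧ ω 1 = x₁} := by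
    intro x₀ x₁
    rw [HasKernel.pair hPK 1 x₀ x₁, HasKernel.pair hPK' 1 x₀ x₁, Icc.coe_one,
      forwardKernel_unique hU hK hK']
  unfold ctrlAMBridgeLoss
  refine lintegral_congr fun t => ?_
  congr 1
  rw [lintegral_endpoints P 0 1 fun x₀ x₁ => ∑ x, ENNReal.ofReal (refBridge γ t x x₀ x₁) *
      ctrlAMTerm f ν Φh Ψ t x x₁,
    lintegral_endpoints P' 0 1 fun x₀ x₁ => ∑ x, ENNReal.ofReal (refBridge γ t x x₀ x₁) *
      ctrlAMTerm f ν Φh Ψ t x x₁]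
  simp only [h1]

/-- With reference bridges the bridge loss is the plain loss, which reduces to
`ctrlFixedPoint_unique`. The measure `P'` in the fixed-point property may differ from `P`, but the
bridge loss depends only on the endpoint law, which the rate determines. -/
theorem ctrlBridgeFixedPoint_unique (hγ : ContinuousOn γ (Icc 0 1))
    (hγ0 : ∀ t ∈ Icc (0 : ℝ) 1, 0 ≤ γ t) (hγ1 : ∀ᵐ t ∂volume.restrict (Icc (0 : ℝ) 1), 0 < γ t)
    (hw : IntegrableOn w (Icc 0 1)) (hw1 : ∀ᵐ t ∂volume.restrict (Icc (0 : ℝ) 1), 0 < w t)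
    (hf : StrictConvexOn ℝ (Ioi 0) f) (hf' : DifferentiableOn ℝ f (Ioi 0))
    (hμ : IsProbVec μ) (hν : ∀ x, 0 < ν x) (hφ : ∀ x, 0 < φ x)
    (hΦ : IsCtrlBridgeFixedPoint γ w f μ ν (ratioCorrector φ) Φ)
    (hP : IsForwardCTMC μ (ctrlRate γ Φ) P) (hbr : HasRefBridges γ P) :
    ∀ t ∈ Icc (0 : ℝ) 1, Φ t = ratioController γ (fun x => ν x / φ x) t := by
  obtain ⟨hc, P', hP', hopt⟩ := hΦ
  obtain ⟨C, hU⟩ := exists_isBoundedRate hγ hγ0 hc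
  refine ctrlFixedPoint_unique hγ hγ0 hγ1 hw hw1 hf hf' hμ hν hφ ⟨hc, P, hP, fun Ψ hΨ => ?_⟩
  rw [← ctrlAMBridgeLoss_eq hbr, ← ctrlAMBridgeLoss_eq hbr, ctrlAMBridgeLoss_congr hU hP hP',
    ctrlAMBridgeLoss_congr hU hP hP']
  exact hopt Ψ hΨ

end FixedPoint

/-! ### The alternating scheme -/

section Scheme

variable {N D : ℕ} [NeZero N] {γ w f : ℝ → ℝ} {R : Measure (PathSpace N D)}
  {a b μ ν φ : State N D → ℝ}

theorem hasMarginal_zero_bridgeMixture (hγ0 : ∀ t ∈ Icc (0 : ℝ) 1, 0 ≤ γ t) (hR : IsUniformRef γ R)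
    (ha : ∀ x, 0 ≤ a x) (hb : ∀ x, 0 ≤ b x) (hab : ∀ x, a x * coevolve γ b 0 x = μ x) :
    HasMarginal (bridgeMixture R a b) 0 μ := fun x => by
  rw [bridgeMixture_single hγ0 hR ha hb, Icc.coe_zero, evolve_zero, hab]

theorem hasMarginal_one_bridgeMixture (hγ0 : ∀ t ∈ Icc (0 : ℝ) 1, 0 ≤ γ t) (hR : IsUniformRef γ R)
    (ha : ∀ x, 0 ≤ a x) (hb : ∀ x, 0 ≤ b x) (hab : ∀ x, evolve γ a 1 x * b x = ν x) :
    HasMarginal (bridgeMixture R a b) 1 ν := fun x => by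
  rw [bridgeMixture_single hγ0 hR ha hb, Icc.coe_one, coevolve_one, hab]

theorem coevolve_const_one (t : ℝ) (x : State N D) : coevolve γ (fun _ => 1) t x = 1 := by
  simp [coevolve, refKernel_sum]

theorem evolve_const_one (t : ℝ) (x : State N D) : evolve γ (fun _ => 1) t x = 1 := by
  simp only [evolve, mul_one, refKernel_comm _ _ x, refKernel_sum]

/-- The reference chain started from `μ`. -/
theorem isForwardCTMC_refRate (hγ : ContinuousOn γ (Icc 0 1))
    (hγ0 : ∀ t ∈ Icc (0 : ℝ) 1, 0 ≤ γ t) (hR : IsUniformRef γ R) (hμ : IsProbVec μ) :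
    IsForwardCTMC μ (refRate γ) (bridgeMixture R μ fun _ => 1) := by
  refine ⟨isProbabilityMeasure_bridgeMixture hγ0 hR hμ.1 (fun _ => zero_le_one) 0 ?_,
    refKernel γ, isForwardKernel_refKernel γ hγ, fun n t x ht ht0 => ?_⟩
  · simp only [Icc.coe_zero, evolve_zero, coevolve_const_one, mul_one, hμ.2]
  · refine (bridgeMixture_follow hγ0 hR hμ.1 (fun _ => zero_le_one)
      (fun i => (t i, x i)) ht).trans ?_
    simp only [ht0, Icc.coe_zero, evolve_zero, coevolve_const_one, mul_one]

/-- The initial factor of the path measure with terminal factor `ν / φ` and initial law `μ`. -/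
noncomputable def initialFactor (γ : ℝ → ℝ) (μ ν φ : State N D → ℝ) (x : State N D) : ℝ :=
  μ x / coevolve γ (fun x => ν x / φ x) 0 x

/-- The iterative proportional fitting iteration. -/
noncomputable def ipf (γ : ℝ → ℝ) (μ ν : State N D → ℝ) : ℕ → State N D → ℝ
  | 0 => fun _ => 1
  | k + 1 => evolve γ (initialFactor γ μ ν (ipf γ μ ν k)) 1

/-- The initial factors of the backward path measures of the iteration. -/
noncomputable def ipfFactor (γ : ℝ → ℝ) (μ ν : State N D → ℝ) : ℕ → State N D → ℝ
  | 0 => fun _ => 1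
  | k + 1 => initialFactor γ μ ν (ipf γ μ ν k)

theorem evolve_ipfFactor (γ : ℝ → ℝ) (μ ν : State N D → ℝ) (k : ℕ) (x : State N D) :
    evolve γ (ipfFactor γ μ ν k) 1 x = ipf γ μ ν k x := by
  cases k with
  | zero => exact evolve_const_one 1 x
  | succ k => rfl

theorem initialFactor_mul (hγ0 : ∀ t ∈ Icc (0 : ℝ) 1, 0 ≤ γ t) (hν : ∀ x, 0 < ν x)
    (hφ : ∀ x, 0 < φ x) (x : State N D) :
    initialFactor γ μ ν φ x * coevolve γ (fun x => ν x / φ x) 0 x = μ x :=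
  div_mul_cancel₀ _ (coevolve_pos hγ0 (fun x => div_pos (hν x) (hφ x))
    (left_mem_Icc.mpr zero_le_one) x).ne'

theorem initialFactor_nonneg (hγ0 : ∀ t ∈ Icc (0 : ℝ) 1, 0 ≤ γ t) (hμ : ∀ x, 0 ≤ μ x)
    (hν : ∀ x, 0 < ν x) (hφ : ∀ x, 0 < φ x) (x : State N D) : 0 ≤ initialFactor γ μ ν φ x :=
  div_nonneg (hμ x) (coevolve_pos hγ0 (fun x => div_pos (hν x) (hφ x))
    (left_mem_Icc.mpr zero_le_one) x).le

theorem exists_initialFactor_pos (hγ0 : ∀ t ∈ Icc (0 : ℝ) 1, 0 ≤ γ t) (hμ : IsProbVec μ)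
    (hν : ∀ x, 0 < ν x) (hφ : ∀ x, 0 < φ x) : ∃ x, 0 < initialFactor γ μ ν φ x := by
  obtain ⟨x, hx⟩ := exists_pos_of_sum_eq_one hμ.1 hμ.2
  exact ⟨x, div_pos hx (coevolve_pos hγ0 (fun x => div_pos (hν x) (hφ x))
    (left_mem_Icc.mpr zero_le_one) x)⟩

theorem ipf_pos (hγ : ContinuousOn γ (Icc 0 1)) (hγ0 : ∀ t ∈ Icc (0 : ℝ) 1, 0 ≤ γ t)
    (hγ1 : ∀ᵐ t ∂volume.restrict (Icc (0 : ℝ) 1), 0 < γ t) (hμ : IsProbVec μ)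
    (hν : ∀ x, 0 < ν x) (k : ℕ) : ∀ x, 0 < ipf γ μ ν k x := by
  induction k with
  | zero => exact fun _ => zero_lt_one
  | succ k ih =>
    exact evolve_pos hγ hγ0 hγ1 (initialFactor_nonneg hγ0 hμ.1 hν ih)
      (exists_initialFactor_pos hγ0 hμ hν ih) (right_mem_Ioc.mpr zero_lt_one)

theorem ipfFactor_nonneg (hγ : ContinuousOn γ (Icc 0 1)) (hγ0 : ∀ t ∈ Icc (0 : ℝ) 1, 0 ≤ γ t)
    (hγ1 : ∀ᵐ t ∂volume.restrict (Icc (0 : ℝ) 1), 0 < γ t) (hμ : IsProbVec μ)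
    (hν : ∀ x, 0 < ν x) (k : ℕ) (x : State N D) : 0 ≤ ipfFactor γ μ ν k x := by
  cases k with
  | zero => exact zero_le_one
  | succ k => exact initialFactor_nonneg hγ0 hμ.1 hν (ipf_pos hγ hγ0 hγ1 hμ hν k) x

theorem exists_ipfFactor_pos (hγ : ContinuousOn γ (Icc 0 1)) (hγ0 : ∀ t ∈ Icc (0 : ℝ) 1, 0 ≤ γ t)
    (hγ1 : ∀ᵐ t ∂volume.restrict (Icc (0 : ℝ) 1), 0 < γ t) (hμ : IsProbVec μ)
    (hν : ∀ x, 0 < ν x) (k : ℕ) : ∃ x, 0 < ipfFactor γ μ ν k x := by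
  cases k with
  | zero => exact ⟨0, zero_lt_one⟩
  | succ k => exact exists_initialFactor_pos hγ0 hμ hν (ipf_pos hγ hγ0 hγ1 hμ hν k)

/-- For `k > 0` the factor vanishes only where `μ` does, and there every initial factor vanishes;
for `k = 0` it is 1. This gives absolute continuity of the forward measure when `μ` has zeros. -/
theorem initialFactor_eq_zero_of_ipfFactor (hγ0 : ∀ t ∈ Icc (0 : ℝ) 1, 0 ≤ γ t)
    (hν : ∀ x, 0 < ν x) {k : ℕ} (hφ : ∀ x, 0 < ipf γ μ ν (k - 1) x) {x : State N D}
    (h : ipfFactor γ μ ν k x = 0) (φ : State N D → ℝ) : initialFactor γ μ ν φ x = 0 := by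
  cases k with
  | zero => exact absurd h one_ne_zero
  | succ k =>
    have h1 := initialFactor_mul (μ := μ) hγ0 hν hφ x
    rw [Nat.add_sub_cancel] at h1
    have h2 : initialFactor γ μ ν (ipf γ μ ν k) x = 0 := h
    rw [h2, zero_mul] at h1
    rw [initialFactor, ← h1, zero_div]

theorem isForwardCTMC_ratioController (hγ : ContinuousOn γ (Icc 0 1))
    (hγ0 : ∀ t ∈ Icc (0 : ℝ) 1, 0 ≤ γ t) (hR : IsUniformRef γ R) (hμ : IsProbVec μ)
    (hν : ∀ x, 0 < ν x) (hφ : ∀ x, 0 < φ x) :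
    IsForwardCTMC μ (ctrlRate γ (ratioController γ fun x => ν x / φ x))
      (bridgeMixture R (initialFactor γ μ ν φ) fun x => ν x / φ x) := by
  have h : ctrlRate γ (ratioController γ fun x => ν x / φ x) =
      doobRate γ (coevolve γ fun x => ν x / φ x) := funext fun t => ctrlRate_ratioController t
  rw [h]
  exact isForwardCTMC_bridgeMixture hγ hγ0 hR hμ (initialFactor_nonneg hγ0 hμ.1 hν hφ)
    (fun x => div_pos (hν x) (hφ x)) (initialFactor_mul hγ0 hν hφ)

/-- `klDiv_withDensity_le` bounds each divergence by the square of the uniform distance of the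
density from 1. -/
theorem tendsto_klDiv_withDensity {Ps : Measure (PathSpace N D)} [IsProbabilityMeasure Ps]
    {Q : ℕ → Measure (PathSpace N D)} (hQ : ∀ k, IsProbabilityMeasure (Q k))
    {g : ℕ → State N D → State N D → ℝ} {δ : ℕ → ℝ} (hδ : Tendsto δ atTop (𝓝 0))
    (hg0 : ∀ k x y, 0 ≤ g k x y) (hg : ∀ k x y, |g k x y - 1| ≤ δ k)
    (hPQ : ∀ k, Ps = (Q k).withDensity fun ω => ENNReal.ofReal (g k (ω 0) (ω 1))) :
    Tendsto (fun k => klDiv Ps (Q k)) atTop (𝓝 0) := by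
  have hle : ∀ k, klDiv Ps (Q k) ≤ ENNReal.ofReal (δ k ^ 2) := by
    intro k
    have hm : Measurable fun ω : PathSpace N D => g k (ω 0) (ω 1) :=
      (measurable_of_finite fun p : State N D × State N D => g k p.1 p.2).comp
        ((measurable_eval (N := N) (D := D) 0).prodMk (measurable_eval 1))
    have := hQ k
    have hfin : IsFiniteMeasure ((Q k).withDensity fun ω => ENNReal.ofReal (g k (ω 0) (ω 1))) :=
      hPQ k ▸ inferInstance
    have h := klDiv_withDensity_le (Q := Q k) hm (fun ω => hg0 k _ _) fun ω => hg k _ _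
    rwa [← hPQ k] at h
  refine tendsto_of_tendsto_of_tendsto_of_le_of_le tendsto_const_nhds ?_ (fun _ => zero_le) hle
  have h := ENNReal.tendsto_ofReal (hδ.pow 2)
  simpa using h

end Scheme

end DASBS

/-! ### Assembly of the alternating scheme. -/

theorem mainTheorem3 {N D : ℕ} [NeZero N] (γ w f : ℝ → ℝ) (μ ν : State N D → ℝ)
    (hγ : ContinuousOn γ (Icc 0 1)) (hγ0 : ∀ t ∈ Icc (0 : ℝ) 1, 0 ≤ γ t)
    (hγ1 : ∀ᵐ t ∂volume.restrict (Icc (0 : ℝ) 1), 0 < γ t)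
    (hw : IntegrableOn w (Icc 0 1)) (hw1 : ∀ᵐ t ∂volume.restrict (Icc (0 : ℝ) 1), 0 < w t)
    (hf : StrictConvexOn ℝ (Ioi 0) f) (hf' : DifferentiableOn ℝ f (Ioi 0))
    (hμ : IsProbVec μ) (hν : IsProbVec ν) (hν0 : ∀ x, 0 < ν x) :
    ∃ (Φ : ℕ → ℝ → State N D → Fin D → ZMod N → ℝ)
      (Φh : ℕ → State N D → Fin D → ZMod N → ℝ) (φh : ℕ → State N D → ℝ)
      (P Q : ℕ → Measure (PathSpace N D)),
      (∀ x d n, Φh 0 x d n = 1) ∧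
      (∀ k, (∀ x, 0 < φh k x) ∧ (∀ x d n, Φh k x d n = φh k (upd x d n) / φh k x) ∧
        IsInducedBy γ ν (φh k) (Q k)) ∧
      (∀ k, IsForwardCTMC μ (ctrlRate γ (Φ (k + 1))) (P (k + 1)) ∧
        IsCtrlFixedPoint γ w f μ ν (Φh k) (Φ (k + 1)) ∧
        (∀ Φ', IsCtrlFixedPoint γ w f μ ν (Φh k) Φ' → ∀ t ∈ Icc (0 : ℝ) 1, Φ' t = Φ (k + 1) t) ∧
        IsCtrlBridgeFixedPoint γ w f μ ν (Φh k) (Φ (k + 1)) ∧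
        HasRefBridges γ (P (k + 1)) ∧
        (∀ Φ' P', IsCtrlBridgeFixedPoint γ w f μ ν (Φh k) Φ' →
          IsForwardCTMC μ (ctrlRate γ Φ') P' → HasRefBridges γ P' →
          ∀ t ∈ Icc (0 : ℝ) 1, Φ' t = Φ (k + 1) t) ∧
        SolvesForwardHalfBridge μ (Q k) (P (k + 1))) ∧
      (∀ k, ((∃ Ψ, IsCorrector Ψ ∧ corrDMLoss γ w f (P (k + 1)) Ψ ≠ ⊤) →
          IsUniqueCorrectorMin (corrDMLoss γ w f (P (k + 1))) (Φh (k + 1))) ∧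
        ((∀ x, 0 < μ x) →
          IsUniqueCorrectorMin (corrAMLoss f μ (Φ (k + 1)) (P (k + 1))) (Φh (k + 1))) ∧
        SolvesBackwardHalfBridge ν (P (k + 1)) (Q (k + 1))) ∧
      ∃ (R : Measure (PathSpace N D)) (Φs : ℝ → State N D → Fin D → ZMod N → ℝ)
        (Ps : Measure (PathSpace N D)),
        IsForwardCTMC μ (refRate γ) R ∧ IsController Φs ∧ IsForwardCTMC μ (ctrlRate γ Φs) Ps ∧
        SolvesBridge μ ν R Ps ∧
        Tendsto (fun k => klDiv Ps (P k)) atTop (𝓝 0) ∧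
        Tendsto (fun k => klDiv Ps (Q k)) atTop (𝓝 0) := by
  obtain ⟨R, hR⟩ := exists_isUniformRef (N := N) (D := D) hγ hγ0
  have h0 : (0 : ℝ) ∈ Icc (0 : ℝ) 1 := left_mem_Icc.mpr zero_le_one
  set φ := ipf γ μ ν with hφdef
  set β : ℕ → State N D → ℝ := fun k x => ν x / φ k x with hβ
  set α : ℕ → State N D → ℝ := fun k => initialFactor γ μ ν (φ k) with hα
  set α' := ipfFactor γ μ ν with hα'
  -- Forward iterates are numbered from 1, so `P (k + 1)` has the factors `α k` and `β k`; `P 0`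
  -- merely repeats `P 1`. It shares `β k` with `Q k`, and `α k = α' (k + 1)` with `Q (k + 1)`.
  set P : ℕ → Measure (PathSpace N D) := fun k => bridgeMixture R (α (k - 1)) (β (k - 1)) with hP
  set Q : ℕ → Measure (PathSpace N D) := fun k => bridgeMixture R (α' k) (β k) with hQ
  have hφ0 : ∀ k x, 0 < φ k x := ipf_pos hγ hγ0 hγ1 hμ hν0
  have hβ0 : ∀ k x, 0 < β k x := fun k x => div_pos (hν0 x) (hφ0 k x)
  have hβ0' : ∀ k x, 0 ≤ β k x := fun k x => (hβ0 k x).le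
  have hα0 : ∀ k x, 0 ≤ α k x := fun k => initialFactor_nonneg hγ0 hμ.1 hν0 (hφ0 k)
  have hα1 : ∀ k, ∃ x, 0 < α k x := fun k => exists_initialFactor_pos hγ0 hμ hν0 (hφ0 k)
  have hα'0 : ∀ k x, 0 ≤ α' k x := ipfFactor_nonneg hγ hγ0 hγ1 hμ hν0
  have hαβ : ∀ k x, α k x * coevolve γ (β k) 0 x = μ x := fun k =>
    initialFactor_mul hγ0 hν0 (hφ0 k)
  have hα'β : ∀ k x, evolve γ (α' k) 1 x * β k x = ν x := fun k x => by
    rw [evolve_ipfFactor]; exact mul_div_cancel₀ _ (hφ0 k x).ne'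
  have hPctmc : ∀ k, IsForwardCTMC μ (ctrlRate γ (ratioController γ (β k))) (P (k + 1)) := fun k =>
    isForwardCTMC_ratioController hγ hγ0 hR hμ hν0 (hφ0 k)
  have hQctmc : ∀ k, IsBackwardCTMC ν (doobRate γ (evolve γ (α' k))) (Q k) := fun k =>
    isBackwardCTMC_bridgeMixture hγ hγ0 hγ1 hR hν (hα'0 k)
      (exists_ipfFactor_pos hγ hγ0 hγ1 hμ hν0 k) (hβ0' k) (hα'β k)
  have hPprob : ∀ k, IsProbabilityMeasure (bridgeMixture R (α k) (β k)) := fun k => (hPctmc k).1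
  have hQprob : ∀ k, IsProbabilityMeasure (Q k) := fun k => (hQctmc k).1
  have hbr : ∀ k, HasRefBridges γ (bridgeMixture R (α k) (β k)) := fun k =>
    hasRefBridges_bridgeMixture hγ hγ0 hγ1 hR (hα0 k) (hβ0' k)
  have hΦ : ∀ k, IsController (ratioController γ (β k)) := fun k =>
    isController_ratioController hγ hγ0 (hβ0 k)
  have hopt : ∀ k Ψ, IsController Ψ →
      ctrlAMLoss w f ν (ratioCorrector (φ k)) (bridgeMixture R (α k) (β k))
        (ratioController γ (β k)) ≤
      ctrlAMLoss w f ν (ratioCorrector (φ k)) (bridgeMixture R (α k) (β k)) Ψ := by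
    intro k Ψ hΨ
    have := hPprob k
    exact ctrlAMLoss_ratioController_le hγ hγ0 hf hf' hR (hα0 k) hν0 (hφ0 k) hΨ
  refine ⟨fun k => ratioController γ (β (k - 1)), fun k => ratioCorrector (φ k), φ, P, Q, ?_, ?_, ?_,
    ?_, ?_⟩
  · intro x d n
    exact div_one _
  · exact fun k => ⟨hφ0 k, fun x d n => rfl, α' k, hα'0 k, evolve_ipfFactor γ μ ν k, hQctmc k⟩
  · intro k
    have := hPprob k
    have := hQprob k
    refine ⟨hPctmc k, ⟨hΦ k, _, hPctmc k, hopt k⟩, fun Φ' hΦ' =>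
      ctrlFixedPoint_unique hγ hγ0 hγ1 hw hw1 hf hf' hμ hν0 (hφ0 k) hΦ',
      ⟨hΦ k, _, hPctmc k, fun Ψ hΨ => ?_⟩, hbr k, fun Φ' P' hΦ' hP' hbr' =>
      ctrlBridgeFixedPoint_unique hγ hγ0 hγ1 hw hw1 hf hf' hμ hν0 (hφ0 k) hΦ' hP' hbr', ?_⟩
    · have hbr' : HasRefBridges γ (P (k + 1)) := hbr k
      rw [ctrlAMBridgeLoss_eq hbr', ctrlAMBridgeLoss_eq hbr']
      exact hopt k Ψ hΨ
    · refine solvesForwardHalfBridge_withDensity (P := bridgeMixture R (α k) (β k))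
        (hasMarginal_zero_bridgeMixture hγ0 hR (hα0 k) (hβ0' k) (hαβ k))
        (g := fun x => ENNReal.ofReal (α k x / α' k x))
        (bridgeMixture_withDensity (g := fun x _ => α k x / α' k x) (hα'0 k) (hβ0' k)
          fun x y => ?_)
      -- Where the denominator of the density vanishes, the numerator does too.
      by_cases h : α' k x = 0
      · have h1 : α k x = 0 := initialFactor_eq_zero_of_ipfFactor hγ0 hν0 (hφ0 _) h _
        rw [h, h1]
        simp
      · field_simp
  · intro k
    have := hPprob k
    have := hQprob (k + 1)
    refine ⟨fun hfin => isUniqueCorrectorMin_corrDMLoss hγ hγ0 hγ1 hw hw1 hf hf' hR (hα0 k) (hα1 k)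
      (hβ0 k) hfin, fun hμ0 => isUniqueCorrectorMin_corrAMLoss hγ hγ0 hγ1 hf hf' hR hμ0 (hβ0 k)
      fun x => rfl, ?_⟩
    refine solvesBackwardHalfBridge_withDensity (P := bridgeMixture R (α k) (β k))
      (hasMarginal_one_bridgeMixture hγ0 hR (hα'0 _) (hβ0' _) (hα'β _))
      (g := fun y => ENNReal.ofReal (β k y / β (k + 1) y))
      (bridgeMixture_withDensity (g := fun _ y => β k y / β (k + 1) y) (hα'0 _) (hβ0' _)
        fun x y => ?_)
    have h1 : α' (k + 1) x = α k x := rfl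
    have h2 := (hβ0 (k + 1) y).ne'
    rw [h1]
    field_simp
  · set K : State N D → State N D → ℝ := fun y x => refKernel γ 0 1 y x with hK
    have hK0 : ∀ y x, 0 < K y x :=
      refKernel_pos hγ hγ0 hγ1 h0 (right_mem_Icc.mpr zero_le_one) zero_lt_one
    obtain ⟨bs, hbs, hfix⟩ := exists_sinkhorn_fixedPoint hK0 hμ.2 hν0 hν.2
    -- `β (k + 1)` is by definition the Sinkhorn step of `β k`, since `coevolve γ b 0` is the column
    -- sum for `K` and `evolve γ a 1` is `K` applied to `a`.
    obtain ⟨δ, hδ, hδb⟩ := sinkhorn_converges hK0 hμ.1 hμ.2 hν0 hbs hfix (b := β) (hβ0 0)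
      fun k => rfl
    have hcs : ∀ x, 0 < coevolve γ bs 0 x := coevolve_pos hγ0 hbs h0
    have hcβ : ∀ k x, 0 < coevolve γ (β k) 0 x := fun k => coevolve_pos hγ0 (hβ0 k) h0
    set a : State N D → ℝ := fun x => μ x / coevolve γ bs 0 x with ha
    have ha0 : ∀ x, 0 ≤ a x := fun x => div_nonneg (hμ.1 x) (hcs x).le
    have hab : ∀ x, a x * coevolve γ bs 0 x = μ x := fun x => div_mul_cancel₀ _ (hcs x).ne'
    have hPs : IsForwardCTMC μ (ctrlRate γ (ratioController γ bs)) (bridgeMixture R a bs) := by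
      have h : ctrlRate γ (ratioController γ bs) = doobRate γ (coevolve γ bs) :=
        funext fun t => ctrlRate_ratioController t
      rw [h]
      exact isForwardCTMC_bridgeMixture hγ hγ0 hR hμ ha0 hbs hab
    have hRμ := isForwardCTMC_refRate hγ hγ0 hR hμ
    have := hPs.1
    have := hRμ.1
    refine ⟨bridgeMixture R μ fun _ => 1, ratioController γ bs, bridgeMixture R a bs, hRμ,
      isController_ratioController hγ hγ0 hbs, hPs, ?_, ?_, ?_⟩
    · refine solvesBridge_of_product_density
        (hasMarginal_zero_bridgeMixture hγ0 hR ha0 (fun x => (hbs x).le) hab)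
        (hasMarginal_one_bridgeMixture hγ0 hR ha0 (fun x => (hbs x).le) fun x => ?_)
        (fun x => inv_pos.mpr (hcs x)) hbs
        (bridgeMixture_withDensity (g := fun x y => (coevolve γ bs 0 x)⁻¹ * bs y) hμ.1
          (fun _ => zero_le_one) fun x y => ?_)
      · rw [mul_comm]
        exact hfix x
      · rw [ha]
        ring
    · refine (tendsto_add_atTop_iff_nat 1).mp (tendsto_klDiv_withDensity
        (Q := fun k => P (k + 1)) hPprob hδ
        (g := fun k x y => colSum K (β k) x / colSum K bs x * (bs y / β k y))
        (fun k x y => (mul_pos (div_pos (hcβ k x) (hcs x)) (div_pos (hbs y) (hβ0 k y))).le)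
        (fun k x y => (hδb k x y).1)
        fun k => bridgeMixture_withDensity (g := fun x y => colSum K (β k) x / colSum K bs x *
          (bs y / β k y)) (hα0 k) (hβ0' k) fun x y => ?_)
      change μ x / colSum K bs x * bs y = μ x / colSum K (β k) x * β k y * _
      have h1 : colSum K (β k) x ≠ 0 := (hcβ k x).ne'
      have h2 : colSum K bs x ≠ 0 := (hcs x).ne'
      have h3 := (hβ0 k y).ne'
      field_simp
    -- `Q (k + 1)` has the initial factor of `P (k + 1)` but the terminal factor `β (k + 1)`, which
    -- is why the second estimate of `sinkhorn_converges` is needed.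
    · refine (tendsto_add_atTop_iff_nat 1).mp (tendsto_klDiv_withDensity
        (Q := fun k => Q (k + 1)) (fun k => hQprob (k + 1)) hδ
        (g := fun k x y => colSum K (β k) x / colSum K bs x * (bs y / β (k + 1) y))
        (fun k x y => (mul_pos (div_pos (hcβ k x) (hcs x)) (div_pos (hbs y) (hβ0 (k + 1) y))).le)
        (fun k x y => (hδb k x y).2)
        fun k => bridgeMixture_withDensity (g := fun x y => colSum K (β k) x / colSum K bs x *
          (bs y / β (k + 1) y)) (hα'0 (k + 1)) (hβ0' (k + 1)) fun x y => ?_)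
      change μ x / colSum K bs x * bs y = μ x / colSum K (β k) x * β (k + 1) y * _
      have h1 : colSum K (β k) x ≠ 0 := (hcβ k x).ne'
      have h2 : colSum K bs x ≠ 0 := (hcs x).ne'
      have h3 := (hβ0 (k + 1) y).ne'
      field_simp
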